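/- Let $M$ be a connected, paracompact, Hausdorff smooth manifold of dimension $m$, let $r$ be an integer with $1\le r<[m/2]$, and let $\eta=\mathrm{diag}(-1,1,\dots,1)$, with entries $\eta_{ij}=\eta^{ij}$. Repeated indices are summed. **Bundles.** Let $\tau:LM\to M$ be the frame bundle and $J^1\tau$ the bundle of $1$-jets of its sections, with coordinates $(x^\mu,e^\mu_k,e^\mu_{k\sigma})$ induced by charts of $M$; let $(e^k_\mu)$ be the inverse matrix of $(e^\mu_k)$. Let $T_0\subset J^1\tau$ be the torsion-free subbundle $\{e^\mu_{i\nu}e^i_\sigma=e^\mu_{i\sigma}e^i_\nu\}$, with projection $\tau_1:T_0\to M$. **Forms.** On $T_0$ consider the canonical forms $\theta^k=e^k_\mu\,dx^\mu$, the universal connection $\omega^i_j=e^i_\mu(de^\mu_j-e^\mu_{j\sigma}dx^\sigma)$, the universal curvature $\Omega^i_j=d\omega^i_j+\omega^i_k\wedge\omega^k_j$, $\Omega^{ab}=\eta^{bq}\Omega^a_q$, the metricity forms $(\omega_{\mathfrak p})^i_j=\tfrac12(\omega^i_j+\eta_{jp}\,\omega^p_q\,\eta^{qi})$, and the Sparling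 forms $$\theta_{i_1\dots i_p}=\frac1{(m-p)!}\,\varepsilon_{i_1\dots i_m}\,\theta^{i_{p+1}}\wedge\dots\wedge\theta^{i_m}.$$ For $I=(i_1,\dots,i_r)$, $J=(j_1,\dots,j_r)$ put $\theta_{IJ}=\theta_{i_1\dots i_rj_1\dots j_r}$, $I'=(i_2,\dots,i_r)$, $J'=(j_2,\dots,j_r)$, $\Omega^{IJ}=\Omega^{i_1j_1}\wedge\dots\wedge\Omega^{i_rj_r}$ and $\Omega^{I'J'}=\Omega^{i_2j_2}\wedge\dots\wedge\Omega^{i_rj_r}$ (equal to $1$ if $r=1$). The degree-$r$ Lovelock Lagrangian is the $m$-form $\lambda_L=\theta_{IJ}\wedge\Omega^{IJ}$. **Variational problem.** Let $\mathcal I_L$ be the exterior differential system (ideal closed under $d$) generated by the metricity forms. A vector field $Z$, defined on the part of $T_0$ over an open subset of $M$, is an infinitesimal symmetry of $\mathcal I_L$ if $\mathcal L_Z\mathcal I_L\subset\mathcal I_L$. A smooth section $\Sigma:M\to T_0$ is an extremal of the Griffiths variational problem $(T_0,\lambda_L,\mathcal I_L)$ if 1. $\Sigma^*\alpha=0$ for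 all $\alpha\in\mathcal I_L$, and 2. for every coordinate domain $U\subset M$, every compact $K\subset U$ and every smooth $\tau_1$-vertical infinitesimal symmetry $Z$ of $\mathcal I_L$ over $U$ that vanishes outside $\tau_1^{-1}(K)$, $$\frac{d}{dt}\Big|_{t=0}\int_K(\phi_t\circ\Sigma)^*\lambda_L=0,$$ where $\phi_t$ is the local flow of $Z$ (the integral being taken in the coordinates of $U$). **Theorem.** If $\Sigma:M\to T_0$ is an extremal of $(T_0,\lambda_L,\mathcal I_L)$, then for all $k,i\in\{1,\dots,m\}$ $$\Sigma^*\Big[\big(\eta^{kq}\,\theta_{I\,i\,j_2\dots j_r}-\tfrac1{2r}\,\eta^{j_1q}\,\delta^k_i\,\theta_{IJ}\big)\wedge\Omega^{i_1}_q\wedge\Omega^{I'J'}\Big]=0,$$ with summation over $q$, $I$, $J$ (over $q$, $I$, $J'$ in the first term). -/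

import Mathlib

open Set Filter Topology Manifold
open scoped ContDiff

noncomputable section

namespace Lovelock

/-! ## Differential forms on a normed space -/

section Forms

variable {X : Type*} [NormedAddCommGroup X] [NormedSpace ℝ X]

/-- The `k`-linear form times the `l`-linear form:
`(v₁, …, v_{k+l}) ↦ α (v₁, …, v_k) * β (v_{k+1}, …, v_{k+l})`. -/
def mulForm {k l : ℕ} (α : X [⋀^Fin k]→L[ℝ] ℝ) (β : X [⋀^Fin l]→L[ℝ] ℝ) :
    ContinuousMultilinearMap ℝ (fun _ : Fin (k + l) => X) ℝ where
  toFun v := α (fun a => v (Fin.castAdd l a)) * β (fun b => v (Fin.natAdd k b))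
  map_update_add' := by
    intro inst v i x y
    obtain rfl : inst = instDecidableEqFin (k + l) := Subsingleton.elim _ _
    induction i using Fin.addCases with
    | left i =>
      have h1 : ∀ z : X, (fun a : Fin k => Function.update v (Fin.castAdd l i) z (Fin.castAdd l a))
          = Function.update (fun a : Fin k => v (Fin.castAdd l a)) i z := by
        intro z; funext a
        by_cases h : a = i
        · subst h; simp
        · rw [Function.update_of_ne h, Function.update_of_ne]
          intro h'; exact h (Fin.castAdd_injective _ _ h')
      have h2 : ∀ z : X, (fun b : Fin l => Function.update v (Fin.castAdd l i) z (Fin.natAdd k b))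
          = (fun b : Fin l => v (Fin.natAdd k b)) := by
        intro z; funext b
        rw [Function.update_of_ne]
        intro h'; have := congrArg Fin.val h'; simp at this; omega
      rw [h1, h1, h1, h2, h2, h2, α.map_update_add, add_mul]
    | right i =>
      have h1 : ∀ z : X, (fun b : Fin l => Function.update v (Fin.natAdd k i) z (Fin.natAdd k b))
          = Function.update (fun b : Fin l => v (Fin.natAdd k b)) i z := by
        intro z; funext a
        by_cases h : a = i
        · subst h; simp
        · rw [Function.update_of_ne h, Function.update_of_ne]
          intro h'; exact h (Fin.natAdd_injective _ _ h')
      have h2 : ∀ z : X, (fun a : Fin k => Function.update v (Fin.natAdd k i) z (Fin.castAdd l a))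
          = (fun a : Fin k => v (Fin.castAdd l a)) := by
        intro z; funext b
        rw [Function.update_of_ne]
        intro h'; have := congrArg Fin.val h'; simp at this; omega
      rw [h1, h1, h1, h2, h2, h2, β.map_update_add, mul_add]
  map_update_smul' := by
    intro inst v i c x
    obtain rfl : inst = instDecidableEqFin (k + l) := Subsingleton.elim _ _
    induction i using Fin.addCases with
    | left i =>
      have h1 : ∀ z : X, (fun a : Fin k => Function.update v (Fin.castAdd l i) z (Fin.castAdd l a))
          = Function.update (fun a : Fin k => v (Fin.castAdd l a)) i z := by
        intro z; funext a
        by_cases h : a = i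
        · subst h; simp
        · rw [Function.update_of_ne h, Function.update_of_ne]
          intro h'; exact h (Fin.castAdd_injective _ _ h')
      have h2 : ∀ z : X, (fun b : Fin l => Function.update v (Fin.castAdd l i) z (Fin.natAdd k b))
          = (fun b : Fin l => v (Fin.natAdd k b)) := by
        intro z; funext b
        rw [Function.update_of_ne]
        intro h'; have := congrArg Fin.val h'; simp at this; omega
      rw [h1, h1, h2, h2, α.map_update_smul, smul_mul_assoc]
    | right i =>
      have h1 : ∀ z : X, (fun b : Fin l => Function.update v (Fin.natAdd k i) z (Fin.natAdd k b))
          = Function.update (fun b : Fin l => v (Fin.natAdd k b)) i z := by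
        intro z; funext a
        by_cases h : a = i
        · subst h; simp
        · rw [Function.update_of_ne h, Function.update_of_ne]
          intro h'; exact h (Fin.natAdd_injective _ _ h')
      have h2 : ∀ z : X, (fun a : Fin k => Function.update v (Fin.natAdd k i) z (Fin.castAdd l a))
          = (fun a : Fin k => v (Fin.castAdd l a)) := by
        intro z; funext b
        rw [Function.update_of_ne]
        intro h'; have := congrArg Fin.val h'; simp at this; omega
      rw [h1, h1, h2, h2, β.map_update_smul, mul_smul_comm]
  cont := by
    refine Continuous.mul ?_ ?_
    · exact α.cont.comp (continuous_pi fun a => continuous_apply _)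
    · exact β.cont.comp (continuous_pi fun a => continuous_apply _)

/-- The exterior product of alternating forms,
`(α ∧ β)(v₁, …, v_{k+l}) =
  1/(k! l!) ∑_σ sgn σ α(v_{σ 1}, …, v_{σ k}) β(v_{σ (k+1)}, …, v_{σ (k+l)})`. -/
def wedge {k l : ℕ} (α : X [⋀^Fin k]→L[ℝ] ℝ) (β : X [⋀^Fin l]→L[ℝ] ℝ) :
    X [⋀^Fin (k + l)]→L[ℝ] ℝ :=
  ((k.factorial : ℝ) * (l.factorial : ℝ))⁻¹ •
    ContinuousMultilinearMap.alternatization (mulForm α β)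

/-- Differential `k`-forms on `X`. -/
abbrev DForm (X : Type*) [NormedAddCommGroup X] [NormedSpace ℝ X] (k : ℕ) : Type _ :=
  X → X [⋀^Fin k]→L[ℝ] ℝ

/-- The exterior product of differential forms. -/
def DForm.wedge {k l : ℕ} (α : DForm X k) (β : DForm X l) : DForm X (k + l) :=
  fun p => Lovelock.wedge (α p) (β p)

/-- A field of linear functionals, regarded as a differential `1`-form. -/
def oneForm (f : X → X →L[ℝ] ℝ) : DForm X 1 :=
  fun p => ContinuousAlternatingMap.ofSubsingleton ℝ X ℝ (0 : Fin 1) (f p)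

/-- The exterior product `α₁ ∧ … ∧ α_q` of `q` one-forms. -/
def wedgeOnes : {q : ℕ} → (Fin q → DForm X 1) → DForm X q
  | 0, _ => fun _ => ContinuousAlternatingMap.constOfIsEmpty ℝ X (Fin 0) 1
  | _ + 1, α => (wedgeOnes (fun a => α (Fin.castSucc a))).wedge (α (Fin.last _))

/-- The exterior product `α₁ ∧ … ∧ α_q` of `q` two-forms. -/
def wedgeTwos : {q : ℕ} → (Fin q → DForm X 2) → DForm X (2 * q)
  | 0, _ => fun _ => ContinuousAlternatingMap.constOfIsEmpty ℝ X (Fin 0) 1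
  | _ + 1, α => (wedgeTwos (fun a => α (Fin.castSucc a))).wedge (α (Fin.last _))

/-- The exterior derivative. -/
def DForm.d {k : ℕ} (α : DForm X k) : DForm X (k + 1) := extDeriv α

/-- The contraction `Z ⌟ α`. -/
def contract {k : ℕ} (Z : X → X) (α : DForm X (k + 1)) : DForm X k :=
  fun p => (α p).curryLeft (Z p)

/-- The Lie derivative `𝓛_Z α = Z ⌟ dα + d (Z ⌟ α)`; the second term is absent on functions. -/
def lieDeriv (Z : X → X) : {k : ℕ} → DForm X k → DForm X k
  | 0, α => contract Z α.d
  | _ + 1, α => contract Z α.d + (contract Z α).d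

/-- The pullback `s^* α` of a differential form along a map `s`. -/
def pullback {Y : Type*} [NormedAddCommGroup Y] [NormedSpace ℝ Y] {k : ℕ} (s : Y → X)
    (α : DForm X k) : DForm Y k :=
  fun y => (α (s y)).compContinuousLinearMap (fderiv ℝ s y)

/-- The smallest exterior differential system on the open set `W` that contains the one-forms
of the family `g`: the smallest family of smooth forms on `W` closed under sums, exterior products
with smooth forms on `W`, and the exterior derivative. Forms on `W` are represented by forms on the
ambient space, and two representatives that agree on `W` are identified. -/
inductive DiffIdeal (W : Set X) {ι : Type*} (g : ι → DForm X 1) : (k : ℕ) → DForm X k → Prop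
  | gen (a : ι) : DiffIdeal W g 1 (g a)
  | zero (k : ℕ) : DiffIdeal W g k 0
  | add {k : ℕ} {α β : DForm X k} :
      DiffIdeal W g k α → DiffIdeal W g k β → DiffIdeal W g k (α + β)
  | wedge_right {k l : ℕ} {α : DForm X k} {β : DForm X l} :
      DiffIdeal W g k α → ContDiffOn ℝ ∞ β W → DiffIdeal W g (k + l) (α.wedge β)
  | wedge_left {k l : ℕ} {α : DForm X k} {β : DForm X l} :
      DiffIdeal W g k α → ContDiffOn ℝ ∞ β W → DiffIdeal W g (l + k) (β.wedge α)
  | d {k : ℕ} {α : DForm X k} : DiffIdeal W g k α → DiffIdeal W g (k + 1) α.d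
  | congr {k : ℕ} {α β : DForm X k} : DiffIdeal W g k α → EqOn α β W → DiffIdeal W g k β

/-- `Z` is an infinitesimal symmetry on `W` of the exterior differential system generated
by `g`: `𝓛_Z 𝓘 ⊆ 𝓘`. -/
def IsInfinitesimalSymmetry (W : Set X) {ι : Type*} (g : ι → DForm X 1) (Z : X → X) : Prop :=
  ∀ (k : ℕ) (α : DForm X k), DiffIdeal W g k α → DiffIdeal W g k (lieDeriv Z α)

end Forms

/-! ## The bundles `LM`, `J¹τ` and `T₀` -/

/-- The model space of an `m`-dimensional manifold. -/
abbrev E (m : ℕ) := EuclideanSpace ℝ (Fin m)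

section Bundles

variable (m : ℕ) {M : Type*} [TopologicalSpace M] [ChartedSpace (E m) M]
  [IsManifold (𝓡 m) ∞ M]

/-- Smooth local sections near `x` of the frame bundle `τ : LM → M`, whose fibre over `y` is
`Iso(ℝᵐ, T_y M)`. (The values away from `x` play no role.) -/
def LocalFrame (x : M) : Type _ :=
  {s : (y : M) → (Fin m → ℝ) ≃ₗ[ℝ] TangentSpace (𝓡 m) y //
    ∃ U ∈ 𝓝 x, ∀ k : Fin m, ContMDiffOn (𝓡 m) (𝓡 m).tangent ∞
      (fun y => (⟨y, s y (Pi.single k 1)⟩ : TangentBundle (𝓡 m) M)) U}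

variable {m}

/-- The components `e^μ_k` of a frame field in the chart `φ`, as functions on the range of `φ`:
`s_k = e^μ_k ∂/∂x^μ`. -/
def frameCoord (φ : OpenPartialHomeomorph M (E m))
    (s : (y : M) → (Fin m → ℝ) ≃ₗ[ℝ] TangentSpace (𝓡 m) y) (p : E m) (μ k : Fin m) : ℝ :=
  (show E m from mfderiv (𝓡 m) (𝓡 m) φ (φ.symm p) (s (φ.symm p) (Pi.single k 1))) μ

/-- The derivatives `e^μ_{kσ} = ∂ e^μ_k / ∂ x^σ` of the components of a frame field in a chart. -/
def frameDeriv (φ : OpenPartialHomeomorph M (E m))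
    (s : (y : M) → (Fin m → ℝ) ≃ₗ[ℝ] TangentSpace (𝓡 m) y) (p : E m) (μ k σ : Fin m) : ℝ :=
  fderiv ℝ (fun q => frameCoord φ s q μ k) p (EuclideanSpace.single σ 1)

variable (m) in
/-- First-order contact at `x` of local sections of the frame bundle. -/
def jetSetoid (x : M) : Setoid (LocalFrame m x) where
  r s s' := ∀ φ ∈ IsManifold.maximalAtlas (𝓡 m) ∞ M, x ∈ φ.source →
    frameCoord φ s.1 (φ x) = frameCoord φ s'.1 (φ x) ∧
      frameDeriv φ s.1 (φ x) = frameDeriv φ s'.1 (φ x)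
  iseqv :=
    { refl := fun _ _ _ _ => ⟨rfl, rfl⟩
      symm := fun h φ hφ hx => ⟨(h φ hφ hx).1.symm, (h φ hφ hx).2.symm⟩
      trans := fun h h' φ hφ hx =>
        ⟨(h φ hφ hx).1.trans (h' φ hφ hx).1, (h φ hφ hx).2.trans (h' φ hφ hx).2⟩ }

variable (m) in
/-- The fibre over `x` of `τ₁ : J¹τ → M`, the bundle of `1`-jets of sections of `LM → M`. -/
def J1 (x : M) : Type _ := Quotient (jetSetoid m x)

/-- The fibre coordinates `e^μ_k` on `J¹τ` induced by the chart `φ`. -/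
def J1.e {x : M} (φ : OpenPartialHomeomorph M (E m))
    (hφ : φ ∈ IsManifold.maximalAtlas (𝓡 m) ∞ M) (hx : x ∈ φ.source) (ρ : J1 m x) :
    Fin m → Fin m → ℝ :=
  Quotient.lift (fun s : LocalFrame m x => frameCoord φ s.1 (φ x))
    (fun _ _ h => (h φ hφ hx).1) ρ

/-- The fibre coordinates `e^μ_{kσ}` on `J¹τ` induced by the chart `φ`. -/
def J1.eDeriv {x : M} (φ : OpenPartialHomeomorph M (E m))
    (hφ : φ ∈ IsManifold.maximalAtlas (𝓡 m) ∞ M) (hx : x ∈ φ.source) (ρ : J1 m x) :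
    Fin m → Fin m → Fin m → ℝ :=
  Quotient.lift (fun s : LocalFrame m x => frameDeriv φ s.1 (φ x))
    (fun _ _ h => (h φ hφ hx).2) ρ

/-- The inverse matrix `e^k_μ` of `e^μ_k`. -/
def coframe (e : Fin m → Fin m → ℝ) (k μ : Fin m) : ℝ := (Matrix.of e)⁻¹ k μ

variable (m) in
/-- The fibre over `x` of the torsion-free subbundle `T₀ ⊆ J¹τ`, cut out by the equations
`e^μ_{iν} e^i_σ - e^μ_{iσ} e^i_ν = 0`. -/
def T0 (x : M) : Type _ :=
  {ρ : J1 m x // ∀ (φ : OpenPartialHomeomorph M (E m))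
    (hφ : φ ∈ IsManifold.maximalAtlas (𝓡 m) ∞ M) (hx : x ∈ φ.source) (μ ν σ : Fin m),
    ∑ i, (ρ.eDeriv φ hφ hx μ i ν * coframe (ρ.e φ hφ hx) i σ -
      ρ.eDeriv φ hφ hx μ i σ * coframe (ρ.e φ hφ hx) i ν) = 0}

variable (m) in
/-- Arrays `Γ^μ_{νσ}` symmetric in the lower indices. -/
def SymArray : Submodule ℝ (Fin m → Fin m → Fin m → ℝ) where
  carrier := {Γ | ∀ μ ν σ, Γ μ ν σ = Γ μ σ ν}
  add_mem' := fun ha hb μ ν σ => by simp [ha μ ν σ, hb μ ν σ]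
  zero_mem' := fun _ _ _ => rfl
  smul_mem' := fun c _ ha μ ν σ => by simp [ha μ ν σ]

variable (m) in
/-- The vector space of coordinates `(x^μ, e^μ_k, Γ^μ_{νσ})` on `T₀`, with
`Γ^μ_{νσ} = - e^k_ν e^μ_{kσ}` symmetric in the lower indices. -/
abbrev Coord := E m × (Fin m → Fin m → ℝ) × SymArray m

/-- The coordinates `(x^μ, e^μ_k, Γ^μ_{νσ})` of a point of `T₀` in the chart induced by `φ`. -/
def T0.coord {x : M} (φ : OpenPartialHomeomorph M (E m))
    (hφ : φ ∈ IsManifold.maximalAtlas (𝓡 m) ∞ M) (hx : x ∈ φ.source) (ρ : T0 m x) : Coord m :=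
  (φ x, ρ.1.e φ hφ hx,
    ⟨fun μ ν σ => -∑ k, coframe (ρ.1.e φ hφ hx) k ν * ρ.1.eDeriv φ hφ hx μ k σ, by
      intro μ ν σ
      have h := ρ.2 φ hφ hx μ ν σ
      rw [Finset.sum_sub_distrib, sub_eq_zero] at h
      simp only [mul_comm (coframe _ _ _)]
      rw [h]⟩)

/-- The range `φ.target × GL(m) × {Γ symmetric}` of the chart of `T₀` induced by `φ`. -/
def coordDomain (φ : OpenPartialHomeomorph M (E m)) : Set (Coord m) :=
  {v | v.1 ∈ φ.target ∧ (Matrix.of v.2.1).det ≠ 0}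

open Classical in
/-- The expression of a section of `T₀ → M` in the coordinates induced by `φ`. -/
def localRep (φ : OpenPartialHomeomorph M (E m))
    (hφ : φ ∈ IsManifold.maximalAtlas (𝓡 m) ∞ M) (S : (x : M) → T0 m x) (p : E m) : Coord m :=
  if hp : p ∈ φ.target then (S (φ.symm p)).coord φ hφ (φ.map_target hp) else 0

variable (m M) in
/-- Smooth sections of `τ₁ : T₀ → M`. -/
structure T0Section where
  /-- the underlying section -/
  toFun : (x : M) → T0 m x
  /-- smoothness, in the coordinates of `T₀` -/
  smooth : ∀ (φ : OpenPartialHomeomorph M (E m))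
    (hφ : φ ∈ IsManifold.maximalAtlas (𝓡 m) ∞ M), ContDiffOn ℝ ∞ (localRep φ hφ toFun) φ.target

end Bundles

/-! ## The canonical forms in the coordinates of `T₀` -/

section CanonicalForms

variable {m : ℕ}

/-- The entries of `η = diag(-1, 1, …, 1)`; this matrix is its own inverse, so these are
both `η_{ij}` and `η^{ij}`. -/
def eta (i j : Fin m) : ℝ := if i = j then (if (i : ℕ) = 0 then -1 else 1) else 0

/-- The coordinate differential `dx^σ`. -/
def dx (σ : Fin m) : Coord m →L[ℝ] ℝ :=
  (EuclideanSpace.proj σ : E m →L[ℝ] ℝ).comp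
    (ContinuousLinearMap.fst ℝ (E m) ((Fin m → Fin m → ℝ) × SymArray m))

/-- The coordinate differential `de^μ_j`. -/
def de (μ j : Fin m) : Coord m →L[ℝ] ℝ :=
  ((ContinuousLinearMap.proj j : (Fin m → ℝ) →L[ℝ] ℝ).comp
    (ContinuousLinearMap.proj μ : (Fin m → Fin m → ℝ) →L[ℝ] (Fin m → ℝ))).comp
  ((ContinuousLinearMap.fst ℝ (Fin m → Fin m → ℝ) (SymArray m)).comp
    (ContinuousLinearMap.snd ℝ (E m) ((Fin m → Fin m → ℝ) × SymArray m)))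

/-- The canonical form `θ^k = e^k_μ dx^μ`. -/
def theta (k : Fin m) : DForm (Coord m) 1 :=
  oneForm fun v => ∑ μ, coframe v.2.1 k μ • dx μ

/-- The jet coordinate `e^μ_{jσ} = - Γ^μ_{νσ} e^ν_j` as a function on `T₀`. -/
def jetCoord (v : Coord m) (μ j σ : Fin m) : ℝ := -∑ ν, v.2.2.1 μ ν σ * v.2.1 ν j

/-- The universal connection form `ω^i_j = e^i_μ (de^μ_j - e^μ_{jσ} dx^σ)`. -/
def omega (i j : Fin m) : DForm (Coord m) 1 :=
  oneForm fun v => ∑ μ, coframe v.2.1 i μ • (de μ j - ∑ σ, jetCoord v μ j σ • dx σ)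

/-- The universal curvature `Ω^i_j = dω^i_j + ω^i_k ∧ ω^k_j`. -/
def curv (i j : Fin m) : DForm (Coord m) 2 :=
  (omega i j).d + ∑ k : Fin m, (omega i k).wedge (omega k j)

/-- The curvature with raised index, `Ω^{ab} = η^{bq} Ω^a_q`. -/
def curvUp (a b : Fin m) : DForm (Coord m) 2 := ∑ q, eta b q • curv a q

/-- The metricity forms, the components
`(ω_𝔭)^i_j = ½ (ω^i_j + η_{jp} ω^p_q η^{qi})` of the projection of `ω` to `𝔭`. -/
def omegaP (ij : Fin m × Fin m) : DForm (Coord m) 1 :=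
  (1 / 2 : ℝ) • (omega ij.1 ij.2 + ∑ p, ∑ q, (eta ij.2 p * eta q ij.1) • omega p q)

/-- The Levi-Civita symbol `ε_{f 1 … f m}`, extended by zero to strings of another length. -/
def leviCivita {n : ℕ} (f : Fin n → Fin m) : ℝ :=
  if h : n = m then
    ∑ σ : Equiv.Perm (Fin m),
      if ∀ a : Fin n, f a = σ (Fin.cast h a) then ((Equiv.Perm.sign σ : ℤ) : ℝ) else 0
  else 0

/-- The Sparling forms
`θ_{i₁…i_p} = 1/(m-p)! ε_{i₁…i_p i_{p+1}…i_m} θ^{i_{p+1}} ∧ … ∧ θ^{i_m}`, for `p ≤ m`. -/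
def sparling {p : ℕ} (i : Fin p → Fin m) : DForm (Coord m) (m - p) :=
  ((m - p).factorial : ℝ)⁻¹ •
    ∑ s : Fin (m - p) → Fin m, leviCivita (Fin.append i s) • wedgeOnes fun a => theta (s a)

/-- `Ω^{IJ} = Ω^{i₁j₁} ∧ … ∧ Ω^{i_n j_n}`. -/
def curvProd {n : ℕ} (I J : Fin n → Fin m) : DForm (Coord m) (2 * n) :=
  wedgeTwos fun a => curvUp (I a) (J a)

/-- The degree-`r` Lovelock Lagrangian `λ_L = θ_{IJ} ∧ Ω^{IJ}`. It is an `m`-form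
when `2 r ≤ m`. -/
def lagrangian (m r : ℕ) : DForm (Coord m) (m - (r + r) + 2 * r) :=
  ∑ I : Fin r → Fin m, ∑ J : Fin r → Fin m, (sparling (Fin.append I J)).wedge (curvProd I J)

/-- `θ_{i I' j J'}`: the Sparling form `θ_{IJ}` for `I = (i, I')` and `J = (j, J')`. -/
def sparlingCons {n : ℕ} (i : Fin m) (I' : Fin n → Fin m) (j : Fin m) (J' : Fin n → Fin m) :
    DForm (Coord m) (m - (n + 1 + (n + 1))) :=
  sparling (Fin.append (Fin.cons i I' : Fin (n + 1) → Fin m) (Fin.cons j J' : Fin (n + 1) → Fin m))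

/-- For `r ≥ 1`, the form
`(η^{kq} θ_{I i j₂…j_r} - 1/(2r) η^{j₁q} δ^k_i θ_{IJ}) ∧ Ω^{i₁}_q ∧ Ω^{I'J'}`,
with `I = (i₁, I')` and `J = (j₁, J')`. -/
def fieldForm (m r : ℕ) (k i : Fin m) :
    DForm (Coord m) (m - (r - 1 + 1 + (r - 1 + 1)) + 2 + 2 * (r - 1)) :=
  ∑ i₁ : Fin m, ∑ I' : Fin (r - 1) → Fin m, ∑ J' : Fin (r - 1) → Fin m, ∑ q : Fin m,
    ((eta k q • sparlingCons i₁ I' i J' -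
      ∑ j₁ : Fin m, (1 / (2 * (r : ℝ)) * eta j₁ q * (if k = i then 1 else 0)) •
        sparlingCons i₁ I' j₁ J').wedge (curv i₁ q)).wedge (curvProd I' J')

end CanonicalForms

/-! ## The Griffiths variational problem -/

section Griffiths

variable {m : ℕ} {M : Type*} [TopologicalSpace M] [ChartedSpace (E m) M]
  [IsManifold (𝓡 m) ∞ M]

/-- The coefficient of `dx¹ ∧ … ∧ dxᵐ` in a form of top degree. -/
def topCoeff {k : ℕ} (h : k = m) (α : E m [⋀^Fin k]→L[ℝ] ℝ) : ℝ :=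
  α fun a => EuclideanSpace.single (Fin.cast h a) 1

/-- The action `∫_K s^* λ_L` over a set `K` in the range of a chart, for the section with
coordinate expression `s`. -/
def action (r : ℕ) (h : 2 * r ≤ m) (K : Set (E m)) (s : E m → Coord m) : ℝ :=
  ∫ x in K, topCoeff (show m - (r + r) + 2 * r = m by omega) (pullback s (lagrangian m r) x)

/-- `S` is an integral section of `𝓘_L = ⟨ω_𝔭⟩_diff`: every form of `𝓘_L` pulls back to zero. -/
def IsIntegral (S : T0Section m M) : Prop :=
  ∀ (φ : OpenPartialHomeomorph M (E m)) (hφ : φ ∈ IsManifold.maximalAtlas (𝓡 m) ∞ M)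
    (k : ℕ) (α : DForm (Coord m) k), DiffIdeal (coordDomain φ) omegaP k α →
    ∀ p ∈ φ.target, pullback (localRep φ hφ S.toFun) α p = 0

/-- `S` is an extremal of the Griffiths variational problem `(T₀, λ_L, 𝓘_L)`: it is an integral
section of `𝓘_L`, and the action is stationary at `S` along the flow of every smooth
`τ₁`-vertical infinitesimal symmetry `Z` of `𝓘_L` on a coordinate domain of `T₀` whose support
projects into a compact set `K` of the corresponding coordinate domain of `M`. The curve `s` of
sections is the image of `S` under the local flow of `Z`; it does not move outside `K`. -/
def IsExtremal (r : ℕ) (h : 2 * r ≤ m) (S : T0Section m M) : Prop :=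
  IsIntegral S ∧
  ∀ (φ : OpenPartialHomeomorph M (E m)) (hφ : φ ∈ IsManifold.maximalAtlas (𝓡 m) ∞ M)
    (Z : Coord m → Coord m) (K : Set (E m)),
    ContDiffOn ℝ ∞ Z (coordDomain φ) →
    (∀ v ∈ coordDomain φ, (Z v).1 = 0) →
    IsInfinitesimalSymmetry (coordDomain φ) omegaP Z →
    IsCompact K → K ⊆ φ.target →
    (∀ v ∈ coordDomain φ, v.1 ∉ K → Z v = 0) →
    ∀ (ε : ℝ) (s : ℝ → E m → Coord m), 0 < ε →
      ContDiffOn ℝ ∞ (fun q : ℝ × E m => s q.1 q.2) (Ioo (-ε) ε ×ˢ φ.target) →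
      (∀ x ∈ φ.target, s 0 x = localRep φ hφ S.toFun x) →
      (∀ t ∈ Ioo (-ε) ε, ∀ x ∈ φ.target,
        s t x ∈ coordDomain φ ∧ HasDerivAt (fun t' => s t' x) (Z (s t x)) t) →
      HasDerivAt (fun t => action r h K (s t)) 0 0

end Griffiths

end Lovelock

end

/-! Along an integral section the pulled-back connection matrices are skew for η. Since
torsion-freeness is built into T₀, the coordinates Γ are then given by Koszul's formula in terms of
the metric g of the frame e (`gammaM_eq_koszul`): the section carries a metric and its Levi-Civita
connection.

In a chart, take a test function f and a constant matrix P. The frame variation δe = f P e extends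
to a vertical field on T₀: its Γ-component is chosen by Koszul's formula so that the Lie derivative
of ω is skew for η. That derivative has no 𝔭-part, so the field annihilates the metricity forms and
is a symmetry of the whole system (`lieDeriv_omegaP`, `isInfinitesimalSymmetry_of_lieDeriv_gen`). If
P is idempotent, the curve it generates is explicit: the frame is exp(t f P) e and Γ is the
Levi-Civita connection of the deformed frame (`hasDerivAt_flowSection`). It is therefore admissible
in the definition of an extremal.

On components, λ_L is a nonzero constant times a double alternating sum, over pairs of bijections
from positions to indices, of products of coframe and curvature components (`lagrangian_apply`). Its
t-derivative has two parts. The curvature part comes from δΩ = D δω; by the Bianchi identity, the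
vanishing torsion and the tracelessness of ω it is a divergence (`fderiv_altSum_curvR`), whose flux
vanishes outside the support of f, so it integrates to zero. The coframe part is -f times `algTerm`,
which is linear in P. The fundamental lemma of the calculus of variations gives `algTerm` = 0 for
every idempotent P, and idempotents span all matrices (`algTerm_eq_zero`).

What remains is algebra. The alternating sum is invariant under a matrix A acting on all frame
indices, up to the factor tr A (`altSum_slot`). Hence the sum over the coframe slots, known to
vanish, trades for 2r equal curvature slots: 2r (A acting on one curvature index) = tr A · λ_L. For
elementary matrices A this is the asserted equation, including the coefficient 1/(2r)
(`altSumWith_curv_of_algTerm`, `fieldForm_apply`). -/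

namespace Lovelock

/-! ### Exterior products, Lie derivatives and their smoothness. -/

section FormAlgebra

variable {X : Type*} [NormedAddCommGroup X] [NormedSpace ℝ X]

theorem wedge_apply {k l : ℕ} (α : X [⋀^Fin k]→L[ℝ] ℝ) (β : X [⋀^Fin l]→L[ℝ] ℝ)
    (v : Fin (k + l) → X) :
    wedge α β v = ((k.factorial : ℝ) * (l.factorial : ℝ))⁻¹ *
      ∑ σ : Equiv.Perm (Fin (k + l)), ((Equiv.Perm.sign σ : ℤ) : ℝ) *
        (α (fun a => v (σ (Fin.castAdd l a))) * β (fun b => v (σ (Fin.natAdd k b)))) := by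
  simp only [wedge, ContinuousAlternatingMap.smul_apply, smul_eq_mul,
    ContinuousMultilinearMap.alternatization_apply_apply]
  congr 1
  refine Finset.sum_congr rfl fun σ _ => ?_
  rw [Units.smul_def, zsmul_eq_mul]
  rfl

theorem norm_wedge_le {k l : ℕ} (α : X [⋀^Fin k]→L[ℝ] ℝ) (β : X [⋀^Fin l]→L[ℝ] ℝ) :
    ‖wedge α β‖ ≤ (((k.factorial : ℝ) * (l.factorial : ℝ))⁻¹ *
      Fintype.card (Equiv.Perm (Fin (k + l)))) * ‖α‖ * ‖β‖ := by
  refine ContinuousAlternatingMap.opNorm_le_bound _ (by positivity) fun v => ?_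
  rw [wedge_apply, norm_mul, Real.norm_of_nonneg (by positivity)]
  have : ∀ σ : Equiv.Perm (Fin (k + l)), ‖((Equiv.Perm.sign σ : ℤ) : ℝ) *
        (α (fun a => v (σ (Fin.castAdd l a))) * β (fun b => v (σ (Fin.natAdd k b))))‖
        ≤ ‖α‖ * ‖β‖ * ∏ i, ‖v i‖ := by
    intro σ
    have hs : ‖((Equiv.Perm.sign σ : ℤ) : ℝ)‖ = 1 := by
      rcases Int.units_eq_one_or (Equiv.Perm.sign σ) with h | h <;> simp [h]
    rw [norm_mul, hs, one_mul, norm_mul, ← Equiv.prod_comp σ, Fin.prod_univ_add]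
    calc _ ≤ (‖α‖ * ∏ a, ‖v (σ (Fin.castAdd l a))‖) * (‖β‖ * ∏ b, ‖v (σ (Fin.natAdd k b))‖) :=
          mul_le_mul (α.le_opNorm _) (β.le_opNorm _) (norm_nonneg _) (by positivity)
      _ = _ := by ring
  calc _ ≤ ((k.factorial : ℝ) * (l.factorial : ℝ))⁻¹ *
        ∑ σ : Equiv.Perm (Fin (k + l)), (‖α‖ * ‖β‖ * ∏ i, ‖v i‖) := by
        gcongr
        exact (norm_sum_le _ _).trans (Finset.sum_le_sum fun σ _ => this σ)
    _ = _ := by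
        rw [Finset.sum_const, nsmul_eq_mul, Finset.card_univ]; ring

/-- The exterior product as a continuous bilinear map. -/
noncomputable def wedgeL (k l : ℕ) :
    (X [⋀^Fin k]→L[ℝ] ℝ) →L[ℝ] (X [⋀^Fin l]→L[ℝ] ℝ) →L[ℝ] (X [⋀^Fin (k + l)]→L[ℝ] ℝ) :=
  LinearMap.mkContinuous₂
    (LinearMap.mk₂ ℝ wedge
      (fun a b c => by ext v; simp [wedge_apply, ← mul_add, ← Finset.sum_add_distrib, add_mul])
      (fun r a c => by
        ext v; simp only [wedge_apply, ContinuousAlternatingMap.smul_apply, smul_eq_mul]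
        rw [mul_left_comm, Finset.mul_sum _ _ r]; congr 1
        exact Finset.sum_congr rfl fun _ _ => by ring)
      (fun a b c => by ext v; simp [wedge_apply, ← mul_add, ← Finset.sum_add_distrib])
      (fun r a c => by
        ext v; simp only [wedge_apply, ContinuousAlternatingMap.smul_apply, smul_eq_mul]
        rw [mul_left_comm, Finset.mul_sum _ _ r]; congr 1
        exact Finset.sum_congr rfl fun _ _ => by ring))
    _ norm_wedge_le

theorem wedgeL_apply {k l : ℕ} (α : X [⋀^Fin k]→L[ℝ] ℝ) (β : X [⋀^Fin l]→L[ℝ] ℝ) :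
    wedgeL k l α β = wedge α β := rfl

theorem DForm.wedge_contDiffOn {W : Set X} {k l : ℕ} {α : DForm X k} {β : DForm X l}
    (hα : ContDiffOn ℝ ∞ α W) (hβ : ContDiffOn ℝ ∞ β W) : ContDiffOn ℝ ∞ (α.wedge β) W :=
  ContDiffOn.clm_apply (f := fun p => wedgeL k l (α p))
    (ContDiff.comp_contDiffOn (g := wedgeL (X := X) k l)
      (ContinuousLinearMap.contDiff (F := (X [⋀^Fin l]→L[ℝ] ℝ) →L[ℝ] (X [⋀^Fin (k + l)]→L[ℝ] ℝ)) _)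
      hα) hβ

theorem DForm.d_contDiffOn {W : Set X} (hW : IsOpen W) {k : ℕ} {α : DForm X k}
    (hα : ContDiffOn ℝ ∞ α W) : ContDiffOn ℝ ∞ α.d W :=
  ((ContinuousAlternatingMap.alternatizeUncurryFinCLM ℝ X ℝ).contDiff).comp_contDiffOn
    (hα.fderiv_of_isOpen hW (by simp))

/-- Currying of an alternating form in its first argument, as a continuous linear map. -/
noncomputable def curryLeftL (k : ℕ) :
    (X [⋀^Fin (k + 1)]→L[ℝ] ℝ) →L[ℝ] (X →L[ℝ] X [⋀^Fin k]→L[ℝ] ℝ) :=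
  (ContinuousAlternatingMap.curryLeftLI (𝕜 := ℝ) (E := X) (F := ℝ) (n := k)).toContinuousLinearMap

theorem contract_contDiffOn {W : Set X} {k : ℕ} {α : DForm X (k + 1)} {Z : X → X}
    (hα : ContDiffOn ℝ ∞ α W) (hZ : ContDiffOn ℝ ∞ Z W) : ContDiffOn ℝ ∞ (contract Z α) W :=
  ContDiffOn.clm_apply (f := fun p => curryLeftL k (α p))
    (ContDiff.comp_contDiffOn (g := curryLeftL (X := X) k)
      (ContinuousLinearMap.contDiff (F := X →L[ℝ] X [⋀^Fin k]→L[ℝ] ℝ) _) hα) hZ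

theorem lieDeriv_contDiffOn {W : Set X} (hW : IsOpen W) {k : ℕ} {α : DForm X k} {Z : X → X}
    (hα : ContDiffOn ℝ ∞ α W) (hZ : ContDiffOn ℝ ∞ Z W) : ContDiffOn ℝ ∞ (lieDeriv Z α) W := by
  cases k with
  | zero => exact contract_contDiffOn (DForm.d_contDiffOn hW hα) hZ
  | succ k =>
    exact (contract_contDiffOn (DForm.d_contDiffOn hW hα) hZ).add
      (DForm.d_contDiffOn hW (contract_contDiffOn hα hZ))

/-- By d² = 0 both sides equal d(Z ⌟ dα). The identity is claimed only on W, because elements of the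
ideal are controlled only there. -/
theorem lieDeriv_d {W : Set X} (hW : IsOpen W) {k : ℕ} {α : DForm X k} {Z : X → X}
    (hα : ContDiffOn ℝ ∞ α W) (hZ : ContDiffOn ℝ ∞ Z W) :
    EqOn (lieDeriv Z α.d) (lieDeriv Z α).d W := by
  intro p hp
  have hm : minSmoothness ℝ 2 ≤ ∞ := by
    rw [minSmoothness_of_isRCLikeNormedField]; exact WithTop.coe_le_coe.2 (le_top : (2 : ℕ∞) ≤ ⊤)
  have hdd : α.d.d =ᶠ[𝓝 p] 0 := by
    filter_upwards [hW.mem_nhds hp] with q hq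
    exact extDeriv_extDeriv_apply (hα.contDiffAt (hW.mem_nhds hq)) hm
  have h1 : lieDeriv Z α.d p = (contract Z α.d).d p := by
    show contract Z α.d.d p + _ = _
    have : contract Z α.d.d p = 0 := by
      ext v; simp [contract, hdd.self_of_nhds]
    rw [this, zero_add]
  rw [h1]
  cases k with
  | zero => rfl
  | succ k =>
    have hc := DForm.d_contDiffOn hW (contract_contDiffOn hα hZ)
    have hc' := contract_contDiffOn (DForm.d_contDiffOn hW hα) hZ
    show _ = extDeriv (contract Z α.d + (contract Z α).d) p
    rw [extDeriv_add ((hc'.contDiffAt (hW.mem_nhds hp)).differentiableAt (by simp))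
      ((hc.contDiffAt (hW.mem_nhds hp)).differentiableAt (by simp))]
    have : extDeriv (contract Z α).d p = 0 :=
      extDeriv_extDeriv_apply ((contract_contDiffOn hα hZ).contDiffAt (hW.mem_nhds hp)) hm
    rw [this, add_zero]; rfl

theorem lieDeriv_congr {W : Set X} (hW : IsOpen W) {k : ℕ} {α β : DForm X k} (Z : X → X)
    (h : EqOn α β W) : EqOn (lieDeriv Z α) (lieDeriv Z β) W := by
  intro p hp
  have he : α =ᶠ[𝓝 p] β := h.eventuallyEq_of_mem (hW.mem_nhds hp)
  have h1 : α.d p = β.d p := he.extDeriv_eq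
  cases k with
  | zero => simp only [lieDeriv, contract, h1]
  | succ k =>
    have h2 : contract Z α =ᶠ[𝓝 p] contract Z β := by
      filter_upwards [he] with q hq
      simp only [contract, hq]
    have h3 : (contract Z α).d p = (contract Z β).d p := h2.extDeriv_eq
    simp only [lieDeriv, Pi.add_apply, h3, contract, h1]

/-- Cartan's formula: the Lie derivative is the derivative along the vector field plus the
derivation induced by its differential. -/
theorem lieDeriv_apply {k : ℕ} {α : DForm X k} {Z : X → X} {p : X}
    (hα : DifferentiableAt ℝ α p) (hZ : DifferentiableAt ℝ Z p) (v : Fin k → X) :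
    lieDeriv Z α p v = fderiv ℝ α p (Z p) v +
      ∑ i, α p (Function.update v i (fderiv ℝ Z p (v i))) := by
  cases k with
  | zero =>
    simp only [lieDeriv, contract, ContinuousAlternatingMap.curryLeft_apply_apply]
    simp [DForm.d, extDeriv, ContinuousAlternatingMap.alternatizeUncurryFin_apply]
  | succ k =>
    have hcd : HasFDerivAt (contract Z α)
        ((curryLeftL k (α p)) ∘L fderiv ℝ Z p + (curryLeftL k ∘L fderiv ℝ α p).flip (Z p)) p :=
      HasFDerivAt.clm_apply (c := fun p => curryLeftL k (α p))
        (HasFDerivAt.comp (g := curryLeftL (X := X) k) p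
          (ContinuousLinearMap.hasFDerivAt (F := X →L[ℝ] X [⋀^Fin k]→L[ℝ] ℝ) _)
          hα.hasFDerivAt) hZ.hasFDerivAt
    have hcl : ∀ (β : X [⋀^Fin (k + 1)]→L[ℝ] ℝ) (x : X) (w : Fin k → X),
      curryLeftL k β x w = β (Matrix.vecCons x w) := fun _ _ _ => rfl
    simp only [lieDeriv, Pi.add_apply, ContinuousAlternatingMap.add_apply]
    have e1 : contract Z α.d p v = α.d p (Matrix.vecCons (Z p) v) := rfl
    rw [e1, DForm.d, extDeriv, ContinuousAlternatingMap.alternatizeUncurryFin_apply, DForm.d,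
      extDeriv, hcd.fderiv, ContinuousAlternatingMap.alternatizeUncurryFin_apply,
      Fin.sum_univ_succ]
    simp only [Matrix.vecCons]
    -- The zeroth term of Z ⌟ dα is the derivative of α along Z. Each later term cancels against d(Z
    -- ⌟ α), up to the part in which Z itself is differentiated.
    rw [add_assoc, ← Finset.sum_add_distrib]
    congr 1
    · simp [Fin.removeNth_zero]
    refine Finset.sum_congr rfl fun i _ => ?_
    have e2 : Fin.removeNth i.succ (Fin.cons (Z p) v : Fin (k+1+1) → X)
        = Fin.cons (Z p) (Fin.removeNth i v) := by
      funext j; refine Fin.cases ?_ (fun j => ?_) j <;> simp [Fin.removeNth]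
    -- Moving the i-th slot to the front costs the sign (-1)^i, which matches the signs in the
    -- exterior derivative.
    have e3 : α p (Function.update v i (fderiv ℝ Z p (v i))) =
        (-1 : ℝ) ^ (i : ℕ) * α p (Fin.cons (fderiv ℝ Z p (v i)) (Fin.removeNth i v)) := by
      have := (α p).toAlternatingMap.map_insertNth i (fderiv ℝ Z p (v i)) (Fin.removeNth i v)
      rw [Fin.insertNth_removeNth] at this
      simpa [Matrix.vecCons] using this
    rw [e3, e2]
    simp [pow_succ, Matrix.vecCons, hcl]
end FormAlgebra

/-! ### The Leibniz rule and symmetries of a differential ideal. -/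

section LieDerivative

variable {X : Type*} [NormedAddCommGroup X] [NormedSpace ℝ X]

theorem differentiableAt_bilinear {F G H : Type*} [NormedAddCommGroup F] [NormedSpace ℝ F]
    [NormedAddCommGroup G] [NormedSpace ℝ G] [NormedAddCommGroup H] [NormedSpace ℝ H]
    (B : F →L[ℝ] G →L[ℝ] H) {f : X → F} {g : X → G} {p : X}
    (hf : DifferentiableAt ℝ f p) (hg : DifferentiableAt ℝ g p) :
    DifferentiableAt ℝ (fun q => B (f q) (g q)) p ∧ ∀ w, fderiv ℝ (fun q => B (f q) (g q)) p w =
      B (fderiv ℝ f p w) (g p) + B (f p) (fderiv ℝ g p w) := by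
  have h := B.isBoundedBilinearMap.hasFDerivAt (f p, g p)
  have h' := h.comp p (hf.hasFDerivAt.prodMk hg.hasFDerivAt)
  refine ⟨h'.differentiableAt, fun w => ?_⟩
  rw [show (fun q => B (f q) (g q)) = (fun p => B p.1 p.2) ∘ fun q => (f q, g q) from rfl, h'.fderiv]
  simp [IsBoundedBilinearMap.deriv, add_comm]

theorem DForm.differentiableAt_wedge {k l : ℕ} {α : DForm X k} {β : DForm X l} {p : X}
    (hα : DifferentiableAt ℝ α p) (hβ : DifferentiableAt ℝ β p) :
    DifferentiableAt ℝ (α.wedge β) p :=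
  (differentiableAt_bilinear (wedgeL k l) hα hβ).1

theorem fderiv_wedge_apply {k l : ℕ} {α : DForm X k} {β : DForm X l} {p : X}
    (hα : DifferentiableAt ℝ α p) (hβ : DifferentiableAt ℝ β p) (w : X) :
    fderiv ℝ (α.wedge β) p w =
      Lovelock.wedge (fderiv ℝ α p w) (β p) + Lovelock.wedge (α p) (fderiv ℝ β p w) :=
  (differentiableAt_bilinear (wedgeL k l) hα hβ).2 w

/-- A linear map acts on the exterior product as a derivation. -/
theorem sum_wedge_update {k l : ℕ} (α : X [⋀^Fin k]→L[ℝ] ℝ) (β : X [⋀^Fin l]→L[ℝ] ℝ)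
    (A : X → X) (α' : X [⋀^Fin k]→L[ℝ] ℝ) (β' : X [⋀^Fin l]→L[ℝ] ℝ)
    (hα : ∀ v, α' v = ∑ i, α (Function.update v i (A (v i))))
    (hβ : ∀ v, β' v = ∑ i, β (Function.update v i (A (v i)))) (v : Fin (k + l) → X) :
    ∑ i, wedge α β (Function.update v i (A (v i))) = wedge α' β v + wedge α β' v := by
  simp only [wedge_apply, ← Finset.mul_sum, ← mul_add]
  congr 1
  rw [Finset.sum_comm, ← Finset.sum_add_distrib]
  refine Finset.sum_congr rfl fun σ _ => ?_
  rw [← mul_add, ← Finset.mul_sum]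
  congr 1
  -- Reindexed by σ, every slot falls either to α or to β, and an update in one group leaves the
  -- other factor untouched.
  rw [← Equiv.sum_comp σ, Fin.sum_univ_add, hα, hβ, Finset.sum_mul, Finset.mul_sum]
  congr 1 <;> refine Finset.sum_congr rfl fun i _ => ?_
  · congr 2
    · funext a
      simp only [Function.update_apply, EmbeddingLike.apply_eq_iff_eq]
      simp [Fin.ext_iff]
    · funext b
      rw [Function.update_of_ne]
      intro h
      have := congrArg Fin.val (σ.injective h)
      simp at this; omega
  · congr 2
    · funext b
      rw [Function.update_of_ne]
      intro h
      have := congrArg Fin.val (σ.injective h)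
      simp at this; omega
    · funext a
      simp only [Function.update_apply, EmbeddingLike.apply_eq_iff_eq]
      simp [Fin.ext_iff]

theorem wedge_add_left {k l : ℕ} (α α' : X [⋀^Fin k]→L[ℝ] ℝ) (β : X [⋀^Fin l]→L[ℝ] ℝ) :
    wedge (α + α') β = wedge α β + wedge α' β := by
  simp only [← wedgeL_apply, map_add, _root_.add_apply]

theorem wedge_add_right {k l : ℕ} (α : X [⋀^Fin k]→L[ℝ] ℝ) (β β' : X [⋀^Fin l]→L[ℝ] ℝ) :
    wedge α (β + β') = wedge α β + wedge α β' := by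
  simp only [← wedgeL_apply, map_add]

/-- The Leibniz rule for the Lie derivative. -/
theorem lieDeriv_wedge {k l : ℕ} {α : DForm X k} {β : DForm X l} {Z : X → X} {p : X}
    (hα : DifferentiableAt ℝ α p) (hβ : DifferentiableAt ℝ β p) (hZ : DifferentiableAt ℝ Z p) :
    lieDeriv Z (α.wedge β) p =
      ((lieDeriv Z α).wedge β + α.wedge (lieDeriv Z β)) p := by
  ext v
  rw [lieDeriv_apply (DForm.differentiableAt_wedge hα hβ) hZ, fderiv_wedge_apply hα hβ]
  -- The slotwise action of DZ on a form is its Lie derivative minus its directional derivative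
  -- along Z.
  have h := sum_wedge_update (α p) (β p) (fderiv ℝ Z p)
    (lieDeriv Z α p - fderiv ℝ α p (Z p)) (lieDeriv Z β p - fderiv ℝ β p (Z p))
    (fun v => by simp [lieDeriv_apply hα hZ])
    (fun v => by simp [lieDeriv_apply hβ hZ]) v
  simp only [DForm.wedge, h]
  obtain ⟨a, ha⟩ : ∃ a, lieDeriv Z α p = fderiv ℝ α p (Z p) + a := ⟨_, (add_sub_cancel _ _).symm⟩
  obtain ⟨b, hb⟩ : ∃ b, lieDeriv Z β p = fderiv ℝ β p (Z p) + b := ⟨_, (add_sub_cancel _ _).symm⟩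
  simp only [Pi.add_apply, ContinuousAlternatingMap.add_apply, DForm.wedge, ha, hb,
    add_sub_cancel_left, wedge_add_left, wedge_add_right]
  ring

theorem lieDeriv_add {k : ℕ} {α β : DForm X k} {Z : X → X} {p : X}
    (hα : DifferentiableAt ℝ α p) (hβ : DifferentiableAt ℝ β p) (hZ : DifferentiableAt ℝ Z p) :
    lieDeriv Z (α + β) p = (lieDeriv Z α + lieDeriv Z β) p := by
  ext v
  rw [lieDeriv_apply (hα.add hβ) hZ, fderiv_add hα hβ]
  simp only [Pi.add_apply, ContinuousAlternatingMap.add_apply, lieDeriv_apply hα hZ,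
    lieDeriv_apply hβ hZ, _root_.add_apply, Finset.sum_add_distrib]
  ring

/-- A smooth vector field whose Lie derivative annihilates the generators is an infinitesimal
symmetry of the exterior differential system that they generate. -/
theorem isInfinitesimalSymmetry_of_lieDeriv_gen {W : Set X} (hW : IsOpen W) {ι : Type*}
    {g : ι → DForm X 1} {Z : X → X} (hg : ∀ a, ContDiffOn ℝ ∞ (g a) W)
    (hZ : ContDiffOn ℝ ∞ Z W) (h : ∀ a, EqOn (lieDeriv Z (g a)) 0 W) :
    IsInfinitesimalSymmetry W g Z := by
  have hdZ : ∀ p ∈ W, DifferentiableAt ℝ Z p := fun p hp =>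
    (hZ.contDiffAt (hW.mem_nhds hp)).differentiableAt (by simp)
  have hd : ∀ {k : ℕ} {α : DForm X k}, ContDiffOn ℝ ∞ α W → ∀ p ∈ W, DifferentiableAt ℝ α p :=
    fun hα p hp => (hα.contDiffAt (hW.mem_nhds hp)).differentiableAt (by simp)
  -- Smoothness on W is carried through the induction: the Leibniz rule and the commutation with d
  -- need it for every member of the ideal.
  suffices H : ∀ (k : ℕ) (α : DForm X k), DiffIdeal W g k α →
      ContDiffOn ℝ ∞ α W ∧ DiffIdeal W g k (lieDeriv Z α) from fun k α hα => (H k α hα).2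
  intro k α hα
  induction hα with
  | gen a => exact ⟨hg a, .congr (.zero 1) (h a).symm⟩
  | zero k =>
    refine ⟨contDiffOn_const, .congr (.zero k) fun p hp => ?_⟩
    ext v
    have h0 : DifferentiableAt ℝ (0 : DForm X k) p := differentiableAt_const _
    rw [lieDeriv_apply h0 (hdZ p hp)]
    simp
  | add hα hβ iα iβ =>
    exact ⟨iα.1.add iβ.1, .congr (.add iα.2 iβ.2)
      fun p hp => (lieDeriv_add (hd iα.1 p hp) (hd iβ.1 p hp) (hdZ p hp)).symm⟩
  | wedge_right hα hβ iα =>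
    exact ⟨DForm.wedge_contDiffOn iα.1 hβ,
      .congr (.add (.wedge_right iα.2 hβ) (.wedge_right hα (lieDeriv_contDiffOn hW hβ hZ)))
      fun p hp => (lieDeriv_wedge (hd iα.1 p hp) (hd hβ p hp) (hdZ p hp)).symm⟩
  | wedge_left hα hβ iα =>
    exact ⟨DForm.wedge_contDiffOn hβ iα.1,
      .congr (.add (.wedge_left hα (lieDeriv_contDiffOn hW hβ hZ)) (.wedge_left iα.2 hβ))
      fun p hp => (lieDeriv_wedge (hd hβ p hp) (hd iα.1 p hp) (hdZ p hp)).symm⟩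
  | d hα iα =>
    exact ⟨DForm.d_contDiffOn hW iα.1, .congr (.d iα.2) (lieDeriv_d hW iα.1 hZ).symm⟩
  | congr hα he iα =>
    exact ⟨iα.1.congr fun p hp => (he hp).symm, .congr iα.2 (lieDeriv_congr hW Z he)⟩

end LieDerivative

/-! ### Entrywise calculus of matrix-valued functions. -/

section MatrixCalculus

variable {Y : Type*} [NormedAddCommGroup Y] [NormedSpace ℝ Y] {V : Type*}

/-- The entrywise directional derivative of a matrix-valued function. -/
noncomputable def dMat (w : Y) (A : Y → Matrix V V ℝ) (p : Y) : Matrix V V ℝ :=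
  Matrix.of fun i j => fderiv ℝ (fun q => A q i j) p w

/-- Entrywise differentiability of a matrix-valued function. -/
def DiffMat (A : Y → Matrix V V ℝ) (p : Y) : Prop :=
  ∀ i j, DifferentiableAt ℝ (fun q => A q i j) p

/-- Entrywise smoothness of a matrix-valued function. -/
def SmoothMat (A : Y → Matrix V V ℝ) (O : Set Y) : Prop :=
  ∀ i j, ContDiffOn ℝ ∞ (fun q => A q i j) O

theorem SmoothMat.diffMat {A : Y → Matrix V V ℝ} {O : Set Y} (h : SmoothMat A O)
    (hO : IsOpen O) {p : Y} (hp : p ∈ O) : DiffMat A p := fun i j =>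
  ((h i j).contDiffAt (hO.mem_nhds hp)).differentiableAt (by simp)

theorem contDiffOn_fderiv_apply {F : Type*} [NormedAddCommGroup F] [NormedSpace ℝ F]
    {u : Y → F} {O : Set Y} (hO : IsOpen O) (hu : ContDiffOn ℝ ∞ u O) (w : Y) :
    ContDiffOn ℝ ∞ (fun p => fderiv ℝ u p w) O :=
  (hu.fderiv_of_isOpen hO (by simp)).clm_apply contDiffOn_const

theorem SmoothMat.dMat {A : Y → Matrix V V ℝ} {O : Set Y} (h : SmoothMat A O)
    (hO : IsOpen O) (w : Y) : SmoothMat (Lovelock.dMat w A) O := fun i j =>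
  contDiffOn_fderiv_apply hO (h i j) w

theorem fderiv_fderiv_comm {u : Y → ℝ} {O : Set Y} (hO : IsOpen O)
    (hu : ContDiffOn ℝ ∞ u O) {p : Y} (hp : p ∈ O) (v w : Y) :
    fderiv ℝ (fun q => fderiv ℝ u q v) p w = fderiv ℝ (fun q => fderiv ℝ u q w) p v := by
  have hc : ContDiffAt ℝ ∞ u p := hu.contDiffAt (hO.mem_nhds hp)
  have hd : DifferentiableAt ℝ (fderiv ℝ u) p :=
    ((hu.fderiv_of_isOpen hO (m := ∞) (by simp)).contDiffAt (hO.mem_nhds hp)).differentiableAt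
      (by simp)
  have hs : IsSymmSndFDerivAt ℝ u p := hc.isSymmSndFDerivAt (by
    rw [minSmoothness_of_isRCLikeNormedField]
    exact WithTop.coe_le_coe.2 (le_top : (2 : ℕ∞) ≤ ⊤))
  have h : ∀ v w : Y, fderiv ℝ (fun q => fderiv ℝ u q v) p w = fderiv ℝ (fderiv ℝ u) p w v := by
    intro v w
    rw [fderiv_clm_apply hd (differentiableAt_const v)]
    simp
  rw [h, h]
  exact hs.eq w v

theorem dMat_comm {A : Y → Matrix V V ℝ} {O : Set Y} (hO : IsOpen O) (h : SmoothMat A O)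
    {p : Y} (hp : p ∈ O) (v w : Y) : dMat v (dMat w A) p = dMat w (dMat v A) p := by
  ext i j
  exact fderiv_fderiv_comm hO (h i j) hp w v

theorem dMat_congr {A B : Y → Matrix V V ℝ} {p : Y} (h : A =ᶠ[𝓝 p] B) (w : Y) :
    dMat w A p = dMat w B p := by
  ext i j
  have : (fun q => A q i j) =ᶠ[𝓝 p] (fun q => B q i j) := h.mono fun q hq => by simp only [hq]
  simp only [dMat, Matrix.of_apply, this.fderiv_eq]

theorem SmoothMat.transpose {A : Y → Matrix V V ℝ} {O : Set Y} (h : SmoothMat A O) :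
    SmoothMat (fun q => (A q).transpose) O := fun i j => h j i

theorem DiffMat.transpose {A : Y → Matrix V V ℝ} {p : Y} (h : DiffMat A p) :
    DiffMat (fun q => (A q).transpose) p := fun i j => h j i

theorem dMat_transpose (A : Y → Matrix V V ℝ) (p w : Y) :
    dMat w (fun q => (A q).transpose) p = (dMat w A p).transpose := rfl

theorem smoothMat_const (C : Matrix V V ℝ) (O : Set Y) : SmoothMat (fun _ => C) O :=
  fun _ _ => contDiffOn_const

theorem diffMat_const (C : Matrix V V ℝ) (p : Y) : DiffMat (fun _ => C) p :=
  fun _ _ => differentiableAt_const _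

theorem dMat_const (C : Matrix V V ℝ) (p w : Y) : dMat w (fun _ => C) p = 0 := by
  ext i j; simp [dMat]

theorem SmoothMat.add {A B : Y → Matrix V V ℝ} {O : Set Y} (hA : SmoothMat A O)
    (hB : SmoothMat B O) : SmoothMat (fun q => A q + B q) O := fun i j => (hA i j).add (hB i j)

theorem SmoothMat.sub {A B : Y → Matrix V V ℝ} {O : Set Y} (hA : SmoothMat A O)
    (hB : SmoothMat B O) : SmoothMat (fun q => A q - B q) O := fun i j => (hA i j).sub (hB i j)

theorem SmoothMat.neg {A : Y → Matrix V V ℝ} {O : Set Y} (hA : SmoothMat A O) :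
    SmoothMat (fun q => -A q) O := fun i j => (hA i j).neg

theorem DiffMat.add {A B : Y → Matrix V V ℝ} {p : Y} (hA : DiffMat A p)
    (hB : DiffMat B p) : DiffMat (fun q => A q + B q) p := fun i j => (hA i j).add (hB i j)

theorem DiffMat.sub {A B : Y → Matrix V V ℝ} {p : Y} (hA : DiffMat A p)
    (hB : DiffMat B p) : DiffMat (fun q => A q - B q) p := fun i j => (hA i j).sub (hB i j)

theorem dMat_add {A B : Y → Matrix V V ℝ} {p : Y} (hA : DiffMat A p) (hB : DiffMat B p) (w : Y) :
    dMat w (fun q => A q + B q) p = dMat w A p + dMat w B p := by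
  ext i j
  simp only [dMat, Matrix.of_apply, Matrix.add_apply]
  rw [fderiv_fun_add (hA i j) (hB i j)]; rfl

theorem dMat_sub {A B : Y → Matrix V V ℝ} {p : Y} (hA : DiffMat A p) (hB : DiffMat B p) (w : Y) :
    dMat w (fun q => A q - B q) p = dMat w A p - dMat w B p := by
  ext i j
  simp only [dMat, Matrix.of_apply, Matrix.sub_apply]
  rw [fderiv_fun_sub (hA i j) (hB i j)]; rfl

theorem SmoothMat.smul {a : Y → ℝ} {A : Y → Matrix V V ℝ} {O : Set Y} (ha : ContDiffOn ℝ ∞ a O)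
    (hA : SmoothMat A O) : SmoothMat (fun q => a q • A q) O := fun i j => ha.mul (hA i j)

theorem DiffMat.smul {a : Y → ℝ} {A : Y → Matrix V V ℝ} {p : Y} (ha : DifferentiableAt ℝ a p)
    (hA : DiffMat A p) : DiffMat (fun q => a q • A q) p := fun i j => ha.mul (hA i j)

theorem dMat_smul {a : Y → ℝ} {A : Y → Matrix V V ℝ} {p : Y} (ha : DifferentiableAt ℝ a p)
    (hA : DiffMat A p) (w : Y) :
    dMat w (fun q => a q • A q) p = fderiv ℝ a p w • A p + a p • dMat w A p := by
  ext i j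
  simp only [dMat, Matrix.of_apply, Matrix.smul_apply, Matrix.add_apply, smul_eq_mul]
  rw [fderiv_fun_mul ha (hA i j)]
  simp; ring

theorem SmoothMat.sum {ι : Type*} [Fintype ι] {A : ι → Y → Matrix V V ℝ} {O : Set Y}
    (hA : ∀ a, SmoothMat (A a) O) : SmoothMat (fun q => ∑ a, A a q) O := fun i j => by
  simp only [Matrix.sum_apply]
  exact ContDiffOn.sum fun a _ => hA a i j

theorem DiffMat.sum {ι : Type*} [Fintype ι] {A : ι → Y → Matrix V V ℝ} {p : Y}
    (hA : ∀ a, DiffMat (A a) p) : DiffMat (fun q => ∑ a, A a q) p := fun i j => by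
  simp only [Matrix.sum_apply]
  exact DifferentiableAt.fun_sum fun a _ => hA a i j

theorem dMat_sum {ι : Type*} [Fintype ι] {A : ι → Y → Matrix V V ℝ} {p : Y}
    (hA : ∀ a, DiffMat (A a) p) (w : Y) :
    dMat w (fun q => ∑ a, A a q) p = ∑ a, dMat w (A a) p := by
  ext i j
  simp only [dMat, Matrix.of_apply, Matrix.sum_apply]
  rw [fderiv_fun_sum fun a _ => hA a i j]
  simp

variable [Fintype V]

theorem SmoothMat.mul {A B : Y → Matrix V V ℝ} {O : Set Y} (hA : SmoothMat A O)
    (hB : SmoothMat B O) : SmoothMat (fun q => A q * B q) O := fun i j => by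
  simp only [Matrix.mul_apply]
  exact ContDiffOn.sum fun k _ => (hA i k).mul (hB k j)

theorem DiffMat.mul {A B : Y → Matrix V V ℝ} {p : Y} (hA : DiffMat A p)
    (hB : DiffMat B p) : DiffMat (fun q => A q * B q) p := fun i j => by
  simp only [Matrix.mul_apply]
  exact DifferentiableAt.fun_sum fun k _ => (hA i k).mul (hB k j)

theorem dMat_mul {A B : Y → Matrix V V ℝ} {p : Y} (hA : DiffMat A p) (hB : DiffMat B p) (w : Y) :
    dMat w (fun q => A q * B q) p = dMat w A p * B p + A p * dMat w B p := by
  ext i j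
  simp only [dMat, Matrix.of_apply, Matrix.mul_apply, Matrix.add_apply]
  rw [fderiv_fun_sum (A := fun k q => A q i k * B q k j) fun k _ => (hA i k).mul (hB k j),
    ← Finset.sum_add_distrib]
  simp only [sum_apply]
  refine Finset.sum_congr rfl fun k _ => ?_
  rw [fderiv_fun_mul (hA i k) (hB k j)]
  simp; ring

variable [DecidableEq V]

theorem contDiffOn_det {A : Y → Matrix V V ℝ} {O : Set Y} (hA : SmoothMat A O) :
    ContDiffOn ℝ ∞ (fun q => (A q).det) O := by
  simp only [Matrix.det_apply']
  exact ContDiffOn.sum fun σ _ => contDiffOn_const.mul (contDiffOn_prod fun i _ => hA _ _)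

theorem SmoothMat.inv {A : Y → Matrix V V ℝ} {O : Set Y} (hA : SmoothMat A O)
    (h0 : ∀ q ∈ O, (A q).det ≠ 0) : SmoothMat (fun q => (A q)⁻¹) O := fun i j => by
  simp only [Matrix.inv_def, Matrix.smul_apply, smul_eq_mul, Ring.inverse_eq_inv', Matrix.adjugate_apply]
  refine ((contDiffOn_det hA).inv h0).mul (contDiffOn_det ?_)
  intro a b
  by_cases h : a = j
  · subst h; simp only [Matrix.updateRow_self]; exact contDiffOn_const
  · simp only [Matrix.updateRow_ne h]; exact hA a b

/-- Differentiate A⁻¹ A = 1, which holds near p since the determinant does not vanish on the open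
set O. -/
theorem dMat_inv {A : Y → Matrix V V ℝ} {O : Set Y} (hO : IsOpen O) (hA : SmoothMat A O)
    (h0 : ∀ q ∈ O, (A q).det ≠ 0) {p : Y} (hp : p ∈ O) (w : Y) :
    dMat w (fun q => (A q)⁻¹) p = -((A p)⁻¹ * dMat w A p * (A p)⁻¹) := by
  have h1 : (fun q => (A q)⁻¹ * A q) =ᶠ[𝓝 p] fun _ => 1 := by
    filter_upwards [hO.mem_nhds hp] with q hq
    exact Matrix.nonsing_inv_mul _ (isUnit_iff_ne_zero.2 (h0 q hq))
  have h2 := dMat_congr h1 w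
  rw [dMat_mul ((hA.inv h0).diffMat hO hp) (hA.diffMat hO hp), dMat_const] at h2
  have h3 : A p * (A p)⁻¹ = 1 := Matrix.mul_nonsing_inv _ (isUnit_iff_ne_zero.2 (h0 p hp))
  have h4 := congrArg (· * (A p)⁻¹) h2
  simp only [add_mul, mul_assoc, h3, mul_one, zero_mul] at h4
  rw [mul_assoc]
  exact eq_neg_of_add_eq_zero_left h4

end MatrixCalculus

/-! ### Koszul's formula as linear algebra. -/

section Koszul

variable {V : Type*}

/-- Koszul's formula: the solution `T` of `T_σ + T_σᵀ = B_σ` with `T_σ` symmetric in the second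
index and `σ`. -/
noncomputable def koszul (B : V → Matrix V V ℝ) (σ : V) : Matrix V V ℝ :=
  Matrix.of fun ν μ => (B σ μ ν + B μ σ ν - B ν μ σ) / 2

theorem koszul_symm {B : V → Matrix V V ℝ} (hB : ∀ σ, (B σ).transpose = B σ) (σ ν μ : V) :
    koszul B σ ν μ = koszul B μ ν σ := by
  have h : B ν μ σ = B ν σ μ := congrFun (congrFun (hB ν) σ) μ
  simp only [koszul, Matrix.of_apply, h]; ring

theorem koszul_add_transpose {B : V → Matrix V V ℝ} (hB : ∀ σ, (B σ).transpose = B σ) (σ : V) :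
    koszul B σ + (koszul B σ).transpose = B σ := by
  ext i j
  have h : ∀ a b c, B a b c = B a c b := fun a b c => congrFun (congrFun (hB a) c) b
  simp only [koszul, Matrix.of_apply, Matrix.add_apply, Matrix.transpose_apply]
  rw [h σ j i, h i j σ, h j i σ]; ring

/-- Writing B as T + Tᵀ in the three index orders of Koszul's expression, the symmetry of T cancels
all terms but one. This uniqueness serves twice: it makes a metric section a Levi-Civita one, and it
identifies the time derivative of the deformed connection with the Γ-component of the variation
field. -/
theorem eq_koszul {B T : V → Matrix V V ℝ} (hT : ∀ σ ν μ, T σ ν μ = T μ ν σ)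
    (h : ∀ σ, T σ + (T σ).transpose = B σ) : T = koszul B := by
  funext σ; ext ν μ
  simp only [koszul, Matrix.of_apply, ← h, Matrix.add_apply, Matrix.transpose_apply]
  rw [hT σ μ ν, hT μ σ ν, hT σ ν μ]; ring

/-- Raising the remaining index does not touch the symmetric pair, so the result is an admissible
value of Γ on T₀. -/
theorem mul_koszul_symm [Fintype V] {B : V → Matrix V V ℝ} (hB : ∀ σ, (B σ).transpose = B σ)
    (G : Matrix V V ℝ) (σ ν μ : V) : (G * koszul B σ) ν μ = (G * koszul B μ) ν σ := by
  simp only [Matrix.mul_apply]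
  exact Finset.sum_congr rfl fun ρ _ => by rw [koszul_symm hB]

end Koszul

/-! ### Coordinates on T₀, the frame metric and the connection matrix. -/

section Coordinates

variable {m : ℕ}

/-- The array with entries `T σ μ ν`, symmetrised in its lower indices `ν`, `σ`. -/
noncomputable def symArray (m : ℕ) :
    (Fin m → Fin m → Fin m → ℝ) →L[ℝ] SymArray m :=
  LinearMap.toContinuousLinearMap
    { toFun := fun T => ⟨fun μ ν σ => (T σ μ ν + T ν μ σ) / 2, fun μ ν σ => by ring⟩
      map_add' := fun a b => by ext μ ν σ; simp; ring
      map_smul' := fun a b => by ext μ ν σ; simp; ring }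

/-- Symmetrisation is a linear map defined on all arrays, which keeps smoothness and differentiation
simple; on the arrays that occur below it only reorders indices. -/
theorem symArray_apply {T : Fin m → Fin m → Fin m → ℝ}
    (h : ∀ σ ν μ, T σ ν μ = T μ ν σ) (μ ν σ : Fin m) : (symArray m T).1 μ ν σ = T σ μ ν := by
  show (T σ μ ν + T ν μ σ) / 2 = _
  rw [h σ μ ν]; ring

/-- The diagonal matrix `η`. -/
noncomputable def etaM (m : ℕ) : Matrix (Fin m) (Fin m) ℝ := Matrix.of eta

theorem etaM_eq : etaM m = Matrix.diagonal fun i : Fin m => if (i : ℕ) = 0 then -1 else 1 := by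
  ext i j
  simp only [etaM, eta, Matrix.of_apply, Matrix.diagonal_apply]

theorem etaM_mul_self : etaM m * etaM m = 1 := by
  rw [etaM_eq, Matrix.diagonal_mul_diagonal, ← Matrix.diagonal_one]
  congr 1; funext i; split_ifs <;> norm_num

theorem etaM_transpose : (etaM m).transpose = etaM m := by
  rw [etaM_eq, Matrix.diagonal_transpose]

/-- The frame matrix `(e^μ_k)`. -/
noncomputable def frameM (v : Coord m) : Matrix (Fin m) (Fin m) ℝ := Matrix.of v.2.1

/-- The matrix `(Γ^μ_{νσ})` with fixed `σ`. -/
noncomputable def gammaM (σ : Fin m) (v : Coord m) : Matrix (Fin m) (Fin m) ℝ :=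
  Matrix.of fun μ ν => v.2.2.1 μ ν σ

/-- The metric `g_{μν} = η_{ij} e^i_μ e^j_ν` determined by a frame. -/
noncomputable def metric (e : Matrix (Fin m) (Fin m) ℝ) : Matrix (Fin m) (Fin m) ℝ :=
  (e⁻¹).transpose * etaM m * e⁻¹

/-- The inverse metric `g^{μν} = η^{ij} e^μ_i e^ν_j` determined by a frame. -/
noncomputable def cometric (e : Matrix (Fin m) (Fin m) ℝ) : Matrix (Fin m) (Fin m) ℝ :=
  e * etaM m * e.transpose

theorem metric_transpose (e : Matrix (Fin m) (Fin m) ℝ) : (metric e).transpose = metric e := by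
  simp only [metric, Matrix.transpose_mul, Matrix.transpose_transpose, etaM_transpose, mul_assoc]

theorem cometric_mul_metric {e : Matrix (Fin m) (Fin m) ℝ} (h : e.det ≠ 0) :
    cometric e * metric e = 1 := by
  have h1 : e * e⁻¹ = 1 := Matrix.mul_nonsing_inv _ (isUnit_iff_ne_zero.2 h)
  have h2 : e.transpose * (e⁻¹).transpose = 1 := by
    rw [← Matrix.transpose_mul, Matrix.nonsing_inv_mul _ (isUnit_iff_ne_zero.2 h),
      Matrix.transpose_one]
  calc _ = e * (etaM m * ((e.transpose * (e⁻¹).transpose) * etaM m)) * e⁻¹ := by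
        simp only [cometric, metric, mul_assoc]
    _ = 1 := by rw [h2, one_mul, etaM_mul_self, mul_one, h1]

theorem metric_mul_cometric {e : Matrix (Fin m) (Fin m) ℝ} (h : e.det ≠ 0) :
    metric e * cometric e = 1 := mul_eq_one_comm.1 (cometric_mul_metric h)

/-- The matrix of the connection form `ω^i_j` evaluated on a tangent vector. -/
noncomputable def connM (w v : Coord m) : Matrix (Fin m) (Fin m) ℝ :=
  (frameM v)⁻¹ * (frameM w + ∑ σ, w.1 σ • (gammaM σ v * frameM v))

theorem oneForm_apply {X : Type*} [NormedAddCommGroup X] [NormedSpace ℝ X] (f : X → X →L[ℝ] ℝ)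
    (p : X) (w : Fin 1 → X) : oneForm f p w = f p (w 0) := rfl

theorem theta_apply (k : Fin m) (v : Coord m) (w : Fin 1 → Coord m) :
    theta k v w = ∑ μ, (frameM v)⁻¹ k μ * (w 0).1 μ := by
  simp [theta, oneForm_apply, dx, coframe, frameM]

theorem omega_apply (i j : Fin m) (v : Coord m) (w : Fin 1 → Coord m) :
    omega i j v w = connM (w 0) v i j := by
  simp only [omega, oneForm_apply, connM, Matrix.mul_apply, sum_apply, smul_apply, smul_eq_mul,
    sub_apply]
  refine Finset.sum_congr rfl fun μ _ => ?_
  congr 1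
  simp only [frameM, Matrix.add_apply, Matrix.of_apply, Matrix.sum_apply, Matrix.smul_apply,
    Matrix.mul_apply, jetCoord, gammaM, smul_eq_mul, neg_mul, Finset.sum_neg_distrib, sub_neg_eq_add]
  congr 1
  exact Finset.sum_congr rfl fun σ _ => mul_comm _ _

/-- Since η is symmetric and its own inverse, the metricity form is half the sum of the connection
matrix and its η-adjoint; it vanishes exactly on matrices in the Lie algebra of the Lorentz group.
-/
theorem omegaP_apply (ij : Fin m × Fin m) (v : Coord m) (w : Fin 1 → Coord m) :
    omegaP ij v w = (1 / 2 : ℝ) *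
      (connM (w 0) v + (etaM m * connM (w 0) v * etaM m).transpose) ij.1 ij.2 := by
  obtain ⟨i, j⟩ := ij
  simp only [omegaP, Pi.smul_apply, Pi.add_apply, Finset.sum_apply,
    ContinuousAlternatingMap.smul_apply, ContinuousAlternatingMap.add_apply,
    ContinuousAlternatingMap.sum_apply, omega_apply, smul_eq_mul, Matrix.add_apply,
    Matrix.transpose_apply]
  congr 2
  simp only [Matrix.mul_apply, etaM, Matrix.of_apply, Finset.sum_mul]
  rw [Finset.sum_comm]
  exact Finset.sum_congr rfl fun q _ => Finset.sum_congr rfl fun p _ => by ring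

theorem frameM_clm (i j : Fin m) (v : Coord m) : frameM v i j = de i j v := rfl

/-- The coordinate `Γ^μ_{νσ}` as a linear functional. -/
noncomputable def gammaL (μ ν σ : Fin m) : Coord m →L[ℝ] ℝ :=
  (ContinuousLinearMap.proj σ ∘L ContinuousLinearMap.proj ν ∘L ContinuousLinearMap.proj μ ∘L
    (SymArray m).subtypeL) ∘L ContinuousLinearMap.snd ℝ _ _ ∘L ContinuousLinearMap.snd ℝ _ _

theorem gammaM_clm (σ i j : Fin m) (v : Coord m) : gammaM σ v i j = gammaL i j σ v := rfl

theorem smoothMat_frameM (O : Set (Coord m)) : SmoothMat frameM O := fun i j =>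
  (de i j).contDiff.contDiffOn

theorem smoothMat_gammaM (σ : Fin m) (O : Set (Coord m)) : SmoothMat (gammaM σ) O := fun i j =>
  (gammaL i j σ).contDiff.contDiffOn

theorem dMat_frameM (w p : Coord m) : dMat w frameM p = frameM w := by
  ext i j
  simp only [dMat, frameM_clm, Matrix.of_apply, ContinuousLinearMap.fderiv]

theorem dMat_gammaM (σ : Fin m) (w p : Coord m) : dMat w (gammaM σ) p = gammaM σ w := by
  ext i j
  simp only [dMat, gammaM_clm, Matrix.of_apply, ContinuousLinearMap.fderiv]

end Coordinates

/-! ### The vertical field that extends a given frame variation. -/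

section VariationField

variable {m : ℕ}

theorem isOpen_frame (U : Set (E m)) (hU : IsOpen U) :
    IsOpen {v : Coord m | v.1 ∈ U ∧ (frameM v).det ≠ 0} := by
  refine (hU.preimage continuous_fst).inter ?_
  have : Continuous fun v : Coord m => (frameM v).det :=
    (contDiffOn_univ.1 (contDiffOn_det (smoothMat_frameM (m := m) univ))).continuous
  exact isOpen_ne.preimage this

theorem contDiffOn_oneForm {X : Type*} [NormedAddCommGroup X] [NormedSpace ℝ X]
    {f : X → X →L[ℝ] ℝ} {O : Set X} (h : ContDiffOn ℝ ∞ f O) : ContDiffOn ℝ ∞ (oneForm f) O :=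
  (ContinuousAlternatingMap.ofSubsingletonLIE (𝕜 := ℝ) (E := X) (F := ℝ)
    (0 : Fin 1)).toContinuousLinearEquiv.contDiff.comp_contDiffOn h

theorem contDiffOn_omega {O : Set (Coord m)} (h0 : ∀ v ∈ O, (frameM v).det ≠ 0) (i j : Fin m) :
    ContDiffOn ℝ ∞ (omega i j) O := by
  refine contDiffOn_oneForm (ContDiffOn.sum fun μ _ => ?_)
  refine ContDiffOn.smul (f := fun v : Coord m => coframe v.2.1 i μ) ((smoothMat_frameM O).inv h0 i μ) (contDiffOn_const.sub ?_)
  refine ContDiffOn.sum fun σ _ => ContDiffOn.smul_const ?_ _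
  refine ContDiffOn.neg (ContDiffOn.sum fun ν _ => ?_)
  exact (smoothMat_gammaM σ O μ ν).mul (smoothMat_frameM O ν j)

theorem contDiffOn_omegaP {O : Set (Coord m)} (h0 : ∀ v ∈ O, (frameM v).det ≠ 0)
    (ij : Fin m × Fin m) : ContDiffOn ℝ ∞ (omegaP ij) O := by
  have h : ∀ p, ContDiffOn ℝ ∞ (∑ q, (eta ij.2 p * eta q ij.1) • omega p q) O := fun p => by
    rw [show (∑ q, (eta ij.2 p * eta q ij.1) • omega p q) =
      fun v => ∑ q, (eta ij.2 p * eta q ij.1) • omega p q v by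
        funext v; simp only [Finset.sum_apply, Pi.smul_apply]]
    exact ContDiffOn.sum fun q _ => (contDiffOn_omega h0 p q).const_smul (_ : ℝ)
  have h' : ContDiffOn ℝ ∞ (∑ p, ∑ q, (eta ij.2 p * eta q ij.1) • omega p q) O := by
    rw [show (∑ p, ∑ q, (eta ij.2 p * eta q ij.1) • omega p q) =
      fun v => ∑ p, (∑ q, (eta ij.2 p * eta q ij.1) • omega p q) v by
        funext v; simp only [Finset.sum_apply]]
    exact ContDiffOn.sum fun p _ => h p
  exact ((contDiffOn_omega h0 _ _).add h').const_smul (_ : ℝ)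

/-- The partial derivative `∂_σ f`. -/
noncomputable def partialD (f : E m → ℝ) (σ : Fin m) (x : E m) : ℝ :=
  fderiv ℝ f x (EuclideanSpace.single σ 1)

theorem fderiv_eq_sum_partialD (f : E m → ℝ) (x y : E m) :
    fderiv ℝ f x y = ∑ σ, y σ * partialD f σ x := by
  have : y = ∑ σ, y σ • EuclideanSpace.single σ (1 : ℝ) := by
    have := (EuclideanSpace.basisFun (Fin m) ℝ).sum_repr y
    simpa using this.symm
  conv_lhs => rw [this, map_sum]
  simp [partialD]

/-- The covariant derivative `∂_σ f P + f [Γ_σ, P]` of the endomorphism field `f P`. -/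
noncomputable def covEnd (f : E m → ℝ) (P : Matrix (Fin m) (Fin m) ℝ) (σ : Fin m) (v : Coord m) :
    Matrix (Fin m) (Fin m) ℝ :=
  partialD f σ v.1 • P + f v.1 • (gammaM σ v * P - P * gammaM σ v)

/-- Minus the symmetrised covariant derivative of `f P`, with lowered index. -/
noncomputable def covSource (f : E m → ℝ) (P : Matrix (Fin m) (Fin m) ℝ) (v : Coord m) (σ : Fin m) :
    Matrix (Fin m) (Fin m) ℝ :=
  -(metric (frameM v) * covEnd f P σ v + (metric (frameM v) * covEnd f P σ v).transpose)

theorem covSource_transpose (f : E m → ℝ) (P : Matrix (Fin m) (Fin m) ℝ) (v : Coord m)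
    (σ : Fin m) : (covSource f P v σ).transpose = covSource f P v σ := by
  simp only [covSource, Matrix.transpose_neg, Matrix.transpose_add, Matrix.transpose_transpose,
    add_comm]

/-- The `Γ`-component of the variation field. -/
noncomputable def fieldGamma (f : E m → ℝ) (P : Matrix (Fin m) (Fin m) ℝ) (v : Coord m)
    (σ : Fin m) : Matrix (Fin m) (Fin m) ℝ :=
  cometric (frameM v) * koszul (covSource f P v) σ

/-- The vertical vector field with frame component `f P e` that preserves the metricity forms. -/
noncomputable def variationField (f : E m → ℝ) (P : Matrix (Fin m) (Fin m) ℝ) (v : Coord m) :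
    Coord m :=
  (0, f v.1 • (P * frameM v), symArray m (fieldGamma f P v))

theorem frameM_variationField (f : E m → ℝ) (P : Matrix (Fin m) (Fin m) ℝ) (v : Coord m) :
    frameM (variationField f P v) = f v.1 • (P * frameM v) := rfl

theorem gammaM_variationField (f : E m → ℝ) (P : Matrix (Fin m) (Fin m) ℝ) (v : Coord m)
    (σ : Fin m) : gammaM σ (variationField f P v) = fieldGamma f P v σ := by
  ext μ ν
  exact symArray_apply (fun σ ν μ => mul_koszul_symm (covSource_transpose f P v) _ σ ν μ) μ ν σ

/-- This is the equation for which the Γ-component was designed: `covEnd` plus `fieldGamma` is the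
σ-component of the variation of the connection, and Koszul's formula makes it skew for g while
keeping Γ symmetric. -/
theorem metric_mul_field {f : E m → ℝ} {P : Matrix (Fin m) (Fin m) ℝ} {v : Coord m}
    (h : (frameM v).det ≠ 0) (σ : Fin m) :
    metric (frameM v) * (covEnd f P σ v + fieldGamma f P v σ) +
      (metric (frameM v) * (covEnd f P σ v + fieldGamma f P v σ)).transpose = 0 := by
  rw [mul_add, fieldGamma, ← mul_assoc, metric_mul_cometric h, one_mul, Matrix.transpose_add]
  have := koszul_add_transpose (covSource_transpose f P v) σ
  rw [add_add_add_comm, this, covSource, add_neg_cancel]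

theorem SmoothMat.metric {Y : Type*} [NormedAddCommGroup Y] [NormedSpace ℝ Y]
    {A : Y → Matrix (Fin m) (Fin m) ℝ} {O : Set Y}
    (hA : SmoothMat A O) (h0 : ∀ q ∈ O, (A q).det ≠ 0) :
    SmoothMat (fun q => Lovelock.metric (A q)) O :=
  ((hA.inv h0).transpose.mul (smoothMat_const _ O)).mul (hA.inv h0)

theorem SmoothMat.cometric {Y : Type*} [NormedAddCommGroup Y] [NormedSpace ℝ Y]
    {A : Y → Matrix (Fin m) (Fin m) ℝ} {O : Set Y}
    (hA : SmoothMat A O) : SmoothMat (fun q => Lovelock.cometric (A q)) O :=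
  (hA.mul (smoothMat_const _ O)).mul hA.transpose

theorem SmoothMat.koszul {Y V : Type*} [NormedAddCommGroup Y] [NormedSpace ℝ Y]
    {B : Y → V → Matrix V V ℝ} {O : Set Y}
    (hB : ∀ σ, SmoothMat (fun q => B q σ) O) (σ : V) :
    SmoothMat (fun q => Lovelock.koszul (B q) σ) O := fun ν μ =>
  (((hB σ μ ν).add (hB μ σ ν)).sub (hB ν μ σ)).div_const 2

theorem contDiffOn_symArray {Y : Type*} [NormedAddCommGroup Y] [NormedSpace ℝ Y]
    {T : Y → Fin m → Matrix (Fin m) (Fin m) ℝ} {O : Set Y}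
    (hT : ∀ σ, SmoothMat (fun q => T q σ) O) :
    ContDiffOn ℝ ∞ (fun q => symArray m (T q)) O :=
  ContDiff.comp_contDiffOn (g := symArray m) (f := fun q σ μ ν => T q σ μ ν) (symArray m).contDiff
    (contDiffOn_pi.2 fun σ => contDiffOn_pi.2 fun μ => contDiffOn_pi.2 fun ν => hT σ μ ν)

theorem contDiffOn_variationField {f : E m → ℝ} (hf : ContDiff ℝ ∞ f)
    (P : Matrix (Fin m) (Fin m) ℝ) {O : Set (Coord m)} (h0 : ∀ v ∈ O, (frameM v).det ≠ 0) :
    ContDiffOn ℝ ∞ (variationField f P) O := by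
  have hf1 : ContDiffOn ℝ ∞ (fun v : Coord m => f v.1) O := (hf.comp contDiff_fst).contDiffOn
  have hP := smoothMat_const P O
  have hf2 : ∀ σ, ContDiffOn ℝ ∞ (fun v : Coord m => partialD f σ v.1) O := fun σ =>
    ((contDiffOn_univ.1 (contDiffOn_fderiv_apply isOpen_univ hf.contDiffOn
      (EuclideanSpace.single σ (1 : ℝ)))).comp contDiff_fst).contDiffOn
  refine contDiffOn_const.prodMk (ContDiffOn.prodMk ?_ (contDiffOn_symArray fun σ => ?_))
  · exact contDiffOn_pi.2 fun μ => contDiffOn_pi.2 fun j =>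
      SmoothMat.smul hf1 (hP.mul (smoothMat_frameM O)) μ j
  · refine (smoothMat_frameM O).cometric.mul (SmoothMat.koszul (fun σ => ?_) σ)
    have hg := (smoothMat_frameM O).metric h0
    have hq : SmoothMat (covEnd f P σ) O :=
      (SmoothMat.smul (hf2 σ) hP).add (SmoothMat.smul hf1
        (((smoothMat_gammaM σ O).mul hP).sub (hP.mul (smoothMat_gammaM σ O))))
    exact ((hg.mul hq).add (hg.mul hq).transpose).neg

theorem clm_fderiv {X : Type*} [NormedAddCommGroup X] [NormedSpace ℝ X] (L : X →L[ℝ] ℝ) {Z : X → X}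
    {p : X} (hZ : DifferentiableAt ℝ Z p) (w : X) :
    L (fderiv ℝ Z p w) = fderiv ℝ (fun q => L (Z q)) p w := by
  rw [show (fun q => L (Z q)) = L ∘ Z from rfl, fderiv_comp p L.differentiableAt hZ]
  simp

theorem fderiv_fst_comp {f : E m → ℝ} (hf : ContDiff ℝ ∞ f) (p w : Coord m) :
    fderiv ℝ (fun v : Coord m => f v.1) p w = fderiv ℝ f p.1 w.1 := by
  rw [show (fun v : Coord m => f v.1) = f ∘ Prod.fst from rfl,
    fderiv_comp p (hf.differentiable (by simp)).differentiableAt differentiableAt_fst, fderiv_fst]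
  rfl

theorem frameM_fderiv_variationField {f : E m → ℝ} (hf : ContDiff ℝ ∞ f)
    (P : Matrix (Fin m) (Fin m) ℝ) {p : Coord m}
    (hZ : DifferentiableAt ℝ (variationField f P) p) (w : Coord m) :
    frameM (fderiv ℝ (variationField f P) p w) =
      fderiv ℝ f p.1 w.1 • (P * frameM p) + f p.1 • (P * frameM w) := by
  have h1 : frameM (fderiv ℝ (variationField f P) p w) =
      dMat w (fun v => f v.1 • (P * frameM v)) p := by
    ext i j
    rw [frameM_clm, clm_fderiv _ hZ]; rfl
  have hd : DifferentiableAt ℝ (fun v : Coord m => f v.1) p :=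
    (hf.differentiable (by simp)).differentiableAt.comp p differentiableAt_fst
  have he : DiffMat frameM p := (smoothMat_frameM univ).diffMat isOpen_univ (mem_univ p)
  rw [h1, dMat_smul hd ((diffMat_const P p).mul he), dMat_mul (diffMat_const P p) he, dMat_const,
    dMat_frameM, zero_mul, zero_add, fderiv_fst_comp hf]

theorem fst_fderiv_variationField {f : E m → ℝ}
    (P : Matrix (Fin m) (Fin m) ℝ) {p : Coord m}
    (hZ : DifferentiableAt ℝ (variationField f P) p) (w : Coord m) (σ : Fin m) :
    (fderiv ℝ (variationField f P) p w).1 σ = 0 := by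
  have : (fderiv ℝ (variationField f P) p w).1 σ = dx σ (fderiv ℝ (variationField f P) p w) := rfl
  rw [this, clm_fderiv _ hZ]
  have : (fun q => dx σ (variationField f P q)) = fun _ => (0 : ℝ) := by
    funext q; simp [dx, variationField]
  simp [this]

end VariationField

/-! ### The variation field preserves the metricity forms. -/

section Symmetry

variable {m : ℕ}

theorem det_inv_cancel {e : Matrix (Fin m) (Fin m) ℝ} (h : e.det ≠ 0) :
    e⁻¹ * e = 1 ∧ e * e⁻¹ = 1 :=
  ⟨Matrix.nonsing_inv_mul _ (isUnit_iff_ne_zero.2 h),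
    Matrix.mul_nonsing_inv _ (isUnit_iff_ne_zero.2 h)⟩

theorem smoothMat_connM (w : Coord m) {O : Set (Coord m)} (h0 : ∀ v ∈ O, (frameM v).det ≠ 0) :
    SmoothMat (connM w) O :=
  ((smoothMat_frameM O).inv h0).mul ((smoothMat_const _ O).add
    (SmoothMat.sum fun σ => SmoothMat.smul contDiffOn_const
      ((smoothMat_gammaM σ O).mul (smoothMat_frameM O))))

theorem dMat_connM {O : Set (Coord m)} (hO : IsOpen O) (h0 : ∀ v ∈ O, (frameM v).det ≠ 0)
    {p : Coord m} (hp : p ∈ O) (w z : Coord m) :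
    dMat z (connM w) p = -((frameM p)⁻¹ * frameM z * connM w p) +
      (frameM p)⁻¹ * ∑ σ, w.1 σ • (gammaM σ z * frameM p + gammaM σ p * frameM z) := by
  have he := (smoothMat_frameM O).diffMat hO hp
  have hi := ((smoothMat_frameM O).inv h0).diffMat hO hp
  have hG : ∀ σ, DiffMat (gammaM σ) p := fun σ => (smoothMat_gammaM σ O).diffMat hO hp
  have hs : ∀ σ, DiffMat (fun v => w.1 σ • (gammaM σ v * frameM v)) p := fun σ =>
    DiffMat.smul (differentiableAt_const _) ((hG σ).mul he)
  have hc := diffMat_const (frameM w) p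
  have : connM w = fun v => (frameM v)⁻¹ * (frameM w + ∑ σ, w.1 σ • (gammaM σ v * frameM v)) := rfl
  rw [this, dMat_mul hi (hc.add (DiffMat.sum hs)), dMat_inv hO (smoothMat_frameM O) h0 hp,
    dMat_add hc (DiffMat.sum hs), dMat_const, dMat_sum hs, zero_add, dMat_frameM]
  congr 1
  · rw [neg_mul, mul_assoc]
  · congr 1
    refine Finset.sum_congr rfl fun σ _ => ?_
    rw [dMat_smul (differentiableAt_const _) ((hG σ).mul he), dMat_mul (hG σ) he, dMat_gammaM,
      dMat_frameM]
    simp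

/-- The Lie derivative of the connection form along the variation field. -/
theorem dMat_connM_add {f : E m → ℝ} (hf : ContDiff ℝ ∞ f)
    (P : Matrix (Fin m) (Fin m) ℝ) {O : Set (Coord m)} (hO : IsOpen O)
    (h0 : ∀ v ∈ O, (frameM v).det ≠ 0) {p : Coord m} (hp : p ∈ O) (w : Coord m) :
    dMat (variationField f P p) (connM w) p + connM (fderiv ℝ (variationField f P) p w) p =
      ∑ σ, w.1 σ • ((frameM p)⁻¹ * (covEnd f P σ p + fieldGamma f P p σ) * frameM p) := by
  have hZ : DifferentiableAt ℝ (variationField f P) p :=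
    ((contDiffOn_variationField hf P h0).contDiffAt (hO.mem_nhds hp)).differentiableAt (by simp)
  have e2 : connM (fderiv ℝ (variationField f P) p w) p =
      (frameM p)⁻¹ * (fderiv ℝ f p.1 w.1 • (P * frameM p) + f p.1 • (P * frameM w)) := by
    simp only [connM, fst_fderiv_variationField P hZ, zero_smul, Finset.sum_const_zero, add_zero,
      frameM_fderiv_variationField hf P hZ]
  rw [e2, dMat_connM hO h0 hp, frameM_variationField, fderiv_eq_sum_partialD]
  simp only [gammaM_variationField]
  have hc := det_inv_cancel (h0 p hp)
  -- This produces the term f P de(w), which cancels the one from the derivative of the field. What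
  -- survives involves only the dx-components of w: the Lie derivative of ω is horizontal.
  have e3 : (frameM p)⁻¹ * f p.1 • (P * frameM p) * connM w p =
      (frameM p)⁻¹ * (f p.1 • (P * frameM w) +
        ∑ σ, w.1 σ • (f p.1 • (P * gammaM σ p * frameM p))) := by
    rw [connM, mul_assoc]
    congr 1
    rw [Matrix.smul_mul, mul_assoc, ← mul_assoc (frameM p), hc.2, one_mul, mul_add, smul_add,
      Finset.mul_sum, Finset.smul_sum]
    congr 1
    refine Finset.sum_congr rfl fun σ _ => ?_
    rw [Matrix.mul_smul, smul_comm, mul_assoc]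
  have e4 : ∀ M N : Matrix (Fin m) (Fin m) ℝ, -((frameM p)⁻¹ * M) + (frameM p)⁻¹ * N =
      (frameM p)⁻¹ * (N - M) := fun M N => by rw [mul_sub]; abel
  rw [e3, e4, ← mul_add]
  simp only [mul_assoc ((frameM p)⁻¹), ← Matrix.mul_smul, ← Finset.mul_sum]
  congr 1
  rw [Finset.sum_smul, sub_add, add_sub_right_comm, sub_eq_add_neg]
  simp only [covEnd, add_mul, smul_add, sub_mul, smul_sub, Finset.sum_add_distrib,
    Finset.sum_sub_distrib, Finset.mul_sum, Matrix.smul_mul, Matrix.mul_smul, mul_smul, mul_assoc]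
  abel

/-- As g = e⁻ᵀ η e⁻¹, congruence by e turns skewness for g into skewness for η of the conjugate e⁻¹
Q e. -/
theorem etaM_skew_of_metric_skew {Q e : Matrix (Fin m) (Fin m) ℝ} (h : e.det ≠ 0)
    (hQ : metric e * Q + (metric e * Q).transpose = 0) :
    etaM m * (e⁻¹ * Q * e) + (etaM m * (e⁻¹ * Q * e)).transpose = 0 := by
  have hc := det_inv_cancel h
  have hc' : e.transpose * (e⁻¹).transpose = 1 := by
    rw [← Matrix.transpose_mul, hc.1, Matrix.transpose_one]
  have h1 : etaM m * (e⁻¹ * Q * e) = e.transpose * (metric e * Q) * e := by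
    simp only [metric, mul_assoc]
    rw [← mul_assoc e.transpose, hc', one_mul]
  have h2 := congrArg (fun M => e.transpose * M * e) hQ
  simp only [mul_add, add_mul, mul_zero, zero_mul] at h2
  rw [h1]
  simpa [Matrix.transpose_mul, mul_assoc] using h2

theorem add_eta_conj_transpose {D : Matrix (Fin m) (Fin m) ℝ} :
    etaM m * D + (etaM m * D).transpose = 0 ↔ D + (etaM m * D * etaM m).transpose = 0 := by
  have h1 : D + (etaM m * D * etaM m).transpose = etaM m * (etaM m * D + (etaM m * D).transpose) := by
    simp only [Matrix.transpose_mul, etaM_transpose, mul_add, ← mul_assoc, etaM_mul_self, one_mul]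
  have h2 : etaM m * D + (etaM m * D).transpose = etaM m * (D + (etaM m * D * etaM m).transpose) := by
    rw [h1, ← mul_assoc, etaM_mul_self, one_mul]
  constructor
  · intro h; rw [h1, h, mul_zero]
  · intro h; rw [h2, h, mul_zero]

/-- The Lie derivative of ω is conjugate by the frame to a g-skew matrix, hence is η-skew, and the
projection to 𝔭 kills it. -/
theorem lieDeriv_omegaP {f : E m → ℝ} (hf : ContDiff ℝ ∞ f)
    (P : Matrix (Fin m) (Fin m) ℝ) {O : Set (Coord m)} (hO : IsOpen O)
    (h0 : ∀ v ∈ O, (frameM v).det ≠ 0) (ij : Fin m × Fin m) :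
    EqOn (lieDeriv (variationField f P) (omegaP ij)) 0 O := by
  intro p hp
  ext v
  have hZ : DifferentiableAt ℝ (variationField f P) p :=
    ((contDiffOn_variationField hf P h0).contDiffAt (hO.mem_nhds hp)).differentiableAt (by simp)
  have hω : DifferentiableAt ℝ (omegaP ij) p :=
    ((contDiffOn_omegaP h0 ij).contDiffAt (hO.mem_nhds hp)).differentiableAt (by simp)
  have hC : DiffMat (connM (v 0)) p := (smoothMat_connM (v 0) h0).diffMat hO hp
  have hη := diffMat_const (etaM m) p
  have h1 : fderiv ℝ (omegaP ij) p (variationField f P p) v = (1 / 2 : ℝ) *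
      dMat (variationField f P p)
        (fun q => connM (v 0) q + (etaM m * connM (v 0) q * etaM m).transpose) p ij.1 ij.2 := by
    have hA : fderiv ℝ (fun q => omegaP ij q v) p (variationField f P p) =
        fderiv ℝ (omegaP ij) p (variationField f P p) v := by
      rw [fderiv_continuousAlternatingMap_apply_const_apply hω]
    rw [← hA]
    simp only [omegaP_apply]
    rw [fderiv_const_mul ((hC.add ((hη.mul hC).mul hη).transpose) ij.1 ij.2)]
    rfl
  rw [lieDeriv_apply hω hZ, h1, dMat_add hC ((hη.mul hC).mul hη).transpose, dMat_transpose,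
    dMat_mul (hη.mul hC) hη, dMat_mul hη hC, dMat_const]
  simp only [Finset.univ_unique, Fin.default_eq_zero, Finset.sum_singleton, omegaP_apply,
    Function.update_self, zero_mul, zero_add, mul_zero, add_zero, Pi.zero_apply]
  rw [← mul_add, ← Matrix.add_apply, add_add_add_comm, ← Matrix.transpose_add, ← add_mul, ← mul_add,
    dMat_connM_add hf P hO h0 hp]
  have hk : ∑ σ, (v 0).1 σ • ((frameM p)⁻¹ * (covEnd f P σ p + fieldGamma f P p σ) * frameM p) =
      (frameM p)⁻¹ * (∑ σ, (v 0).1 σ • (covEnd f P σ p + fieldGamma f P p σ)) * frameM p := by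
    simp only [Finset.mul_sum, Finset.sum_mul, Matrix.mul_smul, Matrix.smul_mul]
  rw [hk, add_eta_conj_transpose.1 (etaM_skew_of_metric_skew (h0 p hp) ?_)]
  · simp
  · simp only [Finset.mul_sum, Matrix.mul_smul, Matrix.transpose_sum, Matrix.transpose_smul,
      ← Finset.sum_add_distrib, ← smul_add, metric_mul_field (h0 p hp), smul_zero,
      Finset.sum_const_zero]

theorem isInfinitesimalSymmetry_variationField {f : E m → ℝ} (hf : ContDiff ℝ ∞ f)
    (P : Matrix (Fin m) (Fin m) ℝ) {O : Set (Coord m)} (hO : IsOpen O)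
    (h0 : ∀ v ∈ O, (frameM v).det ≠ 0) :
    IsInfinitesimalSymmetry O omegaP (variationField f P) :=
  isInfinitesimalSymmetry_of_lieDeriv_gen hO (contDiffOn_omegaP h0)
    (contDiffOn_variationField hf P h0) (lieDeriv_omegaP hf P hO h0)

end Symmetry

/-! ### Signed sums over bijections from positions to indices. -/

section AlternatingSums

variable {P Q V : Type*} [Fintype P] [DecidableEq P] [Fintype V] [DecidableEq V]
  [Fintype Q] [DecidableEq Q]

/-- The sign of a bijection, relative to a reference bijection. -/
noncomputable def sgn (e π : P ≃ V) : ℝ := ((Equiv.Perm.sign (e.symm.trans π) : ℤ) : ℝ)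

theorem sgn_trans (e π : P ≃ V) (τ : Equiv.Perm P) :
    sgn e (τ.trans π) = ((Equiv.Perm.sign τ : ℤ) : ℝ) * sgn e π := by
  have h : (e.symm.trans (τ.trans π) : Equiv.Perm V) =
      ((e.symm.trans τ).trans e : Equiv.Perm V).trans (e.symm.trans π) := by
    ext x; simp
  rw [sgn, h, ← Equiv.Perm.mul_def, Equiv.Perm.sign_mul, Equiv.Perm.sign_symm_trans_trans, sgn]
  push_cast; ring

theorem sum_sgn_trans (e : P ≃ V) (τ : Equiv.Perm P) (F : (P ≃ V) → ℝ) :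
    ∑ π, sgn e π * F π = ((Equiv.Perm.sign τ : ℤ) : ℝ) * ∑ π, sgn e π * F (τ.trans π) := by
  let E : (P ≃ V) ≃ (P ≃ V) := ⟨fun π => τ.trans π, fun π => τ.symm.trans π,
    fun π => by ext; simp, fun π => by ext; simp⟩
  rw [← Equiv.sum_comp E, Finset.mul_sum]
  refine Finset.sum_congr rfl fun π _ => ?_
  show sgn e (τ.trans π) * F (τ.trans π) = _
  rw [sgn_trans, mul_assoc]

/-- An alternating sum vanishes if its summand is annihilated by some signed sum of
permutations of the positions that leave the remaining factor invariant. -/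
theorem sum_sgn_mul_eq_zero {ι : Type*} [Fintype ι] [Nonempty ι] (e : P ≃ V)
    (τ : ι → Equiv.Perm P) (ψ rest : (P ≃ V) → ℝ)
    (hψ : ∀ σ, ∑ i, ((Equiv.Perm.sign (τ i) : ℤ) : ℝ) * ψ ((τ i).trans σ) = 0)
    (hr : ∀ i σ, rest ((τ i).trans σ) = rest σ) :
    ∑ σ, sgn e σ * (ψ σ * rest σ) = 0 := by
  -- Averaging: write the sum once for each i, reindex the i-th copy by τ i, and add; the invariant
  -- factor comes out and the hypothesis on ψ applies.
  have h : (Fintype.card ι : ℝ) * ∑ σ, sgn e σ * (ψ σ * rest σ) = 0 := by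
    rw [← nsmul_eq_mul, ← Finset.card_univ, ← Finset.sum_const]
    rw [Finset.sum_congr rfl fun i _ => sum_sgn_trans e (τ i) fun σ => ψ σ * rest σ]
    simp only [Finset.mul_sum]
    rw [Finset.sum_comm]
    refine Finset.sum_eq_zero fun σ _ => ?_
    have : ∀ i, ((Equiv.Perm.sign (τ i) : ℤ) : ℝ) *
        (sgn e σ * (ψ ((τ i).trans σ) * rest ((τ i).trans σ))) =
        (((Equiv.Perm.sign (τ i) : ℤ) : ℝ) * ψ ((τ i).trans σ)) * (sgn e σ * rest σ) := by
      intro i; rw [hr]; ring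
    rw [Finset.sum_congr rfl fun i _ => this i, ← Finset.sum_mul, hψ, zero_mul]
  exact (mul_eq_zero.1 h).resolve_left (Nat.cast_ne_zero.2 Fintype.card_ne_zero)

/-- Infinitesimal invariance of the determinant: the slotwise action of a matrix on an
alternating sum is multiplication by the trace. -/
theorem sum_sgn_slot (e : P ≃ V) (A : V → V → ℝ) (F : (P → V) → ℝ) :
    ∑ π : P ≃ V, sgn e π * ∑ p, ∑ l, A (π p) l * F (Function.update π p l) =
      (∑ i, A i i) * ∑ π : P ≃ V, sgn e π * F π := by
  -- As π is bijective, the new index l is π q for a unique position q. The off-diagonal terms put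
  -- the same value at p and q, and so cancel in pairs; the diagonal ones give the trace.
  set T : P → P → ℝ := fun p q =>
    ∑ π : P ≃ V, sgn e π * (A (π p) (π q) * F (Function.update π p (π q))) with hT
  have h1 : ∑ π : P ≃ V, sgn e π * ∑ p, ∑ l, A (π p) l * F (Function.update π p l) =
      ∑ p, ∑ q, T p q := by
    have : ∀ π : P ≃ V, sgn e π * ∑ p, ∑ l, A (π p) l * F (Function.update π p l) =
        ∑ p, ∑ q, sgn e π * (A (π p) (π q) * F (Function.update π p (π q))) := by
      intro π
      simp only [Finset.mul_sum]
      exact Finset.sum_congr rfl fun p _ => (Equiv.sum_comp π fun l =>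
        sgn e π * (A (π p) l * F (Function.update π p l))).symm
    simp only [this, hT]
    rw [Finset.sum_comm]
    exact Finset.sum_congr rfl fun p _ => Finset.sum_comm
  have h2 : ∀ p q, p ≠ q → T p q = -T q p := by
    intro p q hpq
    simp only [hT]
    rw [sum_sgn_trans e (Equiv.swap p q), Equiv.Perm.sign_swap hpq]
    simp only [Units.val_neg, Units.val_one, Int.cast_neg, Int.cast_one, neg_mul, one_mul]
    congr 1
    refine Finset.sum_congr rfl fun π _ => ?_
    have : Function.update (⇑((Equiv.swap p q).trans π)) p (π p) = Function.update π q (π p) := by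
      funext x
      by_cases hp : x = p
      · subst hp; simp [Function.update_of_ne hpq]
      · by_cases hq : x = q
        · subst hq; simp [Function.update_of_ne hp]
        · simp [Function.update_of_ne hp, Function.update_of_ne hq, Equiv.swap_apply_of_ne_of_ne hp hq]
    simp only [Equiv.trans_apply, Equiv.swap_apply_left, Equiv.swap_apply_right, this]
  have h3 : ∑ p, ∑ q, T p q = ∑ p, T p p + ∑ p, ∑ q, if p = q then 0 else T p q := by
    rw [← Finset.sum_add_distrib]
    refine Finset.sum_congr rfl fun p _ => ?_
    rw [← Finset.add_sum_erase _ _ (Finset.mem_univ p),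
      ← Finset.add_sum_erase (f := fun q => if p = q then 0 else T p q) _ (Finset.mem_univ p)]
    simp only [if_true, zero_add]
    congr 1
    exact Finset.sum_congr rfl fun q hq => by rw [if_neg (Finset.ne_of_mem_erase hq).symm]
  have h4 : ∑ p, ∑ q, (if p = q then 0 else T p q) = 0 := by
    have : ∑ p, ∑ q, (if p = q then 0 else T p q) = -∑ p, ∑ q, (if p = q then 0 else T p q) := by
      conv_lhs => rw [Finset.sum_comm]
      simp only [← Finset.sum_neg_distrib]
      refine Finset.sum_congr rfl fun p _ => Finset.sum_congr rfl fun q _ => ?_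
      by_cases h : p = q
      · simp [h]
      · rw [if_neg h, if_neg (Ne.symm h), h2 q p (Ne.symm h)]
    linarith
  rw [h1, h3, h4, add_zero]
  simp only [hT]
  rw [Finset.sum_comm, Finset.mul_sum]
  refine Finset.sum_congr rfl fun π _ => ?_
  simp only [Function.update_eq_self]
  rw [← Finset.mul_sum, ← Finset.sum_mul, Equiv.sum_comp π fun i => A i i]
  ring

/-- The slotwise action of a matrix on a product of local factors. -/
theorem sum_slot_prod {P Q V : Type*} [Fintype P] [DecidableEq P] [Fintype V]
    [Fintype Q] [DecidableEq Q] (blk : P → Q) (G : Q → (P → V) → ℝ)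
    (hG : ∀ q f p l, blk p ≠ q → G q (Function.update f p l) = G q f) (A : V → V → ℝ) (f : P → V) :
    ∑ p, ∑ l, A (f p) l * ∏ q, G q (Function.update f p l) =
      ∑ q, (∑ p with blk p = q, ∑ l, A (f p) l * G q (Function.update f p l)) *
        ∏ q' ∈ Finset.univ.erase q, G q' f := by
  rw [← Finset.sum_fiberwise (s := Finset.univ) (g := blk)]
  refine Finset.sum_congr rfl fun q _ => ?_
  rw [Finset.sum_mul]
  refine Finset.sum_congr rfl fun p hp => ?_
  have hp' : blk p = q := (Finset.mem_filter.1 hp).2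
  rw [Finset.sum_mul]
  refine Finset.sum_congr rfl fun l _ => ?_
  rw [← Finset.mul_prod_erase _ _ (Finset.mem_univ q), mul_assoc]
  congr 2
  exact Finset.prod_congr rfl fun q' hq' => hG q' f p l (by
    rw [hp']; exact (Finset.ne_of_mem_erase hq').symm)

/-- The total derivative of an alternating sum of products in the direction of the index at
position `p₀` reduces to the covariant derivative of a single factor, if the antisymmetrised
covariant derivatives of the other factors vanish. -/
theorem sum_sgn_divergence (e : P ≃ V) (blk : P → Q) (G : Q → (P → V) → (P → V) → ℝ)
    (hG : ∀ q f h p l, blk p ≠ q → G q (Function.update f p l) h = G q f h)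
    (G' : V → Q → (P → V) → (P → V) → ℝ) (κ : V → V → V → ℝ) (hκ : ∀ a, ∑ i, κ a i i = 0)
    (p₀ : P) (q₀ : Q)
    (hkill : ∀ q ≠ q₀, ∀ π : P ≃ V, ∑ σ : P ≃ V, sgn e σ * ((G' (σ p₀) q π σ +
      ∑ p with blk p = q, ∑ l, κ (σ p₀) (π p) l * G q (Function.update π p l) σ) *
        ∏ q' ∈ Finset.univ.erase q, G q' π σ) = 0) :
    ∑ π : P ≃ V, ∑ σ : P ≃ V, sgn e π * sgn e σ *
      ∑ q, G' (σ p₀) q π σ * ∏ q' ∈ Finset.univ.erase q, G q' π σ =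
    ∑ π : P ≃ V, ∑ σ : P ≃ V, sgn e π * sgn e σ * ((G' (σ p₀) q₀ π σ +
      ∑ p with blk p = q₀, ∑ l, κ (σ p₀) (π p) l * G q₀ (Function.update π p l) σ) *
        ∏ q' ∈ Finset.univ.erase q₀, G q' π σ) := by
  have h1 : ∑ π : P ≃ V, ∑ σ : P ≃ V, sgn e π * sgn e σ *
      ∑ p, ∑ l, κ (σ p₀) (π p) l * ∏ q, G q (Function.update π p l) σ = 0 := by
    rw [Finset.sum_comm]
    refine Finset.sum_eq_zero fun σ _ => ?_
    have := sum_sgn_slot e (κ (σ p₀)) fun f => ∏ q, G q f σ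
    rw [hκ, zero_mul] at this
    calc _ = sgn e σ * ∑ π : P ≃ V, sgn e π *
        ∑ p, ∑ l, κ (σ p₀) (π p) l * ∏ q, G q (Function.update π p l) σ := by
          rw [Finset.mul_sum]; exact Finset.sum_congr rfl fun π _ => by ring
      _ = 0 := by rw [this, mul_zero]
  have h2 : ∀ π : P ≃ V, ∑ σ : P ≃ V, sgn e π * sgn e σ * ((∑ q, (G' (σ p₀) q π σ +
      ∑ p with blk p = q, ∑ l, κ (σ p₀) (π p) l * G q (Function.update π p l) σ) *
        ∏ q' ∈ Finset.univ.erase q, G q' π σ) ) =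
      ∑ σ : P ≃ V, sgn e π * sgn e σ * ((G' (σ p₀) q₀ π σ +
      ∑ p with blk p = q₀, ∑ l, κ (σ p₀) (π p) l * G q₀ (Function.update π p l) σ) *
        ∏ q' ∈ Finset.univ.erase q₀, G q' π σ) := by
    intro π
    rw [Finset.sum_congr rfl fun σ _ => Finset.mul_sum _ _ (sgn e π * sgn e σ), Finset.sum_comm,
      ← Finset.add_sum_erase _ _ (Finset.mem_univ q₀), add_eq_left]
    refine Finset.sum_eq_zero fun q hq => ?_
    rw [Finset.sum_congr rfl fun σ _ => mul_assoc (sgn e π) (sgn e σ) _, ← Finset.mul_sum,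
      hkill q (Finset.ne_of_mem_erase hq) π, mul_zero]
  rw [← Finset.sum_congr rfl fun π _ => h2 π, ← add_zero (∑ π, _), ← h1,
    ← Finset.sum_add_distrib]
  refine Finset.sum_congr rfl fun π _ => ?_
  rw [← Finset.sum_add_distrib]
  refine Finset.sum_congr rfl fun σ _ => ?_
  rw [sum_slot_prod blk (fun q f => G q f σ) (fun q f p l h => hG q f σ p l h), ← mul_add,
    ← Finset.sum_add_distrib]
  congr 1
  exact Finset.sum_congr rfl fun q _ => by rw [add_mul]

end AlternatingSums

/-! ### The alternating sum behind the Lagrangian and its divergence identity. -/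

section LagrangianSum

variable {V : Type*} [Fintype V] [DecidableEq V] {k r : ℕ}

/-- The index positions of a product of `k` coframe factors and `r` curvature factors; every
position carries a frame index and a coordinate index. -/
abbrev Pos (k r : ℕ) := Fin k ⊕ (Fin r × Bool)

/-- The factor to which a position belongs. -/
def blk : Pos k r → Fin k ⊕ Fin r
  | .inl a => .inl a
  | .inr (b, _) => .inr b

/-- The factors `c^k_ν` and `R^{ij}_{μν}` of the Lagrangian. -/
def fac (c : V → V → ℝ) (R : V → V → V → V → ℝ) (q : Fin k ⊕ Fin r) (f h : Pos k r → V) : ℝ :=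
  match q with
  | .inl a => c (f (.inl a)) (h (.inl a))
  | .inr b => R (f (.inr (b, false))) (f (.inr (b, true))) (h (.inr (b, false)))
      (h (.inr (b, true)))

theorem fac_update {V : Type*} {k r : ℕ} (c : V → V → ℝ) (R : V → V → V → V → ℝ) (q : Fin k ⊕ Fin r)
    (f h : Pos k r → V) (p : Pos k r) (l : V) (hp : blk p ≠ q) :
    fac c R q (Function.update f p l) h = fac c R q f h := by
  rcases q with a | b
  · have : (Sum.inl a : Pos k r) ≠ p := by rintro rfl; exact hp rfl
    simp only [fac, Function.update_of_ne this]
  · have h1 : ∀ s, (Sum.inr (b, s) : Pos k r) ≠ p := by rintro s rfl; exact hp rfl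
    simp only [fac, Function.update_of_ne (h1 _)]

/-- The alternating sum of products of coframe components and curvature components. -/
noncomputable def altSum (e : Pos k r ≃ V) (c : V → V → ℝ) (R : V → V → V → V → ℝ) : ℝ :=
  ∑ π : Pos k r ≃ V, ∑ σ : Pos k r ≃ V, sgn e π * sgn e σ * ∏ q, fac c R q π σ

/-- The alternating sum with the factor `q` replaced by `X`. -/
noncomputable def altSumWith (e : Pos k r ≃ V) (c : V → V → ℝ) (R : V → V → V → V → ℝ)
    (q : Fin k ⊕ Fin r) (X : (Pos k r → V) → (Pos k r → V) → ℝ) : ℝ :=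
  ∑ π : Pos k r ≃ V, ∑ σ : Pos k r ≃ V, sgn e π * sgn e σ *
    (X π σ * ∏ q' ∈ Finset.univ.erase q, fac c R q' π σ)

/-- The factors with the curvature in the factor `b` replaced by the one-form `w`. -/
def facW (c : V → V → ℝ) (R : V → V → V → V → ℝ) (w : V → V → V → ℝ) (b : Fin r)
    (q : Fin k ⊕ Fin r) (f h : Pos k r → V) : ℝ :=
  if q = .inr b then w (f (.inr (b, false))) (f (.inr (b, true))) (h (.inr (b, true)))
    else fac c R q f h

theorem sum_filter_blk_inl (a : Fin k) (F : Pos k r → ℝ) :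
    ∑ p with blk p = .inl a, F p = F (.inl a) := by
  rw [Finset.sum_filter, Finset.sum_eq_single (.inl a)]
  · simp [blk]
  · rintro (a' | ⟨b, s⟩) _ hne
    · rw [if_neg]; rintro h; simp only [blk, Sum.inl.injEq] at h; exact hne (by rw [h])
    · simp [blk]
  · simp

theorem sum_filter_blk_inr (b : Fin r) (F : Pos k r → ℝ) :
    ∑ p with blk p = .inr b, F p = F (.inr (b, false)) + F (.inr (b, true)) := by
  rw [Finset.sum_filter, Fintype.sum_sum_type, Fintype.sum_prod_type]
  simp only [blk, reduceCtorEq, if_false, Finset.sum_const_zero, zero_add, Sum.inr.injEq,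
    Fintype.sum_bool]
  rw [Finset.sum_eq_single b]
  · simp [add_comm]
  · intro b' _ h; simp [h]
  · simp

/-- The divergence of the alternating sum with one curvature replaced by a one-form `w` is the
alternating sum with that factor replaced by the covariant derivative of `w`, for a torsion-free
coframe, a curvature that satisfies the Bianchi identity, and a traceless connection. -/
theorem sum_sgn_divergence_facW (e : Pos k r ≃ V) (c : V → V → ℝ) (R : V → V → V → V → ℝ)
    (w : V → V → V → ℝ) (c' : V → V → V → ℝ) (R' : V → V → V → V → V → ℝ)
    (w' : V → V → V → V → ℝ) (κ : V → V → V → ℝ) (hκ : ∀ a, ∑ i, κ a i i = 0)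
    (hT : ∀ a i b, c' a i b + ∑ l, κ a i l * c l b = c' b i a + ∑ l, κ b i l * c l a)
    (DR : V → V → V → V → V → ℝ)
    (hDR : ∀ a i j μ ν, DR a i j μ ν = R' a i j μ ν + (∑ l, κ a i l * R l j μ ν +
      ∑ l, κ a j l * R i l μ ν))
    (hB : ∀ i j a b d, DR a i j b d + DR b i j d a + DR d i j a b = 0) (b : Fin r) :
    ∑ π : Pos k r ≃ V, ∑ σ : Pos k r ≃ V, sgn e π * sgn e σ *
      ∑ q, (if q = .inr b then w' (σ (.inr (b, false))) (π (.inr (b, false))) (π (.inr (b, true)))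
          (σ (.inr (b, true))) else fac (c' (σ (.inr (b, false)))) (R' (σ (.inr (b, false)))) q π σ) *
        ∏ q' ∈ Finset.univ.erase q, facW c R w b q' π σ =
    altSumWith e c R (.inr b) fun π σ =>
      w' (σ (.inr (b, false))) (π (.inr (b, false))) (π (.inr (b, true))) (σ (.inr (b, true))) +
      (∑ l, κ (σ (.inr (b, false))) (π (.inr (b, false))) l * w l (π (.inr (b, true)))
          (σ (.inr (b, true))) +
        ∑ l, κ (σ (.inr (b, false))) (π (.inr (b, true))) l * w (π (.inr (b, false))) l
          (σ (.inr (b, true)))) := by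
  have key := sum_sgn_divergence e blk (facW c R w b) (by
      intro q f h p l hp
      by_cases hq : q = .inr b
      · have h1 : ∀ s, (Sum.inr (b, s) : Pos k r) ≠ p := by rintro s rfl; exact hp hq.symm
        simp only [facW, if_pos hq, Function.update_of_ne (h1 _)]
      · simp only [facW, if_neg hq, fac_update c R q f h p l hp])
    (fun a q f h => if q = .inr b then w' a (f (.inr (b, false))) (f (.inr (b, true)))
          (h (.inr (b, true))) else fac (c' a) (R' a) q f h) κ hκ (.inr (b, false)) (.inr b) ?_
  · rw [key]
    refine Finset.sum_congr rfl fun π _ => Finset.sum_congr rfl fun σ _ => ?_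
    rw [sum_filter_blk_inr]
    have h1 : ∏ q' ∈ Finset.univ.erase (Sum.inr b), facW c R w b q' π σ =
        ∏ q' ∈ Finset.univ.erase (Sum.inr b), fac c R q' π σ :=
      Finset.prod_congr rfl fun q hq => by rw [facW, if_neg (Finset.ne_of_mem_erase hq)]
    rw [h1]
    simp [facW]
  · rintro (a | b') hq π
    -- Coframe factor: exchanging its lower index with the differentiation index antisymmetrises the
    -- covariant derivative, which is torsion and vanishes. The factor b does not see position (b,
    -- false), so it is unaffected.
    · refine sum_sgn_mul_eq_zero (ι := Bool) e
        (fun s => if s then Equiv.swap (.inr (b, false)) (.inl a) else 1) _ _ ?_ ?_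
      · intro σ
        rw [Fintype.sum_bool]
        simp only [if_true, Bool.false_eq_true, if_false, Equiv.Perm.sign_one,
          Equiv.Perm.sign_swap (show (Sum.inr (b, false) : Pos k r) ≠ .inl a by simp),
          sum_filter_blk_inl, facW, if_neg hq, fac, Function.update_self, Equiv.trans_apply,
          Equiv.swap_apply_left, Equiv.swap_apply_right, Equiv.Perm.coe_one, id]
        rw [hT]
        simp
      · intro s σ
        refine Finset.prod_congr rfl fun q' hq' => ?_
        cases s
        · rfl
        have hne := Finset.ne_of_mem_erase hq'
        rcases q' with a' | b''
        · have : a' ≠ a := fun h => hne (by rw [h])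
          simp [facW, fac, Equiv.swap_apply_def, this]
        · by_cases hb : b'' = b
          · subst hb; simp [facW, Equiv.swap_apply_def]
          · simp [facW, fac, Equiv.swap_apply_def, hb]
    · have hbb : b' ≠ b := fun h => hq (by rw [h])
      set x : Pos k r := .inr (b, false) with hx
      set y : Pos k r := .inr (b', false) with hy
      set z : Pos k r := .inr (b', true) with hz
      have hxy : x ≠ y := by simp [hx, hy, hbb.symm]
      have hxz : x ≠ z := by simp [hx, hz]
      have hyz : y ≠ z := by simp [hy, hz]
      -- Another curvature factor: the three cyclic permutations of the differentiation index and
      -- the two form indices are even, and their sum is the Bianchi identity.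
      refine sum_sgn_mul_eq_zero (ι := Fin 3) e
        ![1, Equiv.swap x y * Equiv.swap y z, Equiv.swap y z * Equiv.swap x y] _ _ ?_ ?_
      · intro σ
        rw [Fin.sum_univ_three]
        simp only [Matrix.cons_val_zero, Matrix.cons_val_one, Matrix.cons_val, Equiv.Perm.sign_one,
          Equiv.Perm.sign_mul, Equiv.Perm.sign_swap hxy, Equiv.Perm.sign_swap hyz,
          sum_filter_blk_inr, facW, if_neg hq, fac, Equiv.trans_apply, Equiv.Perm.coe_mul,
          Function.comp_apply, ← hx, ← hy, ← hz, Function.update_self,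
          Function.update_of_ne hyz, Function.update_of_ne hyz.symm, Equiv.Perm.coe_one, id,
          Equiv.swap_apply_left, Equiv.swap_apply_right, Equiv.swap_apply_of_ne_of_ne hxy hxz,
          Equiv.swap_apply_of_ne_of_ne hxz.symm hyz.symm, ← hDR]
        have := hB (π y) (π z) (σ x) (σ y) (σ z)
        simp
        linarith
      · intro s σ
        refine Finset.prod_congr rfl fun q' hq' => ?_
        have hne := Finset.ne_of_mem_erase hq'
        have h0 : ∀ τ : Equiv.Perm (Pos k r), (∀ p, p ≠ x → p ≠ y → p ≠ z → τ p = p) →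
            facW c R w b q' π (τ.trans σ) = facW c R w b q' π σ := by
          intro τ hτ
          rcases q' with a' | b''
          · simp only [facW, fac, Equiv.trans_apply]
            rw [hτ (.inl a')] <;> simp [hx, hy, hz]
          · by_cases hb : b'' = b
            · subst hb
              simp only [facW, if_true, Equiv.trans_apply]
              rw [hτ] <;> simp [hx, hy, hz, hbb.symm]
            · have hb2 : b'' ≠ b' := fun h => hne (by rw [h])
              simp only [facW, fac, Sum.inr.injEq, hb, if_false, Equiv.trans_apply]
              rw [hτ, hτ] <;> simp [hx, hy, hz, hb, hb2]
        refine h0 _ fun p h1 h2 h3 => ?_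
        fin_cases s
        · rfl
        · simp [Equiv.swap_apply_of_ne_of_ne h2 h3, Equiv.swap_apply_of_ne_of_ne h1 h2]
        · simp [Equiv.swap_apply_of_ne_of_ne h2 h3, Equiv.swap_apply_of_ne_of_ne h1 h2]

/-- Antisymmetrising the covariant derivative of a one-form. -/
theorem altSumWith_antisymm (e : Pos k r ≃ V) (c : V → V → ℝ) (R : V → V → V → V → ℝ)
    (b : Fin r) (Y : V → V → V → V → ℝ) :
    (altSumWith e c R (.inr b) fun π σ =>
      Y (σ (.inr (b, false))) (π (.inr (b, false))) (π (.inr (b, true))) (σ (.inr (b, true))) -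
      Y (σ (.inr (b, true))) (π (.inr (b, false))) (π (.inr (b, true))) (σ (.inr (b, false)))) =
    2 * altSumWith e c R (.inr b) fun π σ =>
      Y (σ (.inr (b, false))) (π (.inr (b, false))) (π (.inr (b, true))) (σ (.inr (b, true))) := by
  have hne : (Sum.inr (b, false) : Pos k r) ≠ .inr (b, true) := by simp
  have h1 : (altSumWith e c R (.inr b) fun π σ =>
      Y (σ (.inr (b, true))) (π (.inr (b, false))) (π (.inr (b, true))) (σ (.inr (b, false)))) =
      -altSumWith e c R (.inr b) fun π σ =>
      Y (σ (.inr (b, false))) (π (.inr (b, false))) (π (.inr (b, true))) (σ (.inr (b, true))) := by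
    simp only [altSumWith]
    rw [← Finset.sum_neg_distrib]
    refine Finset.sum_congr rfl fun π _ => ?_
    simp only [mul_assoc (sgn e π), ← Finset.mul_sum]
    rw [← mul_neg]
    congr 1
    -- Exchanging the two lower indices of block b changes only the sign, because no other factor
    -- uses these positions.
    rw [sum_sgn_trans e (Equiv.swap (.inr (b, false)) (.inr (b, true))), Equiv.Perm.sign_swap hne]
    simp only [Units.val_neg, Units.val_one, Int.cast_neg, Int.cast_one, neg_mul, one_mul]
    congr 1
    refine Finset.sum_congr rfl fun σ _ => ?_
    congr 2
    · simp
    · refine Finset.prod_congr rfl fun q' hq' => ?_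
      have hne' := Finset.ne_of_mem_erase hq'
      rcases q' with a' | b''
      · simp [fac, Equiv.swap_apply_def]
      · have : b'' ≠ b := fun h => hne' (by rw [h])
        simp [fac, Equiv.swap_apply_def, this]
  rw [two_mul]
  nth_rewrite 3 [← neg_neg (altSumWith e c R (.inr b) _)]
  rw [← h1]
  simp only [altSumWith, sub_mul, mul_sub, Finset.sum_sub_distrib]
  ring

end LagrangianSum

/-! ### Invariance of the alternating sum and its derivative. -/

section LagrangianSumSlots

variable {V : Type*} [Fintype V] [DecidableEq V] {k r : ℕ}

theorem altSumWith_add (e : Pos k r ≃ V) (c : V → V → ℝ) (R : V → V → V → V → ℝ)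
    (q : Fin k ⊕ Fin r) (X Y : (Pos k r → V) → (Pos k r → V) → ℝ) :
    altSumWith e c R q (fun f h => X f h + Y f h) = altSumWith e c R q X + altSumWith e c R q Y := by
  simp only [altSumWith, add_mul, mul_add, Finset.sum_add_distrib]

theorem altSumWith_const_mul (e : Pos k r ≃ V) (c : V → V → ℝ) (R : V → V → V → V → ℝ)
    (q : Fin k ⊕ Fin r) (a : ℝ) (X : (Pos k r → V) → (Pos k r → V) → ℝ) :
    altSumWith e c R q (fun f h => a * X f h) = a * altSumWith e c R q X := by
  simp only [altSumWith, Finset.mul_sum]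
  exact Finset.sum_congr rfl fun _ _ => Finset.sum_congr rfl fun _ _ => by ring

/-- Invariance of the Lagrangian under the slotwise action of a matrix, up to the trace. -/
theorem altSum_slot (e : Pos k r ≃ V) (c : V → V → ℝ) (R : V → V → V → V → ℝ) (A : V → V → ℝ) :
    (∑ a, altSumWith e c R (.inl a) fun π σ => ∑ l, A (π (.inl a)) l * c l (σ (.inl a))) +
      ∑ b, ((altSumWith e c R (.inr b) fun π σ => ∑ l, A (π (.inr (b, false))) l *
          R l (π (.inr (b, true))) (σ (.inr (b, false))) (σ (.inr (b, true)))) +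
        altSumWith e c R (.inr b) fun π σ => ∑ l, A (π (.inr (b, true))) l *
          R (π (.inr (b, false))) l (σ (.inr (b, false))) (σ (.inr (b, true)))) =
      (∑ i, A i i) * altSum e c R := by
  have h1 : ∀ q, (altSumWith e c R q fun π σ =>
      ∑ p with blk p = q, ∑ l, A (π p) l * fac c R q (Function.update π p l) σ) =
      ∑ σ : Pos k r ≃ V, ∑ π : Pos k r ≃ V, sgn e σ * (sgn e π *
        ((∑ p with blk p = q, ∑ l, A (π p) l * fac c R q (Function.update π p l) σ) *
          ∏ q' ∈ Finset.univ.erase q, fac c R q' π σ)) := by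
    intro q
    simp only [altSumWith]
    rw [Finset.sum_comm]
    exact Finset.sum_congr rfl fun σ _ => Finset.sum_congr rfl fun π _ => by ring
  have h2 : (∑ i, A i i) * altSum e c R = ∑ q, altSumWith e c R q fun π σ =>
      ∑ p with blk p = q, ∑ l, A (π p) l * fac c R q (Function.update π p l) σ := by
    simp only [h1]
    rw [Finset.sum_comm, altSum, Finset.sum_comm, Finset.mul_sum]
    refine Finset.sum_congr rfl fun σ _ => ?_
    have h := sum_sgn_slot e A fun f => ∏ q, fac c R q f σ
    rw [Finset.sum_congr rfl fun π _ => by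
      rw [sum_slot_prod blk (fun q f => fac c R q f σ)
        (fun q f p l hp => fac_update c R q f σ p l hp)]] at h
    rw [Finset.sum_comm]
    calc _ = sgn e σ * ((∑ i, A i i) * ∑ π : Pos k r ≃ V, sgn e π * ∏ q, fac c R q π σ) := by
          simp only [Finset.mul_sum]
          exact Finset.sum_congr rfl fun π _ => by ring
      _ = _ := by
          rw [← h, Finset.mul_sum]
          exact Finset.sum_congr rfl fun π _ => by rw [Finset.mul_sum, Finset.mul_sum]
  rw [h2, Fintype.sum_sum_type]
  simp only [sum_filter_blk_inl, sum_filter_blk_inr, ← altSumWith_add]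
  congr 1 <;> exact Finset.sum_congr rfl fun _ _ => by simp [fac]

/-- Exchanging the two frame indices of block b gives one sign from the permutation and one from the
antisymmetry of R; they cancel, so both slots contribute equally. -/
theorem altSum_slot_swap (e : Pos k r ≃ V) (c : V → V → ℝ) (R : V → V → V → V → ℝ)
    (hR : ∀ i j μ ν, R i j μ ν = -R j i μ ν) (A : V → V → ℝ) (b : Fin r) :
    (altSumWith e c R (.inr b) fun π σ => ∑ l, A (π (.inr (b, false))) l *
          R l (π (.inr (b, true))) (σ (.inr (b, false))) (σ (.inr (b, true)))) =
      altSumWith e c R (.inr b) fun π σ => ∑ l, A (π (.inr (b, true))) l *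
          R (π (.inr (b, false))) l (σ (.inr (b, false))) (σ (.inr (b, true))) := by
  have hne : (Sum.inr (b, false) : Pos k r) ≠ .inr (b, true) := by simp
  simp only [altSumWith]
  rw [Finset.sum_comm]
  conv_rhs => rw [Finset.sum_comm]
  refine Finset.sum_congr rfl fun σ _ => ?_
  simp only [mul_assoc]
  rw [sum_sgn_trans e (Equiv.swap (.inr (b, false)) (.inr (b, true))), Equiv.Perm.sign_swap hne]
  rw [Finset.mul_sum]
  refine Finset.sum_congr rfl fun π _ => ?_
  have h1 : ∏ q' ∈ Finset.univ.erase (Sum.inr b),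
      fac c R q' ((Equiv.swap (Sum.inr (b, false)) (Sum.inr (b, true))).trans π) σ =
      ∏ q' ∈ Finset.univ.erase (Sum.inr b), fac c R q' π σ := by
    refine Finset.prod_congr rfl fun q' hq' => ?_
    have hne' := Finset.ne_of_mem_erase hq'
    rcases q' with a' | b''
    · simp [fac, Equiv.swap_apply_def]
    · have : b'' ≠ b := fun h => hne' (by rw [h])
      simp [fac, Equiv.swap_apply_def, this]
  rw [h1]
  simp only [Equiv.trans_apply, Equiv.swap_apply_left, Equiv.swap_apply_right]
  rw [Finset.sum_congr rfl fun l _ => show A (π (.inr (b, true))) l *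
      R l (π (.inr (b, false))) (σ (.inr (b, false))) (σ (.inr (b, true))) =
      -(A (π (.inr (b, true))) l *
      R (π (.inr (b, false))) l (σ (.inr (b, false))) (σ (.inr (b, true)))) by rw [hR]; ring,
    Finset.sum_neg_distrib]
  push_cast; ring

/-- Both bijections are relabelled at once, so the sign of τ appears squared. -/
theorem sum_sum_sgn_trans {P : Type*} [Fintype P] [DecidableEq P] (e : P ≃ V)
    (τ : Equiv.Perm P) (F : (P ≃ V) → (P ≃ V) → ℝ) :
    ∑ π, ∑ σ, sgn e π * sgn e σ * F π σ =
      ∑ π, ∑ σ, sgn e π * sgn e σ * F (τ.trans π) (τ.trans σ) := by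
  have hs : ((Equiv.Perm.sign τ : ℤ) : ℝ) * ((Equiv.Perm.sign τ : ℤ) : ℝ) = 1 := by
    rcases Int.units_eq_one_or (Equiv.Perm.sign τ) with h | h <;> simp [h]
  simp only [mul_assoc, ← Finset.mul_sum]
  rw [sum_sgn_trans e τ, Finset.mul_sum]
  refine Finset.sum_congr rfl fun π _ => ?_
  rw [sum_sgn_trans e τ, mul_left_comm, ← mul_assoc ((Equiv.Perm.sign τ : ℤ) : ℝ), hs, one_mul]

/-- Exchange of the curvature factors `b` and `b'` as a permutation of the positions. -/
def swapBlocks (b b' : Fin r) : Equiv.Perm (Pos k r) :=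
  Equiv.sumCongr (Equiv.refl _) (Equiv.prodCongr (Equiv.swap b b') (Equiv.refl _))

/-- Every curvature block contributes the same amount; this is one source of the factor r in the
field equations, the other factor 2 being the two frame indices of a block. -/
theorem altSumWith_swapBlocks (e : Pos k r ≃ V) (c : V → V → ℝ) (R : V → V → V → V → ℝ)
    (b b' : Fin r) (X : V → V → V → V → ℝ) :
    (altSumWith e c R (.inr b) fun π σ => X (π (.inr (b, false))) (π (.inr (b, true)))
        (σ (.inr (b, false))) (σ (.inr (b, true)))) =
      altSumWith e c R (.inr b') fun π σ => X (π (.inr (b', false))) (π (.inr (b', true)))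
        (σ (.inr (b', false))) (σ (.inr (b', true))) := by
  rw [altSumWith, sum_sum_sgn_trans e (swapBlocks b' b)]
  refine Finset.sum_congr rfl fun π _ => Finset.sum_congr rfl fun σ _ => ?_
  have hb : ∀ s, swapBlocks (k := k) b' b (.inr (b, s)) = .inr (b', s) := fun s => by
    simp [swapBlocks]
  simp only [Equiv.trans_apply, hb]
  congr 2
  refine Finset.prod_equiv (Equiv.sumCongr (Equiv.refl _) (Equiv.swap b' b)) ?_ ?_
  · intro q
    rcases q with a | b''
    · simp [Equiv.swap_apply_def]
    · simp only [Finset.mem_erase, Finset.mem_univ, and_true, Equiv.sumCongr_apply, Sum.map_inr,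
        ne_eq, Sum.inr.injEq]
      rw [Equiv.swap_apply_eq_iff, Equiv.swap_apply_left]
  · rintro (a | b'') _ <;> rfl

theorem fderiv_prod {Y Q : Type*} [NormedAddCommGroup Y] [NormedSpace ℝ Y] [DecidableEq Q]
    (s : Finset Q) {G : Q → Y → ℝ} {p : Y} (hG : ∀ q ∈ s, DifferentiableAt ℝ (G q) p) (w : Y) :
    fderiv ℝ (fun y => ∏ q ∈ s, G q y) p w =
      ∑ q ∈ s, fderiv ℝ (G q) p w * ∏ q' ∈ s.erase q, G q' p := by
  rw [(HasFDerivAt.finsetProd fun q hq => (hG q hq).hasFDerivAt).fderiv]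
  simp [mul_comm]

theorem differentiableAt_fac {V : Type*} {k r : ℕ} {Y : Type*} [NormedAddCommGroup Y] [NormedSpace ℝ Y]
    {c : Y → V → V → ℝ} {R : Y → V → V → V → V → ℝ} {p : Y}
    (hc : ∀ i j, DifferentiableAt ℝ (fun y => c y i j) p)
    (hR : ∀ i j μ ν, DifferentiableAt ℝ (fun y => R y i j μ ν) p) (q : Fin k ⊕ Fin r)
    (f h : Pos k r → V) : DifferentiableAt ℝ (fun y => fac (c y) (R y) q f h) p := by
  rcases q with a | b
  · exact hc _ _
  · exact hR _ _ _ _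

theorem fderiv_fac {V : Type*} {k r : ℕ} {Y : Type*} [NormedAddCommGroup Y] [NormedSpace ℝ Y]
    (c : Y → V → V → ℝ) (R : Y → V → V → V → V → ℝ) (p w : Y) (q : Fin k ⊕ Fin r)
    (f h : Pos k r → V) : fderiv ℝ (fun y => fac (c y) (R y) q f h) p w =
      fac (fun i j => fderiv ℝ (fun y => c y i j) p w)
        (fun i j μ ν => fderiv ℝ (fun y => R y i j μ ν) p w) q f h := by
  rcases q with a | b <;> rfl

theorem fderiv_altSum {Y : Type*} [NormedAddCommGroup Y] [NormedSpace ℝ Y] (e : Pos k r ≃ V)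
    {c : Y → V → V → ℝ} {R : Y → V → V → V → V → ℝ} {p : Y}
    (hc : ∀ i j, DifferentiableAt ℝ (fun y => c y i j) p)
    (hR : ∀ i j μ ν, DifferentiableAt ℝ (fun y => R y i j μ ν) p) (w : Y) :
    fderiv ℝ (fun y => altSum e (c y) (R y)) p w =
      ∑ q, altSumWith e (c p) (R p) q (fac (fun i j => fderiv ℝ (fun y => c y i j) p w)
        (fun i j μ ν => fderiv ℝ (fun y => R y i j μ ν) p w) q) := by
  have hf := fun q (f h : Pos k r → V) => differentiableAt_fac hc hR q f h
  have hfp := fun (f h : Pos k r → V) => (HasFDerivAt.finsetProd (u := Finset.univ)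
    fun q _ => (hf q f h).hasFDerivAt).differentiableAt
  have hp : ∀ π σ : Pos k r ≃ V, DifferentiableAt ℝ
      (fun y => sgn e π * sgn e σ * ∏ q, fac (c y) (R y) q π σ) p := fun π σ =>
    (hfp _ _).const_mul _
  simp only [altSum]
  rw [fderiv_fun_sum fun π _ => DifferentiableAt.fun_sum fun σ _ => hp π σ]
  simp only [sum_apply, altSumWith]
  rw [Finset.sum_comm]
  refine Finset.sum_congr rfl fun π _ => ?_
  rw [fderiv_fun_sum fun σ _ => hp π σ, sum_apply, Finset.sum_comm]
  refine Finset.sum_congr rfl fun σ _ => ?_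
  rw [fderiv_const_mul (hfp _ _)]
  simp only [smul_apply, smul_eq_mul]
  rw [fderiv_prod _ fun q _ => hf q _ _, Finset.mul_sum]
  exact Finset.sum_congr rfl fun q _ => by rw [fderiv_fac]

end LagrangianSumSlots

/-! ### Bianchi identity, skew connections and the first variation. -/

section Connection

variable {m : ℕ} {Y : Type*} [NormedAddCommGroup Y] [NormedSpace ℝ Y]

/-- The curvature of the connection with matrices `W_μ`, with respect to the directions `d_μ`. -/
noncomputable def curvM (d : Fin m → Y) (W : Fin m → Y → Matrix (Fin m) (Fin m) ℝ) (μ ν : Fin m)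
    (y : Y) : Matrix (Fin m) (Fin m) ℝ :=
  dMat (d μ) (W ν) y - dMat (d ν) (W μ) y + (W μ y * W ν y - W ν y * W μ y)

/-- The curvature with the second index raised. -/
noncomputable def curvR (d : Fin m → Y) (W : Fin m → Y → Matrix (Fin m) (Fin m) ℝ) (y : Y)
    (i j μ ν : Fin m) : ℝ := (curvM d W μ ν y * etaM m) i j

variable {O : Set Y} {d : Fin m → Y} {W : Fin m → Y → Matrix (Fin m) (Fin m) ℝ}

theorem smoothMat_curvM (hO : IsOpen O) (hW : ∀ μ, SmoothMat (W μ) O) (μ ν : Fin m) :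
    SmoothMat (curvM d W μ ν) O :=
  (((hW ν).dMat hO (d μ)).sub ((hW μ).dMat hO (d ν))).add
    (((hW μ).mul (hW ν)).sub ((hW ν).mul (hW μ)))

theorem dMat_curvM (hO : IsOpen O) (hW : ∀ μ, SmoothMat (W μ) O) (μ ν : Fin m) {p : Y}
    (hp : p ∈ O) (w : Y) : dMat w (curvM d W μ ν) p =
      dMat w (dMat (d μ) (W ν)) p - dMat w (dMat (d ν) (W μ)) p +
        (dMat w (W μ) p * W ν p + W μ p * dMat w (W ν) p -
          (dMat w (W ν) p * W μ p + W ν p * dMat w (W μ) p)) := by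
  have hd := fun μ => (hW μ).diffMat hO hp
  have hd2 := fun μ ν => ((hW ν).dMat hO (d μ)).diffMat hO hp
  have hm := fun μ ν => (hd μ).mul (hd ν)
  have : curvM d W μ ν = fun y => (dMat (d μ) (W ν) y - dMat (d ν) (W μ) y) +
    (W μ y * W ν y - W ν y * W μ y) := rfl
  rw [this, dMat_add ((hd2 μ ν).sub (hd2 ν μ)) ((hm μ ν).sub (hm ν μ)), dMat_sub (hd2 μ ν) (hd2 ν μ),
    dMat_sub (hm μ ν) (hm ν μ), dMat_mul (hd μ) (hd ν), dMat_mul (hd ν) (hd μ)]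

/-- The Bianchi identity. -/
theorem bianchi (hO : IsOpen O) (hW : ∀ μ, SmoothMat (W μ) O) {p : Y} (hp : p ∈ O)
    (a b c : Fin m) :
    (dMat (d a) (curvM d W b c) p + (W a p * curvM d W b c p - curvM d W b c p * W a p)) +
    (dMat (d b) (curvM d W c a) p + (W b p * curvM d W c a p - curvM d W c a p * W b p)) +
    (dMat (d c) (curvM d W a b) p + (W c p * curvM d W a b p - curvM d W a b p * W c p)) = 0 := by
  simp only [dMat_curvM hO hW _ _ hp, curvM]
  -- Once second derivatives in the constant directions commute, the identity is purely algebraic.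
  rw [dMat_comm hO (hW c) hp (d b) (d a), dMat_comm hO (hW a) hp (d c) (d b),
    dMat_comm hO (hW b) hp (d a) (d c)]
  noncomm_ring

/-- In other words A with its second index raised is an antisymmetric matrix. -/
theorem skew_mul_eta {A : Matrix (Fin m) (Fin m) ℝ}
    (h : etaM m * A + (etaM m * A).transpose = 0) :
    A * etaM m = -(etaM m * A.transpose) := by
  have h1 := congrArg (fun M => etaM m * M * etaM m) h
  simp only [Matrix.transpose_mul, etaM_transpose, mul_add, add_mul, ← mul_assoc, etaM_mul_self,
    one_mul, mul_zero, zero_mul] at h1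
  rw [mul_assoc (etaM m * _), etaM_mul_self, mul_one] at h1
  exact eq_neg_of_add_eq_zero_left h1

/-- A equals minus the η-conjugate of its transpose, so its trace equals its own negative. This
supplies the tracelessness required by the divergence identity. -/
theorem trace_eq_zero_of_skew {A : Matrix (Fin m) (Fin m) ℝ}
    (h : etaM m * A + (etaM m * A).transpose = 0) : ∑ i, A i i = 0 := by
  have h1 : A = -(etaM m * A.transpose * etaM m) := by
    rw [← neg_mul, ← skew_mul_eta h, mul_assoc, etaM_mul_self, mul_one]
  have h2 := congrArg Matrix.trace h1
  rw [Matrix.trace_neg, Matrix.trace_mul_comm, ← mul_assoc, etaM_mul_self, one_mul,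
    Matrix.trace_transpose] at h2
  have h3 : A.trace = 0 := by linarith
  exact h3

theorem fderiv_mul_const_matrix {A : Y → Matrix (Fin m) (Fin m) ℝ} {p : Y} (hA : DiffMat A p)
    (C : Matrix (Fin m) (Fin m) ℝ) (w : Y) (i j : Fin m) :
    fderiv ℝ (fun y => (A y * C) i j) p w = (dMat w A p * C) i j := by
  have := congrFun (congrFun (dMat_mul hA (diffMat_const C p) w) i) j
  rw [dMat_const, mul_zero, add_zero] at this
  exact this

/-- On an object whose second index is raised, the commutator with a skew A becomes A acting on each
of the two upper indices, because η Aᵀ = -A η. The covariant derivative of the curvature thus takes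
the slotwise form used in the alternating sums. -/
theorem sum_mul_raised (A B : Matrix (Fin m) (Fin m) ℝ)
    (h : etaM m * A + (etaM m * A).transpose = 0) (i j : Fin m) :
    ∑ l, A i l * (B * etaM m) l j + ∑ l, A j l * (B * etaM m) i l =
      ((A * B - B * A) * etaM m) i j := by
  have h1 : (A * B - B * A) * etaM m = A * (B * etaM m) + (B * etaM m) * A.transpose := by
    rw [sub_mul, mul_assoc, mul_assoc B, skew_mul_eta h, mul_neg, sub_neg_eq_add, mul_assoc B]
  rw [h1, Matrix.add_apply, Matrix.mul_apply, Matrix.mul_apply]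
  congr 1
  exact Finset.sum_congr rfl fun l _ => mul_comm _ _

/-- The variation of the connection in the direction `w`, with the second index raised. -/
noncomputable def varR (w : Y) (W : Fin m → Y → Matrix (Fin m) (Fin m) ℝ) (y : Y)
    (i j ν : Fin m) : ℝ := (dMat w (W ν) y * etaM m) i j

/-- The product of coframe and curvature factors in which the factor `b` is replaced by the
variation of the connection. -/
noncomputable def flux {k r : ℕ} (d : Fin m → Y) (W : Fin m → Y → Matrix (Fin m) (Fin m) ℝ)
    (c : Y → Matrix (Fin m) (Fin m) ℝ) (w : Y) (b : Fin r) (π σ : Pos k r ≃ Fin m) (y : Y) : ℝ :=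
  ∏ q, facW (fun i j => c y i j) (curvR d W y) (varR w W y) b q π σ

theorem differentiableAt_facW {V : Type*} {k r : ℕ}
    {c : Y → V → V → ℝ} {R : Y → V → V → V → V → ℝ} {w : Y → V → V → V → ℝ} {p : Y}
    (hc : ∀ i j, DifferentiableAt ℝ (fun y => c y i j) p)
    (hR : ∀ i j μ ν, DifferentiableAt ℝ (fun y => R y i j μ ν) p)
    (hw : ∀ i j ν, DifferentiableAt ℝ (fun y => w y i j ν) p) (b : Fin r) (q : Fin k ⊕ Fin r)
    (f h : Pos k r → V) : DifferentiableAt ℝ (fun y => facW (c y) (R y) (w y) b q f h) p := by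
  by_cases hq : q = .inr b
  · simp only [facW, if_pos hq]; exact hw _ _ _
  · simp only [facW, if_neg hq]; exact differentiableAt_fac hc hR q f h

/-- The first variation of the Lagrangian: an algebraic term and a divergence. -/
theorem fderiv_altSum_curvR {k r : ℕ} (e : Pos k r ≃ Fin m) (hO : IsOpen O)
    (hW : ∀ μ, SmoothMat (W μ) O) {c : Y → Matrix (Fin m) (Fin m) ℝ} (hc : SmoothMat c O)
    {p : Y} (hp : p ∈ O)
    (hskew : ∀ μ, etaM m * W μ p + (etaM m * W μ p).transpose = 0)
    (htors : ∀ μ i ν, (dMat (d μ) c p + W μ p * c p) i ν = (dMat (d ν) c p + W ν p * c p) i μ)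
    (w : Y) :
    fderiv ℝ (fun y => altSum e (fun i j => c y i j) (curvR d W y)) p w =
      (∑ a, altSumWith e (fun i j => c p i j) (curvR d W p) (.inl a)
        fun π σ => dMat w c p (π (.inl a)) (σ (.inl a))) +
      2 * ∑ b, ∑ π : Pos k r ≃ Fin m, ∑ σ : Pos k r ≃ Fin m, sgn e π * sgn e σ *
        fderiv ℝ (flux d W c w b π σ) p (d (σ (.inr (b, false)))) := by
  have hcd : ∀ i j, DifferentiableAt ℝ (fun y => c y i j) p := hc.diffMat hO hp
  have hKd := fun μ ν => (smoothMat_curvM (d := d) hO hW μ ν).diffMat hO hp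
  have hVd := fun ν => ((hW ν).dMat hO w).diffMat hO hp
  have hη := diffMat_const (etaM m) p
  have hRd : ∀ i j μ ν, DifferentiableAt ℝ (fun y => curvR d W y i j μ ν) p := fun i j μ ν =>
    ((hKd μ ν).mul hη) i j
  have hwd : ∀ i j ν, DifferentiableAt ℝ (fun y => varR w W y i j ν) p := fun i j ν =>
    ((hVd ν).mul hη) i j
  rw [fderiv_altSum e hcd hRd, Fintype.sum_sum_type]
  congr 1
  rw [Finset.mul_sum]
  refine Finset.sum_congr rfl fun b _ => ?_
  have hflux : ∀ π σ : Pos k r ≃ Fin m, fderiv ℝ (flux d W c w b π σ) p (d (σ (.inr (b, false)))) =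
      ∑ q, (if q = .inr b then
          fderiv ℝ (fun y => varR w W y (π (.inr (b, false))) (π (.inr (b, true)))
            (σ (.inr (b, true)))) p (d (σ (.inr (b, false))))
        else fac (fun i j => fderiv ℝ (fun y => c y i j) p (d (σ (.inr (b, false)))))
          (fun i j μ ν => fderiv ℝ (fun y => curvR d W y i j μ ν) p (d (σ (.inr (b, false))))) q π σ) *
        ∏ q' ∈ Finset.univ.erase q,
          facW (fun i j => c p i j) (curvR d W p) (varR w W p) b q' π σ := by
    intro π σ
    have : flux d W c w b π σ =
      fun y => ∏ q, facW (fun i j => c y i j) (curvR d W y) (varR w W y) b q π σ := rfl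
    rw [this, fderiv_prod _ fun q _ => differentiableAt_facW hcd hRd hwd b q π σ]
    refine Finset.sum_congr rfl fun q _ => ?_
    congr 1
    by_cases hq : q = .inr b
    · simp only [facW, if_pos hq]
    · simp only [facW, if_neg hq]
      exact fderiv_fac (fun y i j => c y i j) (curvR d W) p _ q π σ
  simp only [hflux]
  -- Only frame indices receive connection terms; the lower indices refer to fixed commuting
  -- directions, and for them the alternation replaces any correction.
  rw [sum_sgn_divergence_facW e (fun i j => c p i j) (curvR d W p) (varR w W p)
    (fun a i j => fderiv ℝ (fun y => c y i j) p (d a))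
    (fun a i j μ ν => fderiv ℝ (fun y => curvR d W y i j μ ν) p (d a))
    (fun a i j ν => fderiv ℝ (fun y => varR w W y i j ν) p (d a))
    (fun a i l => W a p i l) (fun a => trace_eq_zero_of_skew (hskew a))
    (fun a i b => by
      have := htors a i b
      simpa only [Matrix.add_apply, Matrix.mul_apply, dMat, Matrix.of_apply] using this)
    (fun a i j μ ν => ((dMat (d a) (curvM d W μ ν) p +
      (W a p * curvM d W μ ν p - curvM d W μ ν p * W a p)) * etaM m) i j)
    (fun a i j μ ν => by
      rw [add_mul, Matrix.add_apply, ← sum_mul_raised _ _ (hskew a)]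
      congr 1
      exact (fderiv_mul_const_matrix (hKd μ ν) _ _ i j).symm)
    (fun i j a b c => by
      rw [← Matrix.add_apply, ← Matrix.add_apply, ← add_mul, ← add_mul, bianchi hO hW hp, zero_mul,
        Matrix.zero_apply]) b,
    ← altSumWith_antisymm e (fun i j => c p i j) (curvR d W p) b fun a i j ν =>
      fderiv ℝ (fun y => varR w W y i j ν) p (d a) +
        (∑ l, W a p i l * varR w W p l j ν + ∑ l, W a p j l * varR w W p i l ν)]
  congr 1
  -- This is the identity δΩ_{μν} = D_μ δω_ν - D_ν δω_μ; antisymmetrising its right side is what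
  -- produced the factor 2.
  funext π σ
  simp only [fac, varR, curvR]
  rw [fderiv_mul_const_matrix (hKd _ _), dMat_curvM hO hW _ _ hp, sum_mul_raised _ _ (hskew _),
    sum_mul_raised _ _ (hskew _), fderiv_mul_const_matrix (hVd _), fderiv_mul_const_matrix (hVd _),
    ← Matrix.add_apply, ← Matrix.add_apply, ← Matrix.sub_apply, ← add_mul, ← add_mul, ← sub_mul,
    dMat_comm hO (hW _) hp w, dMat_comm hO (hW _) hp w]
  refine congrFun (congrFun (congrArg (· * etaM m) ?_) _) _
  abel

end Connection

/-! ### Wedge products as normalised antisymmetrisations. -/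

section Evaluation

variable {X : Type*} [NormedAddCommGroup X] [NormedSpace ℝ X]

/-- `α` is `a` times the antisymmetrisation of `F`. -/
def IsAlternatization {k : ℕ} (α : X [⋀^Fin k]→L[ℝ] ℝ) (a : ℝ) (F : (Fin k → X) → ℝ) : Prop :=
  ∀ v, α v = a * ∑ τ : Equiv.Perm (Fin k), ((Equiv.Perm.sign τ : ℤ) : ℝ) * F (fun i => v (τ i))

theorem isAlternatization_self {k : ℕ} (α : X [⋀^Fin k]→L[ℝ] ℝ) :
    IsAlternatization α (k.factorial : ℝ)⁻¹ α := by
  intro v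
  have : ∀ τ : Equiv.Perm (Fin k), ((Equiv.Perm.sign τ : ℤ) : ℝ) * α (fun i => v (τ i)) = α v := by
    intro τ
    have h := α.toAlternatingMap.map_perm v τ
    have h' : α (fun i => v (τ i)) = Equiv.Perm.sign τ • α v := h
    rw [h', Units.smul_def, zsmul_eq_mul, ← mul_assoc]
    rcases Int.units_eq_one_or (Equiv.Perm.sign τ) with h | h <;> simp [h]
  simp only [this, Finset.sum_const, Finset.card_univ, Fintype.card_perm, Fintype.card_fin,
    nsmul_eq_mul]
  rw [← mul_assoc, inv_mul_cancel₀ (by positivity), one_mul]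

/-- The permutations internal to each factor are absorbed in the shuffle sum. All k! l! of them give
the same value, which cancels the normalisation of the wedge; only the constants a and b remain. -/
theorem IsAlternatization.wedge {k l : ℕ} {α : X [⋀^Fin k]→L[ℝ] ℝ} {β : X [⋀^Fin l]→L[ℝ] ℝ}
    {a b : ℝ} {F : (Fin k → X) → ℝ} {H : (Fin l → X) → ℝ}
    (hα : IsAlternatization α a F) (hβ : IsAlternatization β b H) :
    IsAlternatization (wedge α β) (a * b)
      fun v => F (fun i => v (Fin.castAdd l i)) * H (fun j => v (Fin.natAdd k j)) := by
  intro v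
  rw [wedge_apply]
  set S := ∑ σ : Equiv.Perm (Fin (k + l)), ((Equiv.Perm.sign σ : ℤ) : ℝ) *
    (F (fun i => v (σ (Fin.castAdd l i))) * H (fun j => v (σ (Fin.natAdd k j)))) with hS
  have h1 : ∀ (τ : Equiv.Perm (Fin k)) (τ' : Equiv.Perm (Fin l)),
      ∑ σ : Equiv.Perm (Fin (k + l)), ((Equiv.Perm.sign σ : ℤ) : ℝ) *
      (((Equiv.Perm.sign τ : ℤ) : ℝ) * ((Equiv.Perm.sign τ' : ℤ) : ℝ) *
      (F (fun i => v (σ (Fin.castAdd l (τ i)))) * H (fun j => v (σ (Fin.natAdd k (τ' j)))))) = S := by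
    intro τ τ'
    -- The block permutation acting by τ on the first k positions and by τ' on the last l; its sign
    -- is the product of their signs.
    set ρ : Equiv.Perm (Fin (k + l)) := finSumFinEquiv.permCongr (Equiv.Perm.sumCongr τ τ') with hρ
    have hl : ∀ i, ρ (Fin.castAdd l i) = Fin.castAdd l (τ i) := fun i => by
      simp [hρ, Equiv.permCongr_apply]
    have hr : ∀ j, ρ (Fin.natAdd k j) = Fin.natAdd k (τ' j) := fun j => by
      simp [hρ, Equiv.permCongr_apply]
    have hs : ((Equiv.Perm.sign ρ : ℤ) : ℝ) =
        ((Equiv.Perm.sign τ : ℤ) : ℝ) * ((Equiv.Perm.sign τ' : ℤ) : ℝ) := by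
      rw [hρ, Equiv.Perm.sign_permCongr, Equiv.Perm.sign_sumCongr]; push_cast; rfl
    rw [hS]
    conv_rhs => rw [← Equiv.sum_comp (Equiv.mulRight ρ)]
    refine Finset.sum_congr rfl fun σ _ => ?_
    simp only [Equiv.coe_mulRight, Equiv.Perm.sign_mul, Units.val_mul, Int.cast_mul, hs,
      Equiv.Perm.coe_mul, Function.comp_apply, hl, hr]
    ring
  have h2 : ∑ σ : Equiv.Perm (Fin (k + l)), ((Equiv.Perm.sign σ : ℤ) : ℝ) *
      (α (fun i => v (σ (Fin.castAdd l i))) * β (fun j => v (σ (Fin.natAdd k j)))) =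
      a * b * ∑ τ : Equiv.Perm (Fin k), ∑ τ' : Equiv.Perm (Fin l), S := by
    rw [Finset.sum_congr rfl fun τ _ => Finset.sum_congr rfl fun τ' _ => (h1 τ τ').symm]
    rw [Finset.sum_congr rfl fun τ _ => Finset.sum_comm, Finset.sum_comm, Finset.mul_sum]
    refine Finset.sum_congr rfl fun σ _ => ?_
    rw [hα, hβ]
    simp only [Finset.mul_sum, Finset.sum_mul]
    rw [Finset.sum_comm]
    exact Finset.sum_congr rfl fun τ _ => Finset.sum_congr rfl fun τ' _ => by ring
  rw [h2]
  simp only [Finset.sum_const, Finset.card_univ, Fintype.card_perm, Fintype.card_fin, nsmul_eq_mul]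
  have hk : (k.factorial : ℝ) ≠ 0 := by positivity
  have hl : (l.factorial : ℝ) ≠ 0 := by positivity
  field_simp

theorem isAlternatization_wedgeOnes {q : ℕ} (α : Fin q → DForm X 1) (p : X) :
    IsAlternatization (wedgeOnes α p) 1 fun v => ∏ a, α a p fun _ => v a := by
  induction q with
  | zero => intro v; simp [wedgeOnes]
  | succ q ih =>
    have h := (ih fun a => α (Fin.castSucc a)).wedge (isAlternatization_self (α (Fin.last q) p))
    have e1 : (1 : ℝ) * ((1 : ℕ).factorial : ℝ)⁻¹ = 1 := by simp
    rw [e1] at h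
    intro v
    refine (h v).trans ?_
    simp only [Fin.prod_univ_castSucc]
    refine congrArg _ (Finset.sum_congr rfl fun τ _ => ?_)
    congr 2
    refine congrArg _ (funext fun j => ?_)
    rw [Subsingleton.elim j 0]; rfl

/-- The position of the `s`-th argument of the `b`-th factor in a product of two-forms. -/
def pairIdx {n : ℕ} (b : Fin n) (s : Fin 2) : Fin (2 * n) := ⟨2 * b + s, by omega⟩

/-- Each two-form contributes 1/2!, since its value on a pair already includes both orders. -/
theorem isAlternatization_wedgeTwos {q : ℕ} (α : Fin q → DForm X 2) (p : X) :
    IsAlternatization (wedgeTwos α p) ((1 / 2) ^ q) fun v => ∏ b, α b p fun s => v (pairIdx b s) := by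
  induction q with
  | zero => intro v; simp [wedgeTwos]
  | succ q ih =>
    have h := (ih fun a => α (Fin.castSucc a)).wedge (isAlternatization_self (α (Fin.last q) p))
    have e1 : (1 / 2 : ℝ) ^ q * ((2 : ℕ).factorial : ℝ)⁻¹ = (1 / 2) ^ (q + 1) := by
      rw [pow_succ]; norm_num
    rw [e1] at h
    intro v
    refine (h v).trans ?_
    simp only [Fin.prod_univ_castSucc]
    rfl

theorem wedge_smul_left {k l : ℕ} (a : ℝ) (α : X [⋀^Fin k]→L[ℝ] ℝ) (β : X [⋀^Fin l]→L[ℝ] ℝ) :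
    wedge (a • α) β = a • wedge α β := by
  simp only [← wedgeL_apply, map_smul, _root_.smul_apply]

theorem wedge_sum_left {k l : ℕ} {ι : Type*} (s : Finset ι) (α : ι → X [⋀^Fin k]→L[ℝ] ℝ)
    (β : X [⋀^Fin l]→L[ℝ] ℝ) : wedge (∑ i ∈ s, α i) β = ∑ i ∈ s, wedge (α i) β := by
  simp only [← wedgeL_apply, map_sum, sum_apply]

end Evaluation

/-! ### Orderings of positions and sums against the Levi-Civita symbol. -/

section LagrangianEvaluation

variable {m : ℕ}

/-- The order of the argument positions in `θ_{IJ} ∧ Ω^{IJ}`. -/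
def lowerEquiv (k r : ℕ) : Pos k r ≃ Fin (k + 2 * r) :=
  (Equiv.sumCongr (Equiv.refl (Fin k))
    (((Equiv.prodCongr (Equiv.refl (Fin r)) finTwoEquiv.symm).trans finProdFinEquiv).trans
      (finCongr (mul_comm r 2)))).trans finSumFinEquiv

theorem lowerEquiv_inl {k r : ℕ} (a : Fin k) :
    lowerEquiv k r (.inl a) = Fin.castAdd (2 * r) a := by
  simp [lowerEquiv]

theorem lowerEquiv_inr {k r : ℕ} (b : Fin r) (s : Bool) :
    lowerEquiv k r (.inr (b, s)) = Fin.natAdd k (pairIdx b (finTwoEquiv.symm s)) := by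
  ext
  simp [lowerEquiv, pairIdx]
  cases s <;> simp [finTwoEquiv, add_comm]

/-- The order of the frame indices in `ε_{I J K}`. -/
def upperEquiv (k r : ℕ) : Pos k r ≃ Fin (r + r + k) :=
  (Equiv.sumComm _ _).trans ((Equiv.sumCongr (((Equiv.prodComm _ _).trans
    (Equiv.boolProdEquivSum _)).trans finSumFinEquiv) (Equiv.refl (Fin k))).trans finSumFinEquiv)

theorem upperEquiv_inl {k r : ℕ} (a : Fin k) : upperEquiv k r (.inl a) = Fin.natAdd (r + r) a := by
  simp [upperEquiv]

theorem upperEquiv_false {k r : ℕ} (b : Fin r) :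
    upperEquiv k r (.inr (b, false)) = Fin.castAdd k (Fin.castAdd r b) := by
  simp [upperEquiv, Equiv.boolProdEquivSum]

theorem upperEquiv_true {k r : ℕ} (b : Fin r) :
    upperEquiv k r (.inr (b, true)) = Fin.castAdd k (Fin.natAdd r b) := by
  simp [upperEquiv, Equiv.boolProdEquivSum]

theorem sum_perm_eq_sum_sgn {P V : Type*} [Fintype P] [DecidableEq P] [Fintype V] [DecidableEq V]
    {N : ℕ} (e : P ≃ Fin N) (h : Fin N ≃ V) (G : (P → V) → ℝ) :
    ∑ σ : Equiv.Perm (Fin N), ((Equiv.Perm.sign σ : ℤ) : ℝ) * G (fun p => h (σ (e p))) =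
      ∑ ρ : P ≃ V, sgn (e.trans h) ρ * G ρ := by
  rw [← Equiv.sum_comp (Equiv.equivCongr e.symm h)]
  refine Finset.sum_congr rfl fun σ _ => ?_
  congr 1
  rw [sgn]
  congr 2
  rw [show (e.trans h).symm.trans (Equiv.equivCongr e.symm h σ) = (h.symm.trans σ).trans h by
    ext x; simp [Equiv.equivCongr], Equiv.Perm.sign_symm_trans_trans]

theorem sgn_mul (P V : Type*) [Fintype P] [DecidableEq P] [Fintype V] [DecidableEq V]
    (e e' π : P ≃ V) : sgn e' π = sgn e' e * sgn e π := by
  rw [sgn, sgn, sgn, show (e'.symm.trans π : Equiv.Perm V) = (e.symm.trans π : Equiv.Perm V) *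
    (e'.symm.trans e) by ext x; simp, Equiv.Perm.sign_mul]
  push_cast; ring

theorem sgn_ne_zero {P V : Type*} [Fintype V] [DecidableEq V] (e π : P ≃ V) : sgn e π ≠ 0 := by
  rw [sgn]
  rcases Int.units_eq_one_or (Equiv.Perm.sign (e.symm.trans π)) with h | h <;> simp [h]

/-- The symbol is supported on strings without repetition, and each permutation accounts for exactly
one of them. -/
theorem sum_leviCivita {N : ℕ} (h : N = m) (G : (Fin N → Fin m) → ℝ) :
    ∑ f : Fin N → Fin m, leviCivita f * G f =
      ∑ τ : Equiv.Perm (Fin m), ((Equiv.Perm.sign τ : ℤ) : ℝ) * G fun a => τ (Fin.cast h a) := by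
  simp only [leviCivita, dif_pos h, Finset.sum_mul]
  rw [Finset.sum_comm]
  refine Finset.sum_congr rfl fun τ _ => ?_
  rw [Finset.sum_eq_single fun a => τ (Fin.cast h a)]
  · simp
  · intro f _ hf
    rw [if_neg, zero_mul]
    exact fun h' => hf (funext h')
  · simp

theorem sum_append {V : Type*} [Fintype V] {a b : ℕ} (H : (Fin (a + b) → V) → ℝ) :
    ∑ f, H f = ∑ I : Fin a → V, ∑ J : Fin b → V, H (Fin.append I J) := by
  rw [← Fintype.sum_prod_type' fun I J => H (Fin.append I J)]
  exact (Equiv.sum_comp (Fin.appendEquiv a b) H).symm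

/-- The sum over all frame indices, weighted by the Levi-Civita symbol, as a sum over bijections
of the positions with the indices. -/
theorem sum_leviCivita_append {k r : ℕ} (h : r + r + k = m) (e : Pos k r ≃ Fin m)
    (G : (Pos k r → Fin m) → ℝ) :
    ∑ I : Fin r → Fin m, ∑ J : Fin r → Fin m, ∑ s : Fin k → Fin m,
      leviCivita (Fin.append (Fin.append I J) s) *
        G (Fin.append (Fin.append I J) s ∘ upperEquiv k r) =
      sgn ((upperEquiv k r).trans (finCongr h)) e * ∑ π : Pos k r ≃ Fin m, sgn e π * G π := by
  have h1 := sum_append fun f : Fin (r + r + k) → Fin m => leviCivita f * G (f ∘ upperEquiv k r)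
  rw [sum_append (fun IJ => ∑ s : Fin k → Fin m, leviCivita (Fin.append IJ s) *
    G (Fin.append IJ s ∘ upperEquiv k r))] at h1
  rw [← h1, sum_leviCivita h, Finset.mul_sum]
  rw [← Equiv.sum_comp (Equiv.equivCongr ((upperEquiv k r).trans (finCongr h)).symm (Equiv.refl _))]
  refine Finset.sum_congr rfl fun τ _ => ?_
  have hp : ((upperEquiv k r).trans (finCongr h)).symm.trans
      (Equiv.equivCongr ((upperEquiv k r).trans (finCongr h)).symm (Equiv.refl _) τ) = τ := by
    ext x; simp [Equiv.equivCongr]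
  rw [← mul_assoc, ← sgn_mul, sgn, hp]
  rfl

end LagrangianEvaluation

/-! ### The Lagrangian in components. -/

section LagrangianEvaluation

variable {m : ℕ}

/-- The components of `θ^k` on the vectors `U`. -/
noncomputable def thetaC (p : Coord m) (U : Fin m → Coord m) (k ν : Fin m) : ℝ :=
  theta k p fun _ => U ν

/-- The components of `Ω^i_j` on the vectors `U`. -/
noncomputable def curvC (p : Coord m) (U : Fin m → Coord m) (i j μ ν : Fin m) : ℝ :=
  curv i j p ![U μ, U ν]

/-- The components of `Ω^{ij}` on the vectors `U`. -/
noncomputable def curvUpC (p : Coord m) (U : Fin m → Coord m) (i j μ ν : Fin m) : ℝ :=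
  curvUp i j p ![U μ, U ν]

theorem curvUpC_eq (p : Coord m) (U : Fin m → Coord m) (i j μ ν : Fin m) :
    curvUpC p U i j μ ν = ∑ q, eta j q * curvC p U i q μ ν := by
  simp only [curvUpC, curvUp, Finset.sum_apply, ContinuousAlternatingMap.sum_apply, Pi.smul_apply,
    ContinuousAlternatingMap.smul_apply, smul_eq_mul, curvC]

theorem sparling_wedge_apply {p l : ℕ} (i : Fin p → Fin m) (x : Coord m)
    (β : Coord m [⋀^Fin l]→L[ℝ] ℝ) :
    wedge (sparling (m := m) i x) β = ∑ s : Fin (m - p) → Fin m,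
      (((m - p).factorial : ℝ)⁻¹ * leviCivita (Fin.append i s)) •
        wedge (wedgeOnes (fun a => theta (m := m) (s a)) x) β := by
  simp only [sparling, Pi.smul_apply, Finset.sum_apply, wedge_smul_left, wedge_sum_left,
    Finset.smul_sum, smul_smul]

theorem two_vec {X : Type*} {l : ℕ} (v : Fin l → X) (f : Fin 2 → Fin l) :
    (fun s => v (f s)) = ![v (f 0), v (f 1)] := by
  funext s; fin_cases s <;> rfl

/-- The Levi-Civita symbol makes the frame indices a bijection π, and the wedge makes the arguments
a bijection σ. The constant collects the Sparling factorial, one half for each curvature, and the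
relative sign of the two orderings of positions: ε lists I, J and then the coframe indices, whereas
the arguments list the coframes and then the curvature pairs. -/
theorem lagrangian_apply {r : ℕ} (h : m - (r + r) + 2 * r = m)
    (p : Coord m) (U : Fin m → Coord m) :
    lagrangian m r p (fun a => U (Fin.cast h a)) =
      ((m - (r + r)).factorial : ℝ)⁻¹ * (1 / 2) ^ r *
      sgn ((upperEquiv (m - (r + r)) r).trans (finCongr (by omega : _ = m)))
        ((lowerEquiv (m - (r + r)) r).trans (finCongr h)) *
      altSum ((lowerEquiv (m - (r + r)) r).trans (finCongr h)) (thetaC p U) (curvUpC p U) := by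
  set k := m - (r + r) with hk
  set e : Pos k r ≃ Fin m := (lowerEquiv k r).trans (finCongr h) with he
  have h1 : ∀ (I J : Fin r → Fin m) (s : Fin k → Fin m),
      wedge (wedgeOnes (fun a => theta (s a)) p) (curvProd I J p) (fun a => U (Fin.cast h a)) =
      (1 / 2) ^ r * ∑ ρ : Pos k r ≃ Fin m, sgn e ρ * ∏ q, fac (thetaC p U) (curvUpC p U) q
        (Fin.append (Fin.append I J) s ∘ upperEquiv k r) ρ := by
    intro I J s
    rw [curvProd, (isAlternatization_wedgeOnes (fun a => theta (s a)) p).wedge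
      (isAlternatization_wedgeTwos (fun a => curvUp (I a) (J a)) p), one_mul, he,
      ← sum_perm_eq_sum_sgn (lowerEquiv k r) (finCongr h) fun ρ =>
        ∏ q, fac (thetaC p U) (curvUpC p U) q (Fin.append (Fin.append I J) s ∘ upperEquiv k r) ρ]
    congr 1
    refine Finset.sum_congr rfl fun σ _ => ?_
    congr 1
    rw [Fintype.prod_sum_type]
    refine congrArg₂ (· * ·) (Finset.prod_congr rfl fun a _ => ?_)
      (Finset.prod_congr rfl fun b _ => ?_)
    · simp only [fac, Function.comp_apply, upperEquiv_inl, lowerEquiv_inl, Fin.append_right]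
      rfl
    · simp only [fac, Function.comp_apply, upperEquiv_false, upperEquiv_true, lowerEquiv_inr,
        Fin.append_right, Fin.append_left]
      rw [two_vec (fun a => U (Fin.cast h (σ (Fin.natAdd k a))))]
      rfl
  simp only [lagrangian, Finset.sum_apply, DForm.wedge, sparling_wedge_apply,
    ContinuousAlternatingMap.sum_apply, ContinuousAlternatingMap.smul_apply, smul_eq_mul]
  have h2 := sum_leviCivita_append (by omega : r + r + k = m) e fun f =>
    ∑ ρ : Pos k r ≃ Fin m, sgn e ρ * ∏ q, fac (thetaC p U) (curvUpC p U) q f ρ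
  have h3 : altSum e (thetaC p U) (curvUpC p U) = ∑ π : Pos k r ≃ Fin m, sgn e π *
      ∑ ρ : Pos k r ≃ Fin m, sgn e ρ * ∏ q, fac (thetaC p U) (curvUpC p U) q π ρ := by
    simp only [altSum, Finset.mul_sum, mul_assoc]
  rw [mul_assoc _ (sgn _ _), h3, ← h2]
  simp only [Finset.mul_sum (s := (Finset.univ : Finset (Fin _ → Fin m)))]
  refine Finset.sum_congr rfl fun I _ => Finset.sum_congr rfl fun J _ =>
    Finset.sum_congr rfl fun s _ => ?_
  rw [h1]
  ring

end LagrangianEvaluation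

/-! ### The field-equation form in components. -/

section FieldFormEvaluation

variable {m : ℕ}

theorem sum_cons {V β : Type*} [Fintype V] [AddCommMonoid β] {n : ℕ} (H : (Fin (n + 1) → V) → β) :
    ∑ f, H f = ∑ i : V, ∑ I : Fin n → V, H (Fin.cons i I) := by
  rw [← Fintype.sum_prod_type' fun (i : V) (I : Fin n → V) => H (Fin.cons i I : Fin (n + 1) → V)]
  exact (Equiv.sum_comp (Fin.consEquiv fun _ => V) H).symm

/-- The term with the fixed index i is rewritten as a sum over j₁, so that both terms of the field
form share one summation. -/
theorem sum_coeff_smul {ι V : Type*} [Fintype ι] [DecidableEq ι] [AddCommGroup V] [Module ℝ V]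
    (a : ℝ) (i : ι) (b : ι → ℝ) (T : ι → V) :
    a • T i - ∑ j, b j • T j = ∑ j, ((a * if j = i then 1 else 0) - b j) • T j := by
  simp only [sub_smul, Finset.sum_sub_distrib]
  congr 1
  simp

/-- The separate factor Ω^{i₁}_q occupies the arguments of block 0, so the product has the same
layout as the Lagrangian with the factor `inr 0` removed. -/
theorem wedgeOnes_wedge_wedge_apply {k n : ℕ} (h : k + 2 + 2 * n = m)
    (h' : k + 2 * (n + 1) = m) (p : Coord m) (U : Fin m → Coord m)
    (I J : Fin (n + 1) → Fin m) (s : Fin k → Fin m) (q : Fin m) :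
    wedge (wedge (wedgeOnes (fun a => theta (m := m) (s a)) p) (curv (m := m) (I 0) q p))
      (curvProd (m := m) (fun b => I (Fin.succ b)) (fun b => J (Fin.succ b)) p)
      (fun a => U (Fin.cast h a)) =
    (1 / 2) ^ (n + 1) * ∑ ρ : Pos k (n + 1) ≃ Fin m,
        sgn ((lowerEquiv k (n + 1)).trans (finCongr h')) ρ *
        (curvC p U (I 0) q (ρ (.inr (0, false))) (ρ (.inr (0, true))) *
          ∏ q' ∈ Finset.univ.erase (.inr 0), fac (thetaC p U) (curvUpC p U) q'
            (Fin.append (Fin.append I J) s ∘ upperEquiv k (n + 1)) ρ) := by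
  rw [curvProd, ((isAlternatization_wedgeOnes (fun a => theta (m := m) (s a)) p).wedge
    (isAlternatization_self (curv (m := m) (I 0) q p))).wedge
      (isAlternatization_wedgeTwos (fun a => curvUp (m := m) (I (Fin.succ a)) (J (Fin.succ a))) p)]
  have e1 : (1 : ℝ) * ((2 : ℕ).factorial : ℝ)⁻¹ * (1 / 2) ^ n = (1 / 2) ^ (n + 1) := by
    rw [pow_succ]; norm_num; ring
  rw [e1]
  congr 1
  have hN : k + 2 * (n + 1) = k + 2 + 2 * n := by ring
  set e' : Pos k (n + 1) ≃ Fin (k + 2 + 2 * n) := (lowerEquiv k (n + 1)).trans (finCongr hN) with he'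
  have he : (lowerEquiv k (n + 1)).trans (finCongr h') = e'.trans (finCongr h) := by
    ext x; simp [he']
  have h_inl : ∀ a, e' (.inl a) = Fin.castAdd (2 * n) (Fin.castAdd 2 a) := fun a => by
    ext; simp [he', lowerEquiv_inl]
  have h_zero : ∀ s, e' (.inr (0, s)) = Fin.castAdd (2 * n) (Fin.natAdd k (finTwoEquiv.symm s)) :=
    fun s => by ext; simp [he', lowerEquiv_inr, pairIdx]
  have h_succ : ∀ b s, e' (.inr (Fin.succ b, s)) =
      Fin.natAdd (k + 2) (pairIdx b (finTwoEquiv.symm s)) := fun b s => by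
    ext; simp [he', lowerEquiv_inr, pairIdx]; ring
  rw [he, ← sum_perm_eq_sum_sgn e' (finCongr h) fun ρ =>
        curvC p U (I 0) q (ρ (.inr (0, false))) (ρ (.inr (0, true))) *
          ∏ q' ∈ Finset.univ.erase (.inr 0), fac (thetaC p U) (curvUpC p U) q'
            (Fin.append (Fin.append I J) s ∘ upperEquiv _ (n + 1)) ρ]
  refine Finset.sum_congr rfl fun σ _ => ?_
  congr 1
  have herase : ∀ F : Fin k ⊕ Fin (n + 1) → ℝ, ∏ q' ∈ Finset.univ.erase (.inr 0), F q' =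
      (∏ a, F (.inl a)) * ∏ b : Fin n, F (.inr (Fin.succ b)) := by
    intro F
    have : (Finset.univ.erase (.inr 0) : Finset (Fin k ⊕ Fin (n + 1))) =
        Finset.univ.disjSum (Finset.univ.erase 0) := by
      ext x; rcases x with a | b <;> simp
    rw [this, Finset.prod_disjSum]
    congr 1
    rw [show (Finset.univ.erase 0 : Finset (Fin (n + 1))) = Finset.univ.map (Fin.succEmb n) by
      ext x; refine Fin.cases ?_ (fun j => ?_) x <;> simp [Fin.succ_ne_zero], Finset.prod_map]
    rfl
  rw [herase]
  beta_reduce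
  rw [mul_right_comm, mul_comm]
  refine congrArg₂ (· * ·) ?_ (congrArg₂ (· * ·) (Finset.prod_congr rfl fun a _ => ?_)
      (Finset.prod_congr rfl fun b _ => ?_))
  · rw [two_vec (fun a => U (Fin.cast h (σ (Fin.castAdd (2 * n) (Fin.natAdd k a)))))]
    simp only [h_zero]
    rfl
  · simp only [fac, Function.comp_apply, upperEquiv_inl, h_inl, Fin.append_right]
    rfl
  · simp only [fac, Function.comp_apply, upperEquiv_false, upperEquiv_true, h_succ,
      Fin.append_right, Fin.append_left]
    rw [two_vec (fun a => U (Fin.cast h (σ (Fin.natAdd (k + 2) a))))]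
    rfl

/-- Summing over q raises the second index of the distinguished curvature to k in the first term and
to j₁ in the trace term. The prefactor is the one of the Lagrangian, so the field equation can be
read off from alternating sums. -/
theorem fieldForm_apply {n : ℕ}
    (h : m - (n + 1 - 1 + 1 + (n + 1 - 1 + 1)) + 2 + 2 * (n + 1 - 1) = m)
    (h' : m - (n + 1 + (n + 1)) + 2 * (n + 1) = m) (p : Coord m) (U : Fin m → Coord m)
    (k i : Fin m) :
    fieldForm m (n + 1) k i p (fun a => U (Fin.cast h a)) =
      ((m - (n + 1 + (n + 1))).factorial : ℝ)⁻¹ * (1 / 2) ^ (n + 1) *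
      sgn ((upperEquiv (m - (n + 1 + (n + 1))) (n + 1)).trans (finCongr (by omega : _ = m)))
        ((lowerEquiv (m - (n + 1 + (n + 1))) (n + 1)).trans (finCongr h')) *
      altSumWith ((lowerEquiv (m - (n + 1 + (n + 1))) (n + 1)).trans (finCongr h')) (thetaC p U)
        (curvUpC p U) (.inr 0) fun π σ =>
          (if π (.inr (0, true)) = i then curvUpC p U (π (.inr (0, false))) k (σ (.inr (0, false)))
            (σ (.inr (0, true))) else 0) - 1 / (2 * ((n + 1 : ℕ) : ℝ)) * (if k = i then 1 else 0) *
              curvUpC p U (π (.inr (0, false))) (π (.inr (0, true))) (σ (.inr (0, false)))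
                (σ (.inr (0, true))) := by
  set e := (lowerEquiv (m - (n + 1 + (n + 1))) (n + 1)).trans (finCongr h') with he
  set κ : ℝ := 1 / (2 * ((n + 1 : ℕ) : ℝ)) with hκ
  have hlin : fieldForm m (n + 1) k i p = ∑ i₁ : Fin m, ∑ I' : Fin n → Fin m, ∑ j₁ : Fin m,
      ∑ J' : Fin n → Fin m, ∑ q : Fin m,
      ((eta k q * if j₁ = i then 1 else 0) - κ * eta j₁ q * (if k = i then 1 else 0)) •
      wedge (wedge (sparlingCons (m := m) i₁ I' j₁ J' p) (curv (m := m) i₁ q p))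
        (curvProd (m := m) I' J' p) := by
    simp only [fieldForm, Finset.sum_apply, DForm.wedge, Pi.sub_apply, Pi.smul_apply]
    refine Finset.sum_congr rfl fun i₁ _ => Finset.sum_congr rfl fun I' _ => ?_
    rw [Finset.sum_comm (s := (Finset.univ : Finset (Fin m)))]
    refine Finset.sum_congr rfl fun J' _ => ?_
    rw [Finset.sum_comm (s := (Finset.univ : Finset (Fin m)))]
    refine Finset.sum_congr rfl fun q _ => ?_
    erw [sum_coeff_smul (eta k q) i (fun j₁ => κ * eta j₁ q * (if k = i then 1 else 0))
      fun j₁ => sparlingCons (m := m) i₁ I' j₁ J' p]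
    simp only [wedge_sum_left, wedge_smul_left]
  rw [hlin]
  simp only [ContinuousAlternatingMap.sum_apply, ContinuousAlternatingMap.smul_apply, smul_eq_mul]
  -- The coefficient depends on q only through η, which turns Ω^{i₁}_q into the raised curvature.
  have hq : ∀ i₁ j₁ μ ν : Fin m, ∑ q : Fin m, ((eta k q * if j₁ = i then 1 else 0) -
      κ * eta j₁ q * (if k = i then 1 else 0)) * curvC p U i₁ q μ ν =
      (if j₁ = i then curvUpC p U i₁ k μ ν else 0) -
        κ * (if k = i then 1 else 0) * curvUpC p U i₁ j₁ μ ν := by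
    intro i₁ j₁ μ ν
    simp only [curvUpC_eq, sub_mul, Finset.sum_sub_distrib, Finset.mul_sum]
    congr 1
    · split_ifs <;> simp
    · exact Finset.sum_congr rfl fun q _ => by ring
  set X : (Pos (m - (n + 1 + (n + 1))) (n + 1) → Fin m) → (Pos (m - (n + 1 + (n + 1))) (n + 1) → Fin m) → ℝ := fun π σ =>
    (if π (.inr (0, true)) = i then curvUpC p U (π (.inr (0, false))) k (σ (.inr (0, false)))
      (σ (.inr (0, true))) else 0) - κ * (if k = i then 1 else 0) *
        curvUpC p U (π (.inr (0, false))) (π (.inr (0, true))) (σ (.inr (0, false)))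
          (σ (.inr (0, true))) with hX
  have h2 := sum_leviCivita_append (by omega : n + 1 + (n + 1) + (m - (n + 1 + (n + 1))) = m) e fun f =>
    ∑ ρ : Pos (m - (n + 1 + (n + 1))) (n + 1) ≃ Fin m, sgn e ρ * (X f ρ *
      ∏ q' ∈ Finset.univ.erase (.inr 0), fac (thetaC p U) (curvUpC p U) q' f ρ)
  have h3 : altSumWith e (thetaC p U) (curvUpC p U) (.inr 0) X =
      ∑ π : Pos (m - (n + 1 + (n + 1))) (n + 1) ≃ Fin m, sgn e π * ∑ ρ : Pos (m - (n + 1 + (n + 1))) (n + 1) ≃ Fin m, sgn e ρ * (X π ρ *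
        ∏ q' ∈ Finset.univ.erase (.inr 0), fac (thetaC p U) (curvUpC p U) q' π ρ) := by
    simp only [altSumWith, Finset.mul_sum, mul_assoc]
  have h4 : ∀ I J : Fin (n + 1) → Fin m, ∑ q : Fin m,
      ((eta k q * if J 0 = i then 1 else 0) - κ * eta (J 0) q * (if k = i then 1 else 0)) *
      wedge (wedge (sparling (m := m) (Fin.append I J) p) (curv (m := m) (I 0) q p))
        (curvProd (m := m) (fun b => I (Fin.succ b)) (fun b => J (Fin.succ b)) p)
        (fun a => U (Fin.cast h a)) = ∑ s : Fin (m - (n + 1 + (n + 1))) → Fin m, ((m - (n + 1 + (n + 1))).factorial : ℝ)⁻¹ *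
          (1 / 2) ^ (n + 1) * (leviCivita (Fin.append (Fin.append I J) s) *
          ∑ ρ : Pos (m - (n + 1 + (n + 1))) (n + 1) ≃ Fin m, sgn e ρ *
            (X (Fin.append (Fin.append I J) s ∘ upperEquiv (m - (n + 1 + (n + 1))) (n + 1)) ρ *
            ∏ q' ∈ Finset.univ.erase (.inr 0), fac (thetaC p U) (curvUpC p U) q'
              (Fin.append (Fin.append I J) s ∘ upperEquiv (m - (n + 1 + (n + 1))) (n + 1)) ρ)) := by
    intro I J
    simp only [sparling_wedge_apply, wedge_sum_left, wedge_smul_left,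
      ContinuousAlternatingMap.sum_apply, ContinuousAlternatingMap.smul_apply, smul_eq_mul]
    simp only [Finset.mul_sum (s := (Finset.univ : Finset (Fin _ → Fin m)))]
    rw [Finset.sum_comm]
    refine Finset.sum_congr rfl fun s _ => ?_
    have hXs : ∀ ρ : Pos (m - (n + 1 + (n + 1))) (n + 1) ≃ Fin m,
        X (Fin.append (Fin.append I J) s ∘ upperEquiv (m - (n + 1 + (n + 1))) (n + 1)) ρ = ∑ q : Fin m,
        ((eta k q * if J 0 = i then 1 else 0) - κ * eta (J 0) q * (if k = i then 1 else 0)) *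
          curvC p U (I 0) q (ρ (.inr (0, false))) (ρ (.inr (0, true))) := by
      intro ρ
      rw [hq]
      simp only [hX, Function.comp_apply, upperEquiv_false, upperEquiv_true]
      rw [Fin.append_left, Fin.append_left, Fin.append_left, Fin.append_right]
    simp only [hXs]
    rw [Finset.sum_congr rfl fun q _ => by
      rw [wedgeOnes_wedge_wedge_apply (by omega) h' p U I J s q]]
    simp only [Finset.mul_sum, Finset.sum_mul]
    rw [Finset.sum_comm]
    exact Finset.sum_congr rfl fun ρ _ => Finset.sum_congr rfl fun q _ => by ring
  rw [mul_assoc _ (sgn _ _), h3, ← h2]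
  simp only [Finset.mul_sum (s := (Finset.univ : Finset (Fin _ → Fin m)))]
  have h5 : ∀ I : Fin (n + 1) → Fin m, (∑ J : Fin (n + 1) → Fin m, ∑ s : Fin (m - (n + 1 + (n + 1))) → Fin m, ((m - (n + 1 + (n + 1))).factorial : ℝ)⁻¹ *
          (1 / 2) ^ (n + 1) * (leviCivita (Fin.append (Fin.append I J) s) *
          ∑ ρ : Pos (m - (n + 1 + (n + 1))) (n + 1) ≃ Fin m, sgn e ρ *
            (X (Fin.append (Fin.append I J) s ∘ upperEquiv (m - (n + 1 + (n + 1))) (n + 1)) ρ *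
            ∏ q' ∈ Finset.univ.erase (.inr 0), fac (thetaC p U) (curvUpC p U) q'
              (Fin.append (Fin.append I J) s ∘ upperEquiv (m - (n + 1 + (n + 1))) (n + 1)) ρ))) =
      ∑ j₁ : Fin m, ∑ J' : Fin n → Fin m, ∑ q : Fin m,
      ((eta k q * if j₁ = i then 1 else 0) - κ * eta j₁ q * (if k = i then 1 else 0)) *
      wedge (wedge (sparling (m := m) (Fin.append I (Fin.cons j₁ J')) p) (curv (m := m) (I 0) q p))
        (curvProd (m := m) (fun b => I (Fin.succ b)) J' p)
        (fun a => U (Fin.cast h a)) := by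
    intro I
    rw [Finset.sum_congr rfl fun J _ => (h4 I J).symm]
    rw [sum_cons]
    rfl
  rw [Finset.sum_congr rfl fun I _ => h5 I, sum_cons]
  rfl

end FieldFormEvaluation

/-! ### Components of the canonical forms pulled back along a map. -/

section PullbackComponents

variable {m : ℕ} {Y : Type*} [NormedAddCommGroup Y] [NormedSpace ℝ Y]

theorem wedge_one_one_apply {X : Type*} [NormedAddCommGroup X] [NormedSpace ℝ X]
    (α β : X [⋀^Fin 1]→L[ℝ] ℝ) (a b : X) :
    wedge α β ![a, b] = α ![a] * β ![b] - α ![b] * β ![a] := by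
  have h1 : ∀ x y : X, (fun i : Fin 1 => ![x, y] (Fin.castAdd 1 i)) = ![x] := fun x y => by
    funext i; fin_cases i; rfl
  have h2 : ∀ x y : X, (fun i : Fin 1 => ![x, y] (Fin.natAdd 1 i)) = ![y] := fun x y => by
    funext i; fin_cases i; rfl
  have hu : (Finset.univ : Finset (Equiv.Perm (Fin (1 + 1)))) = {1, Equiv.swap 0 1} := by decide
  have h3 : (fun i : Fin 1 => ![a, b] (Equiv.swap (0 : Fin (1 + 1)) 1 (Fin.castAdd 1 i))) = ![b] := by
    funext i; fin_cases i; rfl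
  have h4 : (fun i : Fin 1 => ![a, b] (Equiv.swap (0 : Fin (1 + 1)) 1 (Fin.natAdd 1 i))) = ![a] := by
    funext i; fin_cases i; rfl
  rw [wedge_apply, hu, Finset.sum_pair (by decide), h3, h4]
  simp only [Equiv.Perm.coe_one, id_eq, h1, h2]
  simp [sub_eq_add_neg]

/-- The connection matrices of the pulled-back connection form in the direction `w`. -/
noncomputable def pullConn (F : Y → Coord m) (w : Y) (y : Y) : Matrix (Fin m) (Fin m) ℝ :=
  connM (fderiv ℝ F y w) (F y)

variable {F : Y → Coord m} {O : Set Y}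

theorem smoothMat_frameM_comp (hF : ContDiffOn ℝ ∞ F O) : SmoothMat (fun y => frameM (F y)) O :=
  fun i j => (de i j).contDiff.comp_contDiffOn hF

theorem smoothMat_gammaM_comp (hF : ContDiffOn ℝ ∞ F O) (σ : Fin m) :
    SmoothMat (fun y => gammaM σ (F y)) O :=
  fun i j => (gammaL i j σ).contDiff.comp_contDiffOn hF

theorem smoothMat_pullConn (hO : IsOpen O) (hF : ContDiffOn ℝ ∞ F O)
    (h0 : ∀ y ∈ O, (frameM (F y)).det ≠ 0) (w : Y) : SmoothMat (pullConn F w) O := by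
  have he := smoothMat_frameM_comp hF
  have hd := contDiffOn_fderiv_apply hO hF w
  refine (he.inv h0).mul (SmoothMat.add (smoothMat_frameM_comp hd) (SmoothMat.sum fun σ =>
    SmoothMat.smul ?_ ((smoothMat_gammaM_comp hF σ).mul he)))
  exact (dx σ).contDiff.comp_contDiffOn hd

theorem frameM_fderiv {y : Y} (hF : DifferentiableAt ℝ F y) (w : Y) :
    frameM (fderiv ℝ F y w) = dMat w (fun y => frameM (F y)) y := by
  ext i j
  rw [frameM_clm]
  have := fderiv_comp y (de i j).differentiableAt hF
  have h2 := congrArg (fun L => L w) this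
  simp only [ContinuousLinearMap.fderiv, ContinuousLinearMap.comp_apply] at h2
  exact h2.symm

theorem pullConn_eq {y : Y} (hF : DifferentiableAt ℝ F y) {w : Y} {μ : Fin m}
    (hw : (fderiv ℝ F y w).1 = EuclideanSpace.single μ 1) :
    pullConn F w y = (frameM (F y))⁻¹ *
      (dMat w (fun y => frameM (F y)) y + gammaM μ (F y) * frameM (F y)) := by
  rw [pullConn, connM, frameM_fderiv hF, hw]
  congr 2
  rw [Finset.sum_eq_single μ]
  · simp
  · intro σ _ hσ; simp [hσ]
  · simp

/-- The exterior derivative commutes with pullback, so the universal curvature becomes the curvature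
of the pulled-back connection. The source Y is arbitrary because the result is needed both for
sections and for their one-parameter deformations on ℝ × ℝᵐ. -/
theorem curvC_fderiv (hO : IsOpen O) (hF : ContDiffOn ℝ ∞ F O)
    (h0 : ∀ y ∈ O, (frameM (F y)).det ≠ 0) (d : Fin m → Y) {y : Y} (hy : y ∈ O)
    (i j μ ν : Fin m) :
    curvC (F y) (fun a => fderiv ℝ F y (d a)) i j μ ν =
      curvM d (fun a => pullConn F (d a)) μ ν y i j := by
  have hFy : ContDiffAt ℝ ∞ F y := hF.contDiffAt (hO.mem_nhds hy)
  have hfr : IsOpen {v : Coord m | v.1 ∈ univ ∧ (frameM v).det ≠ 0} := isOpen_frame univ isOpen_univ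
  have hω : ContDiffOn ℝ ∞ (omega i j) {v : Coord m | v.1 ∈ univ ∧ (frameM v).det ≠ 0} :=
    contDiffOn_omega (fun v hv => hv.2) i j
  have hωy : DifferentiableAt ℝ (omega i j) (F y) :=
    (hω.contDiffAt (hfr.mem_nhds ⟨mem_univ _, h0 y hy⟩)).differentiableAt (by simp)
  have hd : (omega i j).d (F y) ![fderiv ℝ F y (d μ), fderiv ℝ F y (d ν)] =
      (dMat (d μ) (pullConn F (d ν)) y - dMat (d ν) (pullConn F (d μ)) y) i j := by
    have h1 := extDeriv_pullback hωy hFy (by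
      rw [minSmoothness_of_isRCLikeNormedField]
      exact WithTop.coe_le_coe.2 (le_top : (2 : ℕ∞) ≤ ⊤))
    have h2 := congrArg (fun α => α ![d μ, d ν]) h1
    have hdF : DifferentiableAt ℝ F y := hFy.differentiableAt (by simp)
    have hdF' : DifferentiableAt ℝ (fderiv ℝ F) y :=
      ((hF.fderiv_of_isOpen hO (m := ∞) (by simp)).contDiffAt (hO.mem_nhds hy)).differentiableAt
        (by simp)
    have hcomp : DifferentiableAt ℝ (fun z => omega i j (F z)) y :=
      DifferentiableAt.comp (g := omega i j) (f := F) y hωy hdF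
    rw [extDeriv_apply (hcomp.continuousAlternatingMapCompContinuousLinearMap hdF')] at h2
    have h3 : ∀ (v : Fin 1 → Y) (z : Y),
        ((omega i j (F z)).compContinuousLinearMap (fderiv ℝ F z)) v = pullConn F (v 0) z i j :=
      fun v z => omega_apply i j (F z) (fun a => fderiv ℝ F z (v a))
    rw [Fin.sum_univ_two] at h2
    simp only [h3] at h2
    have h4 : (omega (m := m) i j).d (F y) ![fderiv ℝ F y (d μ), fderiv ℝ F y (d ν)] =
        ((extDeriv (omega (m := m) i j) (F y)).compContinuousLinearMap (fderiv ℝ F y)) ![d μ, d ν] := by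
      refine congrArg (extDeriv (omega (m := m) i j) (F y)) ?_
      funext a; fin_cases a <;> rfl
    rw [h4, ← h2]
    simp [Fin.removeNth, dMat, sub_eq_add_neg]
  simp only [curvC, curv, Pi.add_apply, Finset.sum_apply, DForm.wedge,
    ContinuousAlternatingMap.add_apply, ContinuousAlternatingMap.sum_apply, hd,
    wedge_one_one_apply, omega_apply, Matrix.cons_val_zero, Finset.sum_sub_distrib]
  rfl

theorem curvUpC_fderiv (hO : IsOpen O) (hF : ContDiffOn ℝ ∞ F O)
    (h0 : ∀ y ∈ O, (frameM (F y)).det ≠ 0) (d : Fin m → Y) {y : Y} (hy : y ∈ O) :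
    curvUpC (F y) (fun a => fderiv ℝ F y (d a)) = curvR d (fun a => pullConn F (d a)) y := by
  funext i j μ ν
  rw [curvUpC_eq, curvR, Matrix.mul_apply]
  refine Finset.sum_congr rfl fun q _ => ?_
  rw [curvC_fderiv hO hF h0 d hy, mul_comm]
  congr 1
  exact congrFun (congrFun (etaM_transpose (m := m)) q) j

theorem thetaC_fderiv {d : Fin m → Y} {y : Y}
    (hd : ∀ a, (fderiv ℝ F y (d a)).1 = EuclideanSpace.single a 1) :
    thetaC (F y) (fun a => fderiv ℝ F y (d a)) = fun i j => (frameM (F y))⁻¹ i j := by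
  funext i j
  rw [thetaC, theta_apply, hd]
  simp

end PullbackComponents

/-! ### Metric and torsion in coordinate form. -/

section MetricCompatibility

variable {m : ℕ} {Y : Type*} [NormedAddCommGroup Y] [NormedSpace ℝ Y] {O : Set Y}
  {e : Y → Matrix (Fin m) (Fin m) ℝ}

theorem dMat_metric (hO : IsOpen O) (he : SmoothMat e O) (h0 : ∀ y ∈ O, (e y).det ≠ 0) {y : Y}
    (hy : y ∈ O) (w : Y) :
    dMat w (fun y => metric (e y)) y = -(metric (e y) * (dMat w e y * (e y)⁻¹) +
      (metric (e y) * (dMat w e y * (e y)⁻¹)).transpose) := by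
  have hi := (he.inv h0).diffMat hO hy
  have hη := diffMat_const (etaM m) y
  have : (fun y => metric (e y)) = fun y => ((e y)⁻¹).transpose * etaM m * (e y)⁻¹ := rfl
  rw [this, dMat_mul (hi.transpose.mul hη) hi, dMat_mul hi.transpose hη, dMat_const, mul_zero,
    add_zero, dMat_transpose, dMat_inv hO he h0 hy]
  simp only [metric, Matrix.transpose_mul, Matrix.transpose_neg, Matrix.transpose_transpose,
    etaM_transpose, neg_mul, mul_neg, mul_assoc, neg_add_rev]

/-- A connection with skew matrices in the frame preserves the metric of the frame. -/
theorem metric_compatible_of_skew (hO : IsOpen O) (he : SmoothMat e O) (h0 : ∀ y ∈ O, (e y).det ≠ 0) {y : Y}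
    (hy : y ∈ O) (w : Y) {G : Matrix (Fin m) (Fin m) ℝ}
    (h : etaM m * ((e y)⁻¹ * (dMat w e y + G * e y)) +
      (etaM m * ((e y)⁻¹ * (dMat w e y + G * e y))).transpose = 0) :
    metric (e y) * G + (metric (e y) * G).transpose = dMat w (fun y => metric (e y)) y := by
  have hc := det_inv_cancel (h0 y hy)
  have h1 : ((e y)⁻¹).transpose * (etaM m * ((e y)⁻¹ * (dMat w e y + G * e y))) * (e y)⁻¹ +
      ((e y)⁻¹).transpose * (etaM m * ((e y)⁻¹ * (dMat w e y + G * e y))).transpose *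
      (e y)⁻¹ = 0 := by
    rw [← add_mul, ← mul_add, h, mul_zero, zero_mul]
  have h2 : ((e y)⁻¹).transpose * (etaM m * ((e y)⁻¹ * (dMat w e y + G * e y))) * (e y)⁻¹ =
      metric (e y) * (dMat w e y * (e y)⁻¹) + metric (e y) * G := by
    rw [← mul_add]
    have : G = G * e y * (e y)⁻¹ := by rw [mul_assoc, hc.2, mul_one]
    conv_rhs => rw [this, ← add_mul]
    simp only [metric, mul_assoc]
  have h3 : ((e y)⁻¹).transpose * (etaM m * ((e y)⁻¹ * (dMat w e y + G * e y))).transpose *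
      (e y)⁻¹ = (metric (e y) * (dMat w e y * (e y)⁻¹) + metric (e y) * G).transpose := by
    rw [← h2]
    simp only [Matrix.transpose_mul, Matrix.transpose_transpose, mul_assoc]
  rw [h2, h3] at h1
  rw [dMat_metric hO he h0 hy]
  rw [Matrix.transpose_add] at h1
  rw [eq_neg_iff_add_eq_zero, ← h1]
  abel

/-- The derivatives of the frame cancel, and the covariant derivative of the coframe is e⁻¹ Γ. Its
symmetry in the lower indices is therefore that of Γ. -/
theorem torsion_free (hO : IsOpen O) (he : SmoothMat e O) (h0 : ∀ y ∈ O, (e y).det ≠ 0) {y : Y}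
    (hy : y ∈ O) (w : Y) (G : Matrix (Fin m) (Fin m) ℝ) :
    dMat w (fun y => (e y)⁻¹) y + (e y)⁻¹ * (dMat w e y + G * e y) * (e y)⁻¹ = (e y)⁻¹ * G := by
  have hc := det_inv_cancel (h0 y hy)
  rw [dMat_inv hO he h0 hy, mul_add, add_mul, mul_assoc (e y)⁻¹ (G * e y), mul_assoc G, hc.2,
    mul_one]
  abel

end MetricCompatibility

/-! ### The explicit deformation of a section. -/

section Flow

variable {m : ℕ}

/-- The coordinate direction `∂/∂x^σ` in `ℝ × ℝᵐ`. -/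
noncomputable def spaceDir (σ : Fin m) : ℝ × E m := (0, EuclideanSpace.single σ 1)

/-- The deformed frame `(1 + (exp (t f) - 1) P) e`. -/
noncomputable def flowFrame (f : E m → ℝ) (P : Matrix (Fin m) (Fin m) ℝ)
    (e : E m → Matrix (Fin m) (Fin m) ℝ) (y : ℝ × E m) : Matrix (Fin m) (Fin m) ℝ :=
  (1 + (Real.exp (y.1 * f y.2) - 1) • P) * e y.2

/-- The Levi-Civita connection of the deformed frame. -/
noncomputable def flowGamma (f : E m → ℝ) (P : Matrix (Fin m) (Fin m) ℝ)
    (e : E m → Matrix (Fin m) (Fin m) ℝ) (y : ℝ × E m) (σ : Fin m) : Matrix (Fin m) (Fin m) ℝ :=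
  cometric (flowFrame f P e y) *
    koszul (fun σ => dMat (spaceDir σ) (fun y => metric (flowFrame f P e y)) y) σ

/-- The curve of sections generated by the variation field. -/
noncomputable def flowSection (f : E m → ℝ) (P : Matrix (Fin m) (Fin m) ℝ)
    (e : E m → Matrix (Fin m) (Fin m) ℝ) (y : ℝ × E m) : Coord m :=
  (y.2, flowFrame f P e y, symArray m (flowGamma f P e y))

variable {f : E m → ℝ} {P : Matrix (Fin m) (Fin m) ℝ} {e : E m → Matrix (Fin m) (Fin m) ℝ}
  {T : Set (E m)}

theorem dMat_metric_flow_symm (y : ℝ × E m) (σ : Fin m) :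
    (dMat (spaceDir σ) (fun y => metric (flowFrame f P e y)) y).transpose =
      dMat (spaceDir σ) (fun y => metric (flowFrame f P e y)) y := by
  rw [← dMat_transpose]
  simp only [metric_transpose]

theorem gammaM_flowSection (y : ℝ × E m) (σ : Fin m) :
    gammaM σ (flowSection f P e y) = flowGamma f P e y σ := by
  ext μ ν
  exact symArray_apply (fun σ ν μ => mul_koszul_symm (dMat_metric_flow_symm y) _ σ ν μ) μ ν σ

theorem flowGamma_symm (y : ℝ × E m) (σ ν μ : Fin m) :
    flowGamma f P e y σ ν μ = flowGamma f P e y μ ν σ :=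
  mul_koszul_symm (dMat_metric_flow_symm y) _ σ ν μ

/-- For idempotent P the matrix 1 + (exp(tf) - 1) P is exp(t f P), with inverse exp(-t f P). The
deformed frame is thus invertible for all times. -/
theorem det_flowFrame (hP : P * P = P) {y : ℝ × E m} (h : (e y.2).det ≠ 0) :
    (flowFrame f P e y).det ≠ 0 := by
  have h1 : (1 + (Real.exp (y.1 * f y.2) - 1) • P) * (1 + (Real.exp (-(y.1 * f y.2)) - 1) • P) = 1 := by
    have h2 : Real.exp (y.1 * f y.2) * Real.exp (-(y.1 * f y.2)) = 1 := by
      rw [← Real.exp_add, add_neg_cancel, Real.exp_zero]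
    simp only [mul_add, add_mul, one_mul, mul_one, Matrix.smul_mul, Matrix.mul_smul, hP, smul_smul]
    rw [add_assoc, ← add_smul, ← add_smul]
    rw [show Real.exp (y.1 * f y.2) - 1 + ((Real.exp (-(y.1 * f y.2)) - 1) +
      (Real.exp (-(y.1 * f y.2)) - 1) * (Real.exp (y.1 * f y.2) - 1)) = 0 by linarith]
    simp
  have h3 := congrArg Matrix.det h1
  rw [Matrix.det_mul, Matrix.det_one] at h3
  rw [flowFrame, Matrix.det_mul]
  exact mul_ne_zero (left_ne_zero_of_mul (h3 ▸ one_ne_zero)) h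

theorem contDiff_exp_flow (hf : ContDiff ℝ ∞ f) :
    ContDiff ℝ ∞ fun y : ℝ × E m => Real.exp (y.1 * f y.2) - 1 :=
  (Real.contDiff_exp.comp (contDiff_fst.mul (hf.comp contDiff_snd))).sub contDiff_const

theorem smoothMat_flowFrame (hf : ContDiff ℝ ∞ f) (he : SmoothMat e T) :
    SmoothMat (flowFrame f P e) (univ ×ˢ T) := by
  refine ((smoothMat_const 1 _).add (SmoothMat.smul (contDiff_exp_flow hf).contDiffOn
    (smoothMat_const P _))).mul fun i j => ?_
  exact (he i j).comp contDiff_snd.contDiffOn fun y hy => hy.2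

theorem isOpen_flow (hT : IsOpen T) : IsOpen ((univ : Set ℝ) ×ˢ T) := isOpen_univ.prod hT

theorem smoothMat_flowGamma (hf : ContDiff ℝ ∞ f) (hP : P * P = P) (hT : IsOpen T)
    (he : SmoothMat e T) (h0 : ∀ x ∈ T, (e x).det ≠ 0) (σ : Fin m) :
    SmoothMat (fun y => flowGamma f P e y σ) (univ ×ˢ T) := by
  have hF := smoothMat_flowFrame (P := P) hf he
  have hg := hF.metric fun y hy => det_flowFrame hP (h0 y.2 hy.2)
  exact hF.cometric.mul (SmoothMat.koszul (fun σ => hg.dMat (isOpen_flow hT) (spaceDir σ)) σ)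

theorem contDiffOn_flowSection (hf : ContDiff ℝ ∞ f) (hP : P * P = P) (hT : IsOpen T)
    (he : SmoothMat e T) (h0 : ∀ x ∈ T, (e x).det ≠ 0) :
    ContDiffOn ℝ ∞ (flowSection f P e) (univ ×ˢ T) :=
  contDiff_snd.contDiffOn.prodMk ((contDiffOn_pi.2 fun μ => contDiffOn_pi.2 fun j =>
    smoothMat_flowFrame hf he μ j).prodMk
      (contDiffOn_symArray fun σ => smoothMat_flowGamma hf hP hT he h0 σ))

/-- The frame part of the flow equation; idempotency gives P exp(t f P) = exp(t f) P, the time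
derivative divided by f. -/
theorem dMat_time_flowFrame (hf : ContDiff ℝ ∞ f) (hP : P * P = P) (hT : IsOpen T)
    (he : SmoothMat e T) {y : ℝ × E m} (hy : y.2 ∈ T) :
    dMat (1, 0) (flowFrame f P e) y = f y.2 • (P * flowFrame f P e y) := by
  have hy' : y ∈ (univ : Set ℝ) ×ˢ T := ⟨mem_univ _, hy⟩
  have hx := (contDiff_exp_flow hf).contDiffOn (s := (univ : Set ℝ) ×ˢ T)
  have hxd : DifferentiableAt ℝ (fun y : ℝ × E m => Real.exp (y.1 * f y.2) - 1) y :=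
    (contDiff_exp_flow hf).differentiable (by simp) y
  have he' : DiffMat (fun y : ℝ × E m => e y.2) y := fun i j =>
    DifferentiableAt.comp (g := fun x => e x i j) (f := Prod.snd) y
      (he.diffMat hT hy i j) differentiableAt_snd
  have hPd := diffMat_const (Y := ℝ × E m) P y
  have h1d := diffMat_const (Y := ℝ × E m) (1 : Matrix (Fin m) (Fin m) ℝ) y
  have h1 : dMat (1, 0) (fun y : ℝ × E m => e y.2) y = 0 := by
    ext i j
    have := fderiv_comp (g := fun x => e x i j) (f := (Prod.snd : ℝ × E m → E m)) y
      (he.diffMat hT hy i j) differentiableAt_snd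
    have h2 := congrArg (fun L => L ((1, 0) : ℝ × E m)) this
    rw [fderiv_snd] at h2
    simpa [dMat, Function.comp_def] using h2
  have h2 : fderiv ℝ (fun y : ℝ × E m => Real.exp (y.1 * f y.2) - 1) y (1, 0) =
      f y.2 * Real.exp (y.1 * f y.2) := by
    have := hxd.lineDeriv_eq_fderiv (v := ((1, 0) : ℝ × E m))
    rw [← this, lineDeriv]
    have : HasDerivAt (fun t : ℝ => Real.exp ((y.1 + t) * f y.2) - 1)
        (Real.exp ((y.1 + 0) * f y.2) * (1 * f y.2)) 0 :=
      ((((hasDerivAt_id (0 : ℝ)).const_add y.1).mul_const (f y.2)).exp).sub_const 1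
    rw [show (fun t : ℝ => Real.exp ((y + t • ((1, 0) : ℝ × E m)).1 *
      f (y + t • ((1, 0) : ℝ × E m)).2) - 1) = fun t : ℝ => Real.exp ((y.1 + t) * f y.2) - 1 by
        funext t; simp, this.deriv]
    simp [mul_comm]
  have : flowFrame f P e = fun y => (1 + (Real.exp (y.1 * f y.2) - 1) • P) * e y.2 := rfl
  rw [this, dMat_mul (h1d.add (DiffMat.smul hxd hPd)) he', h1, dMat_add h1d (DiffMat.smul hxd hPd),
    dMat_smul hxd hPd, dMat_const, dMat_const, h2]
  simp only [zero_add, smul_zero, mul_zero, add_zero]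
  rw [← mul_assoc, mul_add, Matrix.mul_smul, hP, mul_one]
  rw [show P + (Real.exp (y.1 * f y.2) - 1) • P = Real.exp (y.1 * f y.2) • P by
    rw [sub_smul, one_smul]; abel]
  simp only [Matrix.smul_mul, smul_smul]

theorem fderiv_comp_snd (hf : ContDiff ℝ ∞ f) (y : ℝ × E m) (w : ℝ × E m) :
    fderiv ℝ (fun y : ℝ × E m => f y.2) y w = fderiv ℝ f y.2 w.2 := by
  rw [show (fun y : ℝ × E m => f y.2) = f ∘ Prod.snd from rfl,
    fderiv_comp y (hf.differentiable (by simp)).differentiableAt differentiableAt_snd, fderiv_snd]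
  rfl

theorem flowGamma_compatible (hP : P * P = P) (h0 : ∀ x ∈ T, (e x).det ≠ 0) {y : ℝ × E m}
    (hy : y.2 ∈ T) (σ : Fin m) :
    metric (flowFrame f P e y) * flowGamma f P e y σ +
      (metric (flowFrame f P e y) * flowGamma f P e y σ).transpose =
      dMat (spaceDir σ) (fun y => metric (flowFrame f P e y)) y := by
  rw [flowGamma, ← mul_assoc, metric_mul_cometric (det_flowFrame hP (h0 _ hy)), one_mul]
  exact koszul_add_transpose (dMat_metric_flow_symm y) σ

theorem dMat_time_metric (hf : ContDiff ℝ ∞ f) (hP : P * P = P) (hT : IsOpen T)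
    (he : SmoothMat e T) (h0 : ∀ x ∈ T, (e x).det ≠ 0) {y : ℝ × E m} (hy : y.2 ∈ T) :
    dMat (1, 0) (fun y => metric (flowFrame f P e y)) y =
      -(f y.2 • (metric (flowFrame f P e y) * P + P.transpose * metric (flowFrame f P e y))) := by
  have hc := det_inv_cancel (det_flowFrame (f := f) hP (h0 _ hy))
  rw [dMat_metric (isOpen_flow hT) (smoothMat_flowFrame hf he)
    (fun y hy => det_flowFrame hP (h0 y.2 hy.2)) ⟨mem_univ _, hy⟩,
    dMat_time_flowFrame hf hP hT he hy, Matrix.smul_mul, mul_assoc P, hc.2, mul_one,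
    Matrix.mul_smul, Matrix.transpose_smul, Matrix.transpose_mul, metric_transpose, smul_add]

/-- The Γ-part of the flow equation. Differentiating metric compatibility in time shows that g ∂ₜΓ
solves the symmetric system that defines the Γ-component of the field, and `eq_koszul` says that
this system has only one solution. -/
theorem dMat_time_flowGamma (hf : ContDiff ℝ ∞ f) (hP : P * P = P) (hT : IsOpen T)
    (he : SmoothMat e T) (h0 : ∀ x ∈ T, (e x).det ≠ 0) {y : ℝ × E m} (hy : y.2 ∈ T) (σ : Fin m) :
    dMat (1, 0) (fun y => flowGamma f P e y σ) y = fieldGamma f P (flowSection f P e y) σ := by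
  have hO := isOpen_flow hT
  have hy' : y ∈ (univ : Set ℝ) ×ˢ T := ⟨mem_univ _, hy⟩
  have hF := smoothMat_flowFrame (P := P) hf he
  have hd : ∀ y ∈ (univ : Set ℝ) ×ˢ T, (flowFrame f P e y).det ≠ 0 :=
    fun y hy => det_flowFrame hP (h0 y.2 hy.2)
  have hg := hF.metric hd
  have hgd := hg.diffMat hO hy'
  have hG := fun σ => (smoothMat_flowGamma hf hP hT he h0 σ).diffMat hO hy'
  have hPd := diffMat_const (Y := ℝ × E m) P y
  have hPd' := diffMat_const (Y := ℝ × E m) P.transpose y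
  have hfd : DifferentiableAt ℝ (fun y : ℝ × E m => f y.2) y :=
    (hf.comp contDiff_snd).differentiable (by simp) y
  have hfn : DifferentiableAt ℝ (fun y : ℝ × E m => -f y.2) y := hfd.neg
  set g := metric (flowFrame f P e y) with hgdef
  have key : (fun σ => g * dMat (1, 0) (fun y => flowGamma f P e y σ) y) =
      koszul (covSource f P (flowSection f P e y)) := by
    refine eq_koszul (fun σ ν μ => ?_) fun σ => ?_
    · simp only [Matrix.mul_apply, dMat, Matrix.of_apply]
      refine Finset.sum_congr rfl fun ρ _ => ?_
      simp only [flowGamma_symm _ σ ρ μ]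
    · have h1 : (fun y => metric (flowFrame f P e y) * flowGamma f P e y σ +
          (metric (flowFrame f P e y) * flowGamma f P e y σ).transpose) =ᶠ[𝓝 y]
          dMat (spaceDir σ) (fun y => metric (flowFrame f P e y)) := by
        filter_upwards [hO.mem_nhds hy'] with z hz
        exact flowGamma_compatible hP h0 hz.2 σ
      have h2 : dMat (1, 0) (fun y => metric (flowFrame f P e y)) =ᶠ[𝓝 y]
          fun y => (-f y.2) • (metric (flowFrame f P e y) * P +
            P.transpose * metric (flowFrame f P e y)) := by
        filter_upwards [hO.mem_nhds hy'] with z hz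
        rw [dMat_time_metric hf hP hT he h0 hz.2, neg_smul]
      have h3 := dMat_congr h1 (1, 0)
      -- Time and space derivatives of the metric are exchanged, so that ∂ₜg = -f (g P + Pᵀ g) can
      -- be inserted; compatibility then eliminates the space derivative of g.
      rw [dMat_comm hO hg hy', dMat_congr h2, dMat_smul hfn ((hgd.mul hPd).add (hPd'.mul hgd)),
        dMat_add (hgd.mul (hG σ)) (hgd.mul (hG σ)).transpose, dMat_transpose,
        dMat_mul hgd (hG σ), dMat_time_metric hf hP hT he h0 hy,
        dMat_add (hgd.mul hPd) (hPd'.mul hgd), dMat_mul hgd hPd, dMat_mul hPd' hgd, dMat_const,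
        dMat_const, ← flowGamma_compatible hP h0 hy] at h3
      have h4 : fderiv ℝ (fun y : ℝ × E m => -f y.2) y (spaceDir σ) = -partialD f σ y.2 := by
        rw [show (fun y : ℝ × E m => -f y.2) = -fun y : ℝ × E m => f y.2 from rfl, fderiv_neg,
          neg_apply, fderiv_comp_snd hf]
        rfl
      rw [h4, ← hgdef] at h3
      have hgt : g.transpose = g := metric_transpose _
      have e1 : covSource f P (flowSection f P e y) σ = -(g * (partialD f σ y.2 • P + f y.2 •
          (flowGamma f P e y σ * P - P * flowGamma f P e y σ)) + (g * (partialD f σ y.2 • P +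
          f y.2 • (flowGamma f P e y σ * P - P * flowGamma f P e y σ))).transpose) := by
        rw [← gammaM_flowSection]; rfl
      rw [e1]
      generalize flowGamma f P e y σ = G at h3 ⊢
      generalize dMat (1, 0) (fun y => flowGamma f P e y σ) y = D at h3 ⊢
      generalize f y.2 = a at h3 ⊢
      generalize partialD f σ y.2 = b at h3 ⊢
      simp only [Matrix.transpose_mul, Matrix.transpose_add, Matrix.transpose_neg,
        Matrix.transpose_sub, Matrix.transpose_smul, Matrix.transpose_transpose, hgt, mul_add,
        add_mul, mul_sub, Matrix.mul_smul, Matrix.smul_mul, smul_add, smul_sub, neg_mul,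
        mul_zero, zero_mul, add_zero, zero_add, neg_smul, mul_assoc] at h3 ⊢
      rw [← sub_eq_zero] at h3 ⊢
      rw [← h3]
      abel
  have h5 := congrFun key σ
  rw [fieldGamma, ← h5, ← mul_assoc]
  have : cometric (frameM (flowSection f P e y)) * g = 1 :=
    cometric_mul_metric (det_flowFrame hP (h0 _ hy))
  rw [this, one_mul]

end Flow

/-! ### The deformation is an integral curve starting at the section. -/

section FlowCurve

variable {m : ℕ} {f : E m → ℝ} {P : Matrix (Fin m) (Fin m) ℝ}
  {e : E m → Matrix (Fin m) (Fin m) ℝ} {T : Set (E m)}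

theorem hasDerivAt_time {u : ℝ × E m → ℝ} {t : ℝ} {x : E m} (hu : DifferentiableAt ℝ u (t, x)) :
    HasDerivAt (fun t' => u (t', x)) (fderiv ℝ u (t, x) (1, 0)) t :=
  HasFDerivAt.comp_hasDerivAt (f := fun t' : ℝ => (t', x)) t hu.hasFDerivAt
    ((hasDerivAt_id t).prodMk (hasDerivAt_const t x))

theorem hasDerivAt_flowSection (hf : ContDiff ℝ ∞ f) (hP : P * P = P) (hT : IsOpen T)
    (he : SmoothMat e T) (h0 : ∀ x ∈ T, (e x).det ≠ 0) (t : ℝ) {x : E m} (hx : x ∈ T) :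
    HasDerivAt (fun t' => flowSection f P e (t', x))
      (variationField f P (flowSection f P e (t, x))) t := by
  have hO := isOpen_flow hT
  have hy : (t, x) ∈ (univ : Set ℝ) ×ˢ T := ⟨mem_univ _, hx⟩
  refine (hasDerivAt_const t x).prodMk (HasDerivAt.prodMk ?_ ?_)
  · refine hasDerivAt_pi.2 fun μ => hasDerivAt_pi.2 fun j => ?_
    have h1 := hasDerivAt_time ((smoothMat_flowFrame (P := P) hf he).diffMat hO hy μ j)
    have h2 := congrFun (congrFun (dMat_time_flowFrame (y := (t, x)) hf hP hT he hx) μ) j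
    exact h1.congr_deriv h2
  · have h : HasDerivAt (fun t' : ℝ => (fun σ μ ν => flowGamma f P e (t', x) σ μ ν :
        Fin m → Fin m → Fin m → ℝ))
        (fun σ μ ν => fieldGamma f P (flowSection f P e (t, x)) σ μ ν) t := ?_
    · exact (symArray m).hasFDerivAt.comp_hasDerivAt t h
    refine hasDerivAt_pi.2 fun σ => hasDerivAt_pi.2 fun μ => hasDerivAt_pi.2 fun ν => ?_
    have h1 := hasDerivAt_time ((smoothMat_flowGamma hf hP hT he h0 σ).diffMat hO hy μ ν)
    have h2 := congrFun (congrFun (dMat_time_flowGamma (y := (t, x)) hf hP hT he h0 hx σ) μ) ν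
    exact h1.congr_deriv h2

theorem fderiv_slice {F : Type*} [NormedAddCommGroup F] [NormedSpace ℝ F] {u : ℝ × E m → F} {t : ℝ}
    {x : E m} (hu : DifferentiableAt ℝ u (t, x)) (v : E m) :
    fderiv ℝ (fun x => u (t, x)) x v = fderiv ℝ u (t, x) (0, v) := by
  have := HasFDerivAt.comp (f := fun x : E m => (t, x)) x hu.hasFDerivAt
    ((hasFDerivAt_const t x).prodMk (hasFDerivAt_id x))
  rw [show (fun x => u (t, x)) = u ∘ fun x => (t, x) from rfl, this.fderiv]
  rfl

theorem flowFrame_eq_self {y : ℝ × E m} (h : y.1 * f y.2 = 0) : flowFrame f P e y = e y.2 := by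
  simp [flowFrame, h]

theorem fst_fderiv_of_section {s : E m → Coord m} (hT : IsOpen T) {x : E m}
    (hsx : DifferentiableAt ℝ s x) (hs1 : ∀ x ∈ T, (s x).1 = x) (hx : x ∈ T) (v : E m) :
    (fderiv ℝ s x v).1 = v := by
  have h1 : (fun x => (s x).1) =ᶠ[𝓝 x] id := by
    filter_upwards [hT.mem_nhds hx] with z hz using hs1 z hz
  have h2 := HasFDerivAt.comp x (hasFDerivAt_fst (𝕜 := ℝ) (p := s x)) hsx.hasFDerivAt
  have h3 : fderiv ℝ (fun x => (s x).1) x = ContinuousLinearMap.id ℝ (E m) := by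
    rw [h1.fderiv_eq, fderiv_id]
  have h4 := h2.fderiv
  rw [show Prod.fst ∘ s = fun x => (s x).1 from rfl, h3] at h4
  exact (congrArg (fun L => L v) h4).symm

/-- The connection coefficients of a section along which the connection is metric. -/
theorem gammaM_eq_koszul {s : E m → Coord m} (hT : IsOpen T) (hs : ContDiffOn ℝ ∞ s T)
    (hs1 : ∀ x ∈ T, (s x).1 = x) (h0 : ∀ x ∈ T, (frameM (s x)).det ≠ 0)
    (hskew : ∀ x ∈ T, ∀ σ : Fin m, etaM m * pullConn s (EuclideanSpace.single σ 1) x +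
      (etaM m * pullConn s (EuclideanSpace.single σ 1) x).transpose = 0)
    {x : E m} (hx : x ∈ T) (σ : Fin m) :
    gammaM σ (s x) = cometric (frameM (s x)) * koszul (fun σ =>
      dMat (EuclideanSpace.single σ 1) (fun x => metric (frameM (s x))) x) σ := by
  have hsx : DifferentiableAt ℝ s x := (hs.contDiffAt (hT.mem_nhds hx)).differentiableAt (by simp)
  have hdir := fst_fderiv_of_section hT hsx hs1 hx
  have key : (fun σ => metric (frameM (s x)) * gammaM σ (s x)) =
      koszul fun σ => dMat (EuclideanSpace.single σ 1) (fun x => metric (frameM (s x))) x := by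
    refine eq_koszul (fun σ ν μ => ?_) fun σ => ?_
    · simp only [Matrix.mul_apply]
      exact Finset.sum_congr rfl fun ρ _ => congrArg _ ((s x).2.2.2 ρ μ σ)
    · refine metric_compatible_of_skew hT (smoothMat_frameM_comp hs) h0 hx _ ?_
      have := hskew x hx σ
      rwa [pullConn_eq hsx (hdir _)] at this
  rw [← congrFun key σ, ← mul_assoc, cometric_mul_metric (h0 x hx), one_mul]

/-- The Γ of a metric section is determined by its frame, so undeformed frames have undeformed Γ.
Vanishing of t f near x is required, not just at x, since Γ contains derivatives of the frame. This
covers both the initial condition t = 0 and the points off the support of f. -/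
theorem flowSection_eq_self {s : E m → Coord m} (hf : ContDiff ℝ ∞ f) (hP : P * P = P)
    (hT : IsOpen T) (hs : ContDiffOn ℝ ∞ s T)
    (hs1 : ∀ x ∈ T, (s x).1 = x) (h0 : ∀ x ∈ T, (frameM (s x)).det ≠ 0)
    (hskew : ∀ x ∈ T, ∀ σ : Fin m, etaM m * pullConn s (EuclideanSpace.single σ 1) x +
      (etaM m * pullConn s (EuclideanSpace.single σ 1) x).transpose = 0)
    {t : ℝ} {x : E m} (hx : x ∈ T) (ht : ∀ᶠ z in 𝓝 x, t * f z = 0) :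
    flowSection f P (fun x => frameM (s x)) (t, x) = s x := by
  have he := smoothMat_frameM_comp hs
  have hy : (t, x) ∈ (univ : Set ℝ) ×ˢ T := ⟨mem_univ _, hx⟩
  have hfr : flowFrame f P (fun x => frameM (s x)) (t, x) = frameM (s x) :=
    flowFrame_eq_self ht.self_of_nhds
  have hB : ∀ σ, dMat (spaceDir σ) (fun y => metric (flowFrame f P (fun x => frameM (s x)) y)) (t, x)
      = dMat (EuclideanSpace.single σ 1) (fun x => metric (frameM (s x))) x := by
    intro σ
    have h1 : (fun z => metric (flowFrame f P (fun x => frameM (s x)) (t, z))) =ᶠ[𝓝 x]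
        fun z => metric (frameM (s z)) := by
      filter_upwards [ht] with z hz
      rw [flowFrame_eq_self (y := (t, z)) hz]
    rw [← dMat_congr h1]
    ext i j
    exact (fderiv_slice (((smoothMat_flowFrame (P := P) hf he).metric
      (fun y hy => det_flowFrame hP (h0 y.2 hy.2))).diffMat (isOpen_flow hT) hy i j) _).symm
  have hG : ∀ σ, gammaM σ (flowSection f P (fun x => frameM (s x)) (t, x)) = gammaM σ (s x) := by
    intro σ
    rw [gammaM_flowSection, gammaM_eq_koszul hT hs hs1 h0 hskew hx, flowGamma, hfr]
    simp only [hB]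
  refine Prod.ext (hs1 x hx).symm (Prod.ext ?_ ?_)
  · exact hfr
  · ext μ ν σ
    exact congrFun (congrFun (hG σ) μ) ν

end FlowCurve

/-! ### Sections of T₀ in a chart. -/

section LocalRepresentation

variable {m : ℕ} {M : Type*} [TopologicalSpace M] [ChartedSpace (E m) M]

/-- The frame is an isomorphism and the differential of a chart is injective, so the matrix of
components has no kernel. -/
theorem det_frameCoord {φ : OpenPartialHomeomorph M (E m)}
    (hφ : φ ∈ IsManifold.maximalAtlas (𝓡 m) ∞ M)
    (s : (y : M) → (Fin m → ℝ) ≃ₗ[ℝ] TangentSpace (𝓡 m) y) {p : E m} (hp : p ∈ φ.target) :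
    (Matrix.of (frameCoord φ s p)).det ≠ 0 := by
  have hd : φ.MDifferentiable (𝓡 m) (𝓡 m) :=
    ⟨(contMDiffOn_of_mem_maximalAtlas hφ).mdifferentiableOn (by simp),
      (contMDiffOn_symm_of_mem_maximalAtlas hφ).mdifferentiableOn (by simp)⟩
  have hinj := hd.mfderiv_injective (φ.map_target hp)
  intro h
  obtain ⟨v, hv, hv0⟩ := Matrix.exists_mulVec_eq_zero_iff.2 h
  apply hv
  have h1 : mfderiv (𝓡 m) (𝓡 m) φ (φ.symm p) (s (φ.symm p) v) = 0 := by
    have h2 : v = ∑ k, v k • (Pi.single k 1 : Fin m → ℝ) := by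
      ext k; simp [Finset.sum_apply, Pi.single_apply]
    have h3 : mfderiv (𝓡 m) (𝓡 m) φ (φ.symm p) (s (φ.symm p) v) =
        ∑ k, v k • mfderiv (𝓡 m) (𝓡 m) φ (φ.symm p) (s (φ.symm p) (Pi.single k 1)) := by
      conv_lhs => rw [h2, map_sum, map_sum]
      simp
    rw [h3]
    refine PiLp.ext fun μ => ?_
    have h4 := congrFun hv0 μ
    simp only [Matrix.mulVec, dotProduct, Matrix.of_apply, Pi.zero_apply] at h4
    have h6 : ∀ w : Fin m → E m, (∑ k, v k • w k) μ = ∑ k, w k μ * v k := by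
      intro w; simp [mul_comm]
    exact (h6 fun k => mfderiv (𝓡 m) (𝓡 m) φ (φ.symm p) (s (φ.symm p) (Pi.single k 1))).trans h4
  rw [← map_zero (mfderiv (𝓡 m) (𝓡 m) φ (φ.symm p))] at h1
  have h5 := hinj h1
  rwa [LinearEquiv.map_eq_zero_iff] at h5

variable [IsManifold (𝓡 m) ∞ M]

theorem localRep_fst (φ : OpenPartialHomeomorph M (E m))
    (hφ : φ ∈ IsManifold.maximalAtlas (𝓡 m) ∞ M) (S : (x : M) → T0 m x) {p : E m}
    (hp : p ∈ φ.target) : (localRep φ hφ S p).1 = p := by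
  rw [localRep, dif_pos hp]
  exact φ.right_inv hp

theorem det_localRep (φ : OpenPartialHomeomorph M (E m))
    (hφ : φ ∈ IsManifold.maximalAtlas (𝓡 m) ∞ M) (S : (x : M) → T0 m x) {p : E m}
    (hp : p ∈ φ.target) : (frameM (localRep φ hφ S p)).det ≠ 0 := by
  rw [localRep, dif_pos hp]
  have : ∀ {x : M} (hx : x ∈ φ.source) (ρ : J1 m x), (Matrix.of (ρ.e φ hφ hx)).det ≠ 0 := by
    intro x hx ρ
    induction ρ using Quotient.inductionOn with
    | h s => exact det_frameCoord hφ s.1 (φ.map_source hx)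
  exact this (φ.map_target hp) _

/-- The generators of the ideal, in degree one, already give skewness of the pulled-back connection.
-/
theorem skew_of_isIntegral {S : T0Section m M} (hS : IsIntegral S) (φ : OpenPartialHomeomorph M (E m))
    (hφ : φ ∈ IsManifold.maximalAtlas (𝓡 m) ∞ M) {p : E m} (hp : p ∈ φ.target) (v : E m) :
    etaM m * pullConn (localRep φ hφ S.toFun) v p +
      (etaM m * pullConn (localRep φ hφ S.toFun) v p).transpose = 0 := by
  rw [add_eta_conj_transpose]
  ext i j
  have h1 := hS φ hφ 1 (omegaP (i, j)) (DiffIdeal.gen (i, j)) p hp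
  have h2 := congrArg (fun α => α ![v]) h1
  have h3 := omegaP_apply (i, j) (localRep φ hφ S.toFun p)
    (fun a => fderiv ℝ (localRep φ hφ S.toFun) p (![v] a))
  have h4 : (1 / 2 : ℝ) * (pullConn (localRep φ hφ S.toFun) v p +
      (etaM m * pullConn (localRep φ hφ S.toFun) v p * etaM m).transpose) i j = 0 :=
    h3.symm.trans h2
  simpa using h4

end LocalRepresentation

/-! ### Differentiation under the integral and vanishing of divergences. -/

section Analysis

open MeasureTheory

variable {m : ℕ} {T K : Set (E m)}

theorem hasDerivAt_setIntegral {u : ℝ × E m → ℝ} (hT : IsOpen T)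
    (hu : ContDiffOn ℝ ∞ u (univ ×ˢ T)) (hK : IsCompact K) (hKT : K ⊆ T) :
    HasDerivAt (fun t => ∫ x in K, u (t, x)) (∫ x in K, fderiv ℝ u (0, x) (1, 0)) 0 := by
  have hO := isOpen_flow (m := m) hT
  have hc : ∀ t : ℝ, ContinuousOn (fun x => u (t, x)) K := fun t =>
    hu.continuousOn.comp (by fun_prop) fun x hx => ⟨mem_univ _, hKT hx⟩
  have hu' := (contDiffOn_fderiv_apply hO hu ((1, 0) : ℝ × E m)).continuousOn
  have hc' : ContinuousOn (fun x => fderiv ℝ u ((0 : ℝ), x) (1, 0)) K :=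
    hu'.comp (by fun_prop) fun x hx => ⟨mem_univ _, hKT hx⟩
  -- Restricting time to a compact interval gives one constant that dominates the time derivative on
  -- all of K.
  have hcpt : IsCompact (Icc (-1 : ℝ) 1 ×ˢ K) := isCompact_Icc.prod hK
  obtain ⟨B, hB⟩ := hcpt.exists_bound_of_continuousOn
    (hu'.mono (prod_mono (subset_univ _) hKT))
  refine (hasDerivAt_integral_of_dominated_loc_of_deriv_le (μ := volume.restrict K)
    (s := Icc (-1 : ℝ) 1) (bound := fun _ => B) (F := fun t x => u (t, x))
    (F' := fun t x => fderiv ℝ u (t, x) (1, 0))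
    (Icc_mem_nhds (by norm_num) (by norm_num)) ?_ ?_ ?_ ?_ ?_ ?_).2
  · exact Eventually.of_forall fun t => (hc t).aestronglyMeasurable hK.measurableSet
  · exact (hc 0).integrableOn_compact hK
  · exact hc'.aestronglyMeasurable hK.measurableSet
  · filter_upwards [ae_restrict_mem hK.measurableSet] with x hx t ht
    exact hB (t, x) ⟨ht, hx⟩
  · have : IsFiniteMeasure (volume.restrict K) := ⟨by simpa using hK.measure_lt_top⟩
    exact integrable_const B
  · filter_upwards [ae_restrict_mem hK.measurableSet] with x hx t ht
    exact hasDerivAt_time ((hu.contDiffAt (hO.mem_nhds ⟨mem_univ _, hKT hx⟩)).differentiableAt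
      (by simp))

theorem setIntegral_fderiv_eq_zero {u : E m → ℝ} (hT : IsOpen T) (hu : ContDiffOn ℝ ∞ u T)
    (hK : IsCompact K) (hKT : K ⊆ T) (h0 : ∀ x ∈ T, x ∉ K → u x = 0) (v : E m) :
    ∫ x in K, fderiv ℝ u x v = 0 := by
  classical
  -- Because u vanishes on T outside K, this extension agrees with u on all of T; it is therefore
  -- smooth across the boundary of K, and compactly supported.
  set w : E m → ℝ := K.indicator u with hw
  have hwT : EqOn w u T := fun x hx => by
    by_cases hxK : x ∈ K
    · exact indicator_of_mem hxK u
    · rw [hw, indicator_of_notMem hxK, h0 x hx hxK]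
  have hwK : EqOn w 0 Kᶜ := fun x hx => indicator_of_notMem hx u
  have hcd : ContDiff ℝ ∞ w := by
    rw [contDiff_iff_contDiffAt]
    intro x
    by_cases hx : x ∈ K
    · refine (hu.contDiffAt (hT.mem_nhds (hKT hx))).congr_of_eventuallyEq ?_
      filter_upwards [hT.mem_nhds (hKT hx)] with z hz using hwT hz
    · refine contDiffAt_const.congr_of_eventuallyEq (f := fun _ => (0 : ℝ)) ?_
      filter_upwards [hK.isClosed.isOpen_compl.mem_nhds hx] with z hz using hwK hz
  have hcs : HasCompactSupport w := HasCompactSupport.intro hK fun x hx => hwK hx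
  have h1 : ∀ x ∈ K, fderiv ℝ u x v = fderiv ℝ w x v := fun x hx => by
    have : w =ᶠ[𝓝 x] u := by filter_upwards [hT.mem_nhds (hKT hx)] with z hz using hwT hz
    rw [this.fderiv_eq]
  rw [setIntegral_congr_fun hK.measurableSet h1,
    setIntegral_eq_integral_of_forall_compl_eq_zero (fun x hx => ?_)]
  · have hd : Continuous fun x => fderiv ℝ w x v :=
      (hcd.continuous_fderiv (by simp)).clm_apply continuous_const
    have := integral_mul_fderiv_eq_neg_fderiv_mul_of_integrable (μ := volume) (𝕜 := ℝ)
      (f := fun _ : E m => (1 : ℝ)) (g := w) (v := v) ?_ ?_ ?_ ?_ ?_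
    · simpa using this
    · simp
    · simpa using hd.integrable_of_hasCompactSupport (hcs.fderiv_apply (𝕜 := ℝ) v)
    · simpa using hcd.continuous.integrable_of_hasCompactSupport hcs
    · exact fun x _ => differentiableAt_const _
    · exact fun x _ => hcd.differentiable (by simp) x
  · have : w =ᶠ[𝓝 x] fun _ => (0 : ℝ) := by
      filter_upwards [hK.isClosed.isOpen_compl.mem_nhds hx] with z hz using hwK hz
    rw [this.fderiv_eq]
    simp

end Analysis

/-! ### Smoothness and vanishing of the flux. -/

section Smoothness

variable {m k r : ℕ} {Y : Type*} [NormedAddCommGroup Y] [NormedSpace ℝ Y] {O : Set Y}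
  {d : Fin m → Y} {W : Fin m → Y → Matrix (Fin m) (Fin m) ℝ} {c : Y → Matrix (Fin m) (Fin m) ℝ}

theorem contDiffOn_curvR (hO : IsOpen O) (hW : ∀ μ, SmoothMat (W μ) O) (i j μ ν : Fin m) :
    ContDiffOn ℝ ∞ (fun y => curvR d W y i j μ ν) O :=
  ((smoothMat_curvM hO hW μ ν).mul (smoothMat_const (etaM m) O)) i j

theorem contDiffOn_fac {R : Y → Fin m → Fin m → Fin m → Fin m → ℝ} (hc : SmoothMat c O)
    (hR : ∀ i j μ ν, ContDiffOn ℝ ∞ (fun y => R y i j μ ν) O) (q : Fin k ⊕ Fin r)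
    (f g : Pos k r → Fin m) :
    ContDiffOn ℝ ∞ (fun y => fac (fun i j => c y i j) (R y) q f g) O := by
  rcases q with a | b
  · exact hc _ _
  · exact hR _ _ _ _

theorem contDiffOn_flux (hO : IsOpen O) (hW : ∀ μ, SmoothMat (W μ) O) (hc : SmoothMat c O) (w : Y)
    (b : Fin r) (π σ : Pos k r ≃ Fin m) : ContDiffOn ℝ ∞ (flux d W c w b π σ) O := by
  refine contDiffOn_prod fun q _ => ?_
  by_cases hq : q = .inr b
  · simp only [facW, if_pos hq]
    exact (((hW _).dMat hO w).mul (smoothMat_const (etaM m) O)) _ _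
  · simp only [facW, if_neg hq]
    exact contDiffOn_fac hc (contDiffOn_curvR hO hW) q _ _

theorem flux_eq_zero {w y : Y} (h : ∀ μ, dMat w (W μ) y = 0) (b : Fin r) (π σ : Pos k r ≃ Fin m) :
    flux d W c w b π σ y = 0 := by
  refine Finset.prod_eq_zero (Finset.mem_univ (.inr b)) ?_
  simp [facW, varR, h]

end Smoothness

/-! ### The first variation of the action. -/

section FirstVariation

variable {m : ℕ} {f : E m → ℝ} {P : Matrix (Fin m) (Fin m) ℝ} {s : E m → Coord m} {T : Set (E m)}

theorem fderiv_flowSection_fst (hf : ContDiff ℝ ∞ f) (hP : P * P = P) (hT : IsOpen T)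
    {e : E m → Matrix (Fin m) (Fin m) ℝ} (he : SmoothMat e T) (h0 : ∀ x ∈ T, (e x).det ≠ 0)
    {y : ℝ × E m} (hy : y.2 ∈ T) (w : ℝ × E m) : (fderiv ℝ (flowSection f P e) y w).1 = w.2 := by
  have hd : DifferentiableAt ℝ (flowSection f P e) y :=
    ((contDiffOn_flowSection hf hP hT he h0).contDiffAt
      ((isOpen_flow hT).mem_nhds ⟨mem_univ _, hy⟩)).differentiableAt (by simp)
  have h1 := HasFDerivAt.comp y (hasFDerivAt_fst (𝕜 := ℝ) (p := flowSection f P e y)) hd.hasFDerivAt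
  have h2 := h1.fderiv
  rw [show Prod.fst ∘ flowSection f P e = Prod.snd from rfl, fderiv_snd] at h2
  exact (congrArg (fun L => L w) h2).symm

/-- The connection matrices of the deformed sections. -/
noncomputable def flowConn (f : E m → ℝ) (P : Matrix (Fin m) (Fin m) ℝ)
    (e : E m → Matrix (Fin m) (Fin m) ℝ) (μ : Fin m) : ℝ × E m → Matrix (Fin m) (Fin m) ℝ :=
  pullConn (flowSection f P e) (spaceDir μ)

/-- The curvature components of a section of `T₀`. -/
noncomputable def sectionCurv (s : E m → Coord m) (x : E m) : Fin m → Fin m → Fin m → Fin m → ℝ :=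
  curvUpC (s x) fun a => fderiv ℝ s x (EuclideanSpace.single a 1)

/-- The algebraic part of the first variation of the Lagrangian. -/
noncomputable def algTerm {k r : ℕ} (ee : Pos k r ≃ Fin m) (s : E m → Coord m) (x : E m)
    (P : Matrix (Fin m) (Fin m) ℝ) : ℝ :=
  ∑ a, altSumWith ee (fun i j => (frameM (s x))⁻¹ i j) (sectionCurv s x) (.inl a)
    fun π σ => ((frameM (s x))⁻¹ * P) (π (.inl a)) (σ (.inl a))

/-- The coordinate expression of a section along which the metricity forms vanish. -/
structure IsMetricRep (s : E m → Coord m) (T : Set (E m)) : Prop where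
  isOpen : IsOpen T
  smooth : ContDiffOn ℝ ∞ s T
  fst : ∀ x ∈ T, (s x).1 = x
  det : ∀ x ∈ T, (frameM (s x)).det ≠ 0
  skew : ∀ x ∈ T, ∀ σ : Fin m, etaM m * pullConn s (EuclideanSpace.single σ 1) x +
    (etaM m * pullConn s (EuclideanSpace.single σ 1) x).transpose = 0

theorem IsMetricRep.smoothMat (h : IsMetricRep s T) : SmoothMat (fun x => frameM (s x)) T :=
  smoothMat_frameM_comp h.smooth

theorem IsMetricRep.smooth_flow (h : IsMetricRep s T) (hf : ContDiff ℝ ∞ f) (hP : P * P = P) :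
    ContDiffOn ℝ ∞ (flowSection f P fun x => frameM (s x)) (univ ×ˢ T) :=
  contDiffOn_flowSection hf hP h.isOpen h.smoothMat h.det

theorem IsMetricRep.det_flow (h : IsMetricRep s T) (hP : P * P = P) :
    ∀ y ∈ (univ : Set ℝ) ×ˢ T, (frameM (flowSection f P (fun x => frameM (s x)) y)).det ≠ 0 :=
  fun y hy => det_flowFrame (e := fun x => frameM (s x)) hP (h.det y.2 hy.2)

theorem IsMetricRep.differentiableAt_flow (h : IsMetricRep s T) (hf : ContDiff ℝ ∞ f)
    (hP : P * P = P) {y : ℝ × E m} (hy : y.2 ∈ T) :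
    DifferentiableAt ℝ (flowSection f P fun x => frameM (s x)) y :=
  ((h.smooth_flow hf hP).contDiffAt
    ((isOpen_flow h.isOpen).mem_nhds ⟨mem_univ _, hy⟩)).differentiableAt (by simp)

theorem IsMetricRep.flow_eq_self (h : IsMetricRep s T) (hf : ContDiff ℝ ∞ f) (hP : P * P = P)
    {t : ℝ} {x : E m} (hx : x ∈ T) (ht : ∀ᶠ z in 𝓝 x, t * f z = 0) :
    flowSection f P (fun x => frameM (s x)) (t, x) = s x :=
  flowSection_eq_self hf hP h.isOpen h.smooth h.fst h.det h.skew hx ht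

theorem IsMetricRep.flow_zero (h : IsMetricRep s T) (hf : ContDiff ℝ ∞ f) (hP : P * P = P)
    {x : E m} (hx : x ∈ T) : flowSection f P (fun x => frameM (s x)) (0, x) = s x :=
  h.flow_eq_self hf hP hx (Eventually.of_forall fun _ => zero_mul _)

theorem IsMetricRep.fderiv_flow (h : IsMetricRep s T) (hf : ContDiff ℝ ∞ f) (hP : P * P = P)
    {t : ℝ} {x : E m} (hx : x ∈ T) (ht : ∀ᶠ z in 𝓝 x, t * f z = 0) (v : E m) :
    fderiv ℝ (flowSection f P (fun x => frameM (s x))) (t, x) (0, v) = fderiv ℝ s x v := by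
  rw [← fderiv_slice (h.differentiableAt_flow hf hP hx)]
  have : (fun x' => flowSection f P (fun x => frameM (s x)) (t, x')) =ᶠ[𝓝 x] s := by
    filter_upwards [h.isOpen.mem_nhds hx, ht.eventually_nhds] with z hz hz'
    exact h.flow_eq_self hf hP hz hz'
  rw [this.fderiv_eq]

theorem IsMetricRep.fderiv_flow_zero (h : IsMetricRep s T) (hf : ContDiff ℝ ∞ f) (hP : P * P = P)
    {x : E m} (hx : x ∈ T) (v : E m) :
    fderiv ℝ (flowSection f P (fun x => frameM (s x))) (0, x) (0, v) = fderiv ℝ s x v :=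
  h.fderiv_flow hf hP hx (Eventually.of_forall fun _ => zero_mul _) v

theorem IsMetricRep.sectionCurv_eq (h : IsMetricRep s T) {x : E m} (hx : x ∈ T) :
    sectionCurv s x = curvR (fun a => EuclideanSpace.single a 1)
      (fun a => pullConn s (EuclideanSpace.single a 1)) x :=
  curvUpC_fderiv h.isOpen h.smooth h.det (fun a => EuclideanSpace.single a 1) hx

theorem IsMetricRep.curvR_flow_zero (h : IsMetricRep s T) (hf : ContDiff ℝ ∞ f) (hP : P * P = P)
    {x : E m} (hx : x ∈ T) :
    curvR spaceDir (flowConn f P fun x => frameM (s x)) (0, x) = sectionCurv s x := by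
  have h1 := curvUpC_fderiv (isOpen_flow h.isOpen) (h.smooth_flow hf hP) (h.det_flow hP) spaceDir
    (y := (0, x)) ⟨mem_univ _, hx⟩
  rw [h.flow_zero hf hP hx] at h1
  refine h1.symm.trans ?_
  rw [sectionCurv]
  congr 1
  funext a
  exact h.fderiv_flow_zero hf hP hx _

theorem IsMetricRep.flowConn_eq (h : IsMetricRep s T) (hf : ContDiff ℝ ∞ f) (hP : P * P = P)
    {y : ℝ × E m} (hy : y.2 ∈ T) (μ : Fin m) :
    flowConn f P (fun x => frameM (s x)) μ y = (flowFrame f P (fun x => frameM (s x)) y)⁻¹ *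
      (dMat (spaceDir μ) (flowFrame f P fun x => frameM (s x)) y +
        flowGamma f P (fun x => frameM (s x)) y μ * flowFrame f P (fun x => frameM (s x)) y) := by
  rw [flowConn, pullConn_eq (h.differentiableAt_flow hf hP hy)
    (fderiv_flowSection_fst hf hP h.isOpen h.smoothMat h.det hy _), gammaM_flowSection]
  rfl

theorem IsMetricRep.flowConn_of_eq_zero (h : IsMetricRep s T) (hf : ContDiff ℝ ∞ f) (hP : P * P = P)
    {t : ℝ} {x : E m} (hx : x ∈ T) (ht : ∀ᶠ z in 𝓝 x, t * f z = 0) (μ : Fin m) :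
    flowConn f P (fun x => frameM (s x)) μ (t, x) = pullConn s (EuclideanSpace.single μ 1) x := by
  rw [flowConn, pullConn, h.flow_eq_self hf hP hx ht, spaceDir, h.fderiv_flow hf hP hx ht, pullConn]

theorem IsMetricRep.smoothMat_flowConn (h : IsMetricRep s T) (hf : ContDiff ℝ ∞ f) (hP : P * P = P)
    (μ : Fin m) : SmoothMat (flowConn f P (fun x => frameM (s x)) μ) (univ ×ˢ T) :=
  smoothMat_pullConn (isOpen_flow h.isOpen) (h.smooth_flow hf hP) (h.det_flow hP) _

theorem IsMetricRep.smoothMat_coframe (h : IsMetricRep s T) (hf : ContDiff ℝ ∞ f) (hP : P * P = P) :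
    SmoothMat (fun y => (flowFrame f P (fun x => frameM (s x)) y)⁻¹) (univ ×ˢ T) :=
  (smoothMat_flowFrame hf h.smoothMat).inv (h.det_flow hP)

/-- The first variation of the Lagrangian along the flow. -/
theorem IsMetricRep.fderiv_lagrangian (h : IsMetricRep s T) (hf : ContDiff ℝ ∞ f) (hP : P * P = P)
    {k r : ℕ} (ee : Pos k r ≃ Fin m) {x : E m} (hx : x ∈ T) :
    fderiv ℝ (fun y => altSum ee (fun i j => (flowFrame f P (fun x => frameM (s x)) y)⁻¹ i j)
      (curvR spaceDir (flowConn f P fun x => frameM (s x)) y)) (0, x) (1, 0) =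
      -(f x * algTerm ee s x P) +
      2 * ∑ b, ∑ π : Pos k r ≃ Fin m, ∑ σ : Pos k r ≃ Fin m, sgn ee π * sgn ee σ *
        fderiv ℝ (fun x => flux spaceDir (flowConn f P fun x => frameM (s x))
          (fun y => (flowFrame f P (fun x => frameM (s x)) y)⁻¹) (1, 0) b π σ (0, x)) x
          (EuclideanSpace.single (σ (.inr (b, false))) 1) := by
  have hy : ((0 : ℝ), x) ∈ (univ : Set ℝ) ×ˢ T := ⟨mem_univ _, hx⟩
  have hO := isOpen_flow h.isOpen
  have hd : ∀ y ∈ (univ : Set ℝ) ×ˢ T, (flowFrame f P (fun x => frameM (s x)) y).det ≠ 0 :=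
    h.det_flow hP
  have hc0 : flowFrame f P (fun x => frameM (s x)) (0, x) = frameM (s x) :=
    flowFrame_eq_self (zero_mul _)
  rw [fderiv_altSum_curvR (O := univ ×ˢ T) ee hO (h.smoothMat_flowConn hf hP)
    (h.smoothMat_coframe hf hP) hy (fun μ => ?_) (fun μ i ν => ?_), h.curvR_flow_zero hf hP hx]
  · congr 1
    · rw [algTerm, ← neg_mul, Finset.mul_sum]
      refine Finset.sum_congr rfl fun a _ => ?_
      rw [← altSumWith_const_mul, hc0]
      congr 1
      funext π σ
      rw [dMat_inv hO (smoothMat_flowFrame hf h.smoothMat) hd hy,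
        dMat_time_flowFrame hf hP h.isOpen h.smoothMat hx, hc0, Matrix.mul_smul, Matrix.smul_mul,
        ← mul_assoc, mul_assoc _ (frameM (s x)), (det_inv_cancel (h.det x hx)).2, mul_one,
        Matrix.neg_apply, Matrix.smul_apply, smul_eq_mul, neg_mul]
    · congr 1
      refine Finset.sum_congr rfl fun b _ => Finset.sum_congr rfl fun π _ =>
        Finset.sum_congr rfl fun σ _ => ?_
      congr 1
      exact (fderiv_slice (((contDiffOn_flux hO (h.smoothMat_flowConn hf hP)
        (h.smoothMat_coframe hf hP) _ b π σ).contDiffAt (hO.mem_nhds hy)).differentiableAt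
          (by simp)) _).symm
  -- Skewness is needed only at t = 0, where the connection is that of the original section.
  · rw [h.flowConn_of_eq_zero hf hP hx (Eventually.of_forall fun _ => zero_mul _)]
    exact h.skew x hx μ
  · rw [h.flowConn_eq hf hP (y := (0, x)) hx, h.flowConn_eq hf hP (y := (0, x)) hx,
      torsion_free hO (smoothMat_flowFrame hf h.smoothMat) hd hy,
      torsion_free hO (smoothMat_flowFrame hf h.smoothMat) hd hy, Matrix.mul_apply,
      Matrix.mul_apply]
    exact Finset.sum_congr rfl fun ρ _ => congrArg _ (flowGamma_symm _ μ ρ ν)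

/-- Where f vanishes nearby, the connection does not depend on t, so the factor δω of the flux is
zero. -/
theorem IsMetricRep.flux_flow_eq_zero (h : IsMetricRep s T) (hf : ContDiff ℝ ∞ f) (hP : P * P = P)
    {k r : ℕ} {x : E m} (hx : x ∈ T) (hfx : ∀ᶠ z in 𝓝 x, f z = 0) (b : Fin r)
    (π σ : Pos k r ≃ Fin m) :
    flux spaceDir (flowConn f P fun x => frameM (s x))
      (fun y => (flowFrame f P (fun x => frameM (s x)) y)⁻¹) (1, 0) b π σ (0, x) = 0 := by
  refine flux_eq_zero (fun μ => ?_) b π σ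
  ext i j
  have h1 := hasDerivAt_time (((h.smoothMat_flowConn hf hP) μ).diffMat (isOpen_flow h.isOpen)
    (p := (0, x)) ⟨mem_univ _, hx⟩ i j)
  have h2 : (fun t' => flowConn f P (fun x => frameM (s x)) μ (t', x) i j) = fun _ =>
      pullConn s (EuclideanSpace.single μ 1) x i j := by
    funext t
    rw [h.flowConn_of_eq_zero hf hP hx (hfx.mono fun z hz => by rw [hz, mul_zero])]
  rw [h2] at h1
  exact h1.unique (hasDerivAt_const _ _)

theorem IsMetricRep.smoothMat_inv (h : IsMetricRep s T) :
    SmoothMat (fun x => (frameM (s x))⁻¹) T := h.smoothMat.inv h.det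

theorem IsMetricRep.contDiffOn_sectionCurv (h : IsMetricRep s T) (i j μ ν : Fin m) :
    ContDiffOn ℝ ∞ (fun x => sectionCurv s x i j μ ν) T := by
  refine (contDiffOn_curvR (d := fun a => EuclideanSpace.single a 1) h.isOpen (fun a =>
    smoothMat_pullConn h.isOpen h.smooth h.det (EuclideanSpace.single a 1)) i j μ ν).congr
    fun x hx => ?_
  rw [h.sectionCurv_eq hx]

theorem IsMetricRep.contDiffOn_algTerm (h : IsMetricRep s T) {k r : ℕ} (ee : Pos k r ≃ Fin m)
    (P : Matrix (Fin m) (Fin m) ℝ) : ContDiffOn ℝ ∞ (fun x => algTerm ee s x P) T := by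
  refine ContDiffOn.sum fun a _ => ContDiffOn.sum fun π _ => ContDiffOn.sum fun σ _ =>
    contDiffOn_const.mul (ContDiffOn.mul ?_ (contDiffOn_prod fun q _ => ?_))
  · exact (h.smoothMat_inv.mul (smoothMat_const P T)) _ _
  · exact contDiffOn_fac h.smoothMat_inv h.contDiffOn_sectionCurv q _ _

/-- The derivative of the action is minus the integral of f times the algebraic term plus integrals
of partial derivatives of fluxes. The latter vanish because each flux is zero on T outside K. -/
theorem IsMetricRep.integral_algTerm_eq_zero (h : IsMetricRep s T) (hf : ContDiff ℝ ∞ f)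
    (hP : P * P = P) {k r : ℕ} (ee : Pos k r ≃ Fin m) {K : Set (E m)} (hK : IsCompact K)
    (hKT : K ⊆ T) (hfK : ∀ x ∉ K, ∀ᶠ z in 𝓝 x, f z = 0)
    (hact : HasDerivAt (fun t : ℝ => ∫ x in K, altSum ee
      (fun i j => (flowFrame f P (fun x => frameM (s x)) (t, x))⁻¹ i j)
      (curvR spaceDir (flowConn f P fun x => frameM (s x)) (t, x))) 0 0) :
    ∫ x in K, f x * algTerm ee s x P = 0 := by
  have hO := isOpen_flow h.isOpen
  have hL : ContDiffOn ℝ ∞ (fun y => altSum ee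
      (fun i j => (flowFrame f P (fun x => frameM (s x)) y)⁻¹ i j)
      (curvR spaceDir (flowConn f P fun x => frameM (s x)) y)) (univ ×ˢ T) :=
    ContDiffOn.sum fun π _ => ContDiffOn.sum fun σ _ => contDiffOn_const.mul
      (contDiffOn_prod fun q _ => contDiffOn_fac (h.smoothMat_coframe hf hP)
        (contDiffOn_curvR hO (h.smoothMat_flowConn hf hP)) q _ _)
  have h1 := (hasDerivAt_setIntegral h.isOpen hL hK hKT).unique hact
  rw [MeasureTheory.setIntegral_congr_fun hK.measurableSet
    (fun x hx => h.fderiv_lagrangian hf hP ee (hKT hx))] at h1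
  have hsl : ∀ (b : Fin r) (π σ : Pos k r ≃ Fin m), ContDiffOn ℝ ∞ (fun x =>
      flux spaceDir (flowConn f P fun x => frameM (s x))
        (fun y => (flowFrame f P (fun x => frameM (s x)) y)⁻¹) (1, 0) b π σ (0, x)) T :=
    fun b π σ => (contDiffOn_flux hO (h.smoothMat_flowConn hf hP) (h.smoothMat_coframe hf hP) _ b
      π σ).comp (contDiff_const.prodMk contDiff_id).contDiffOn fun x hx => ⟨mem_univ _, hx⟩
  have hint : ∀ (b : Fin r) (π σ : Pos k r ≃ Fin m), MeasureTheory.IntegrableOn (fun x =>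
      sgn ee π * sgn ee σ * fderiv ℝ (fun x => flux spaceDir (flowConn f P fun x => frameM (s x))
        (fun y => (flowFrame f P (fun x => frameM (s x)) y)⁻¹) (1, 0) b π σ (0, x)) x
        (EuclideanSpace.single (σ (.inr (b, false))) 1)) K := fun b π σ =>
    ((((contDiffOn_fderiv_apply h.isOpen (hsl b π σ) _).continuousOn.mono hKT).integrableOn_compact
      hK)).const_mul _
  have hint' : MeasureTheory.IntegrableOn (fun x => -(f x * algTerm ee s x P)) K :=
    ((hf.continuous.continuousOn.mul
      ((h.contDiffOn_algTerm ee P).continuousOn.mono hKT)).integrableOn_compact hK).neg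
  rw [MeasureTheory.integral_add hint' ((MeasureTheory.integrable_finsetSum _ fun b _ =>
    MeasureTheory.integrable_finsetSum _ fun π _ => MeasureTheory.integrable_finsetSum _ fun σ _ =>
      hint b π σ).const_mul 2), MeasureTheory.integral_neg, MeasureTheory.integral_const_mul,
    MeasureTheory.integral_finsetSum _ (fun b _ => MeasureTheory.integrable_finsetSum _ fun π _ =>
      MeasureTheory.integrable_finsetSum _ fun σ _ => hint b π σ),
    Finset.sum_eq_zero, mul_zero, add_zero, neg_eq_zero] at h1
  · exact h1
  intro b _
  rw [MeasureTheory.integral_finsetSum _ (fun π _ =>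
    MeasureTheory.integrable_finsetSum _ fun σ _ => hint b π σ)]
  refine Finset.sum_eq_zero fun π _ => ?_
  rw [MeasureTheory.integral_finsetSum _ (fun σ _ => hint b π σ)]
  refine Finset.sum_eq_zero fun σ _ => ?_
  rw [MeasureTheory.integral_const_mul, setIntegral_fderiv_eq_zero h.isOpen (hsl b π σ) hK hKT
    (fun x hx hxK => h.flux_flow_eq_zero hf hP hx (hfK x hxK) b π σ), mul_zero]

end FirstVariation

/-! ### From stationarity to pointwise equations. -/

section EulerLagrange

variable {m : ℕ}

/-- Vanishing near the point is required because the Γ-component contains ∂f. -/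
theorem variationField_eq_zero {f : E m → ℝ} {P : Matrix (Fin m) (Fin m) ℝ} {v : Coord m}
    (h : ∀ᶠ z in 𝓝 v.1, f z = 0) : variationField f P v = 0 := by
  have h1 : f v.1 = 0 := h.self_of_nhds
  have h2 : ∀ σ, partialD f σ v.1 = 0 := fun σ => by
    rw [partialD, show fderiv ℝ f v.1 = 0 by
      rw [Filter.EventuallyEq.fderiv_eq (f₁ := f) (f := fun _ => (0 : ℝ)) h]; simp]
    rfl
  have h3 : covSource f P v = 0 := by
    funext σ
    simp [covSource, covEnd, h1, h2]
  have h4 : fieldGamma f P v = 0 := by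
    funext σ
    have : koszul (covSource f P v) σ = 0 := by
      rw [h3]; ext i j; simp [koszul]
    simp [fieldGamma, this]
  rw [variationField, h1, h4, zero_smul]
  exact Prod.ext rfl (Prod.ext rfl (map_zero (symArray m)))

/-- The matrices E_ii and, for i ≠ j, E_ii + E_ij are idempotent, and together they span. This
removes the restriction to idempotent P under which the flow is explicit. -/
theorem linearMap_eq_zero_of_idempotent {V : Type*} [Fintype V] [DecidableEq V]
    (ℓ : Matrix V V ℝ →ₗ[ℝ] ℝ) (h : ∀ P, P * P = P → ℓ P = 0) (A : Matrix V V ℝ) : ℓ A = 0 := by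
  have h1 : ∀ i j, ℓ (Matrix.single i j 1) = 0 := by
    intro i j
    have hi : ℓ (Matrix.single i i 1) = 0 := h _ (by simp)
    by_cases hij : i = j
    · subst hij; exact hi
    · have h2 := h (Matrix.single i i 1 + Matrix.single i j 1) (by
        simp [mul_add, add_mul, Ne.symm hij, Matrix.single_mul_single_of_ne])
      rwa [map_add, hi, zero_add] at h2
  rw [Matrix.matrix_eq_sum_single A]
  simp only [map_sum]
  refine Finset.sum_eq_zero fun i _ => Finset.sum_eq_zero fun j _ => ?_
  rw [show Matrix.single i j (A i j) = A i j • Matrix.single i j (1 : ℝ) by simp, map_smul, h1,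
    smul_zero]

/-- The algebraic part of the first variation, as a linear map. -/
noncomputable def algTermL {k r : ℕ} (ee : Pos k r ≃ Fin m) (s : E m → Coord m) (x : E m) :
    Matrix (Fin m) (Fin m) ℝ →ₗ[ℝ] ℝ where
  toFun := algTerm ee s x
  map_add' A B := by
    simp only [algTerm, ← Finset.sum_add_distrib, mul_add, Matrix.add_apply]
    exact Finset.sum_congr rfl fun a _ => altSumWith_add _ _ _ _ _ _
  map_smul' a A := by
    simp only [algTerm, Finset.mul_sum, Matrix.mul_smul, Matrix.smul_apply, smul_eq_mul,
      RingHom.id_apply]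
    exact Finset.sum_congr rfl fun b _ => altSumWith_const_mul _ _ _ _ _ _

/-- The constant relating the Lagrangian to the alternating sum of its components. -/
noncomputable def lagrangianConst (m r : ℕ) (h : m - (r + r) + 2 * r = m) : ℝ :=
  ((m - (r + r)).factorial : ℝ)⁻¹ * (1 / 2) ^ r *
    sgn ((upperEquiv (m - (r + r)) r).trans (finCongr (by omega : _ = m)))
      ((lowerEquiv (m - (r + r)) r).trans (finCongr h))

theorem lagrangianConst_ne_zero (m r : ℕ) (h : m - (r + r) + 2 * r = m) :
    lagrangianConst m r h ≠ 0 :=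
  mul_ne_zero (mul_ne_zero (inv_ne_zero (by positivity)) (by positivity)) (sgn_ne_zero _ _)

variable {s : E m → Coord m} {T : Set (E m)} {f : E m → ℝ} {P : Matrix (Fin m) (Fin m) ℝ}

theorem IsMetricRep.action_flow (h : IsMetricRep s T) (hf : ContDiff ℝ ∞ f) (hP : P * P = P)
    {r : ℕ} (hr : 2 * r ≤ m) (hr' : m - (r + r) + 2 * r = m) {K : Set (E m)} (hK : IsCompact K)
    (hKT : K ⊆ T) (t : ℝ) :
    action r hr K (fun x => flowSection f P (fun x => frameM (s x)) (t, x)) =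
      lagrangianConst m r hr' * ∫ x in K, altSum ((lowerEquiv (m - (r + r)) r).trans (finCongr hr'))
      (fun i j => (flowFrame f P (fun x => frameM (s x)) (t, x))⁻¹ i j)
      (curvR spaceDir (flowConn f P fun x => frameM (s x)) (t, x)) := by
  rw [action, ← MeasureTheory.integral_const_mul]
  refine MeasureTheory.setIntegral_congr_fun hK.measurableSet fun x hx => ?_
  have hd := h.differentiableAt_flow hf hP (y := (t, x)) (hKT hx)
  have h1 := lagrangian_apply hr' (flowSection f P (fun x => frameM (s x)) (t, x))
    fun a => fderiv ℝ (flowSection f P fun x => frameM (s x)) (t, x) (spaceDir a)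
  rw [curvUpC_fderiv (isOpen_flow h.isOpen) (h.smooth_flow hf hP) (h.det_flow hP) spaceDir
    (y := (t, x)) ⟨mem_univ _, hKT hx⟩, thetaC_fderiv (fun a => fderiv_flowSection_fst hf hP
      h.isOpen h.smoothMat h.det (hKT hx) _)] at h1
  refine Eq.trans ?_ h1
  refine congrArg (lagrangian m r _) ?_
  funext a
  exact fderiv_slice hd _

variable {M : Type*} [TopologicalSpace M] [ChartedSpace (E m) M] [IsManifold (𝓡 m) ∞ M]

theorem isMetricRep_localRep {S : T0Section m M} (hS : IsIntegral S)
    (φ : OpenPartialHomeomorph M (E m)) (hφ : φ ∈ IsManifold.maximalAtlas (𝓡 m) ∞ M) :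
    IsMetricRep (localRep φ hφ S.toFun) φ.target where
  isOpen := φ.open_target
  smooth := S.smooth φ hφ
  fst _ hx := localRep_fst φ hφ S.toFun hx
  det _ hx := det_localRep φ hφ S.toFun hx
  skew _ hx _ := skew_of_isIntegral hS φ hφ hx _

/-- The Euler-Lagrange equations. -/
theorem algTerm_eq_zero {r : ℕ} {hr : 2 * r ≤ m} {S : T0Section m M} (hS : IsExtremal r hr S)
    (hr' : m - (r + r) + 2 * r = m) (φ : OpenPartialHomeomorph M (E m))
    (hφ : φ ∈ IsManifold.maximalAtlas (𝓡 m) ∞ M) {x : E m} (hx : x ∈ φ.target)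
    (A : Matrix (Fin m) (Fin m) ℝ) :
    algTerm ((lowerEquiv (m - (r + r)) r).trans (finCongr hr')) (localRep φ hφ S.toFun) x A = 0 := by
  set s := localRep φ hφ S.toFun with hs
  set ee := (lowerEquiv (m - (r + r)) r).trans (finCongr hr')
  have h : IsMetricRep s φ.target := isMetricRep_localRep hS.1 φ hφ
  refine linearMap_eq_zero_of_idempotent (algTermL ee s x) (fun P hP => ?_) A
  have hcont := (h.contDiffOn_algTerm ee P).continuousOn
  -- Fundamental lemma of the calculus of variations: every smooth f with compact support in the
  -- chart is a legitimate variation.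
  have hae : ∀ᵐ z, z ∈ φ.target → algTerm ee s z P = 0 := by
    refine IsOpen.ae_eq_zero_of_integral_contDiff_smul_eq_zero h.isOpen
      (hcont.locallyIntegrableOn h.isOpen.measurableSet) fun f hf hfc hfs => ?_
    have hf0 : ∀ z ∉ tsupport f, ∀ᶠ w in 𝓝 z, f w = 0 := fun z hz =>
      notMem_tsupport_iff_eventuallyEq.1 hz
    have hdet : ∀ v ∈ coordDomain φ, (frameM v).det ≠ 0 := fun v hv => hv.2
    -- The compact set is the support of f. The deformation exists for all times, so the bound 1 on
    -- the time is arbitrary.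
    have hact := hS.2 φ hφ (variationField f P) (tsupport f)
      (contDiffOn_variationField hf P hdet) (fun _ _ => rfl)
      (isInfinitesimalSymmetry_variationField hf P (isOpen_frame _ h.isOpen) hdet) hfc hfs
      (fun v _ hv => variationField_eq_zero (hf0 _ hv)) 1
      (fun t x => flowSection f P (fun x => frameM (s x)) (t, x)) one_pos
      ((h.smooth_flow hf hP).mono (prod_mono (subset_univ _) Subset.rfl))
      (fun x hx => h.flow_zero hf hP hx)
      (fun t _ x hx => ⟨⟨hx, h.det_flow hP (t, x) ⟨mem_univ _, hx⟩⟩,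
        hasDerivAt_flowSection hf hP h.isOpen h.smoothMat h.det t hx⟩)
    simp only [h.action_flow hf hP hr hr' hfc hfs] at hact
    have hC := lagrangianConst_ne_zero m r hr'
    have h1 := h.integral_algTerm_eq_zero hf hP ee hfc hfs hf0 (by
      have := hact.const_mul (lagrangianConst m r hr')⁻¹
      simpa only [← mul_assoc, inv_mul_cancel₀ hC, one_mul, mul_zero] using this)
    rw [← h1, MeasureTheory.setIntegral_eq_integral_of_forall_compl_eq_zero fun z hz => by
      rw [image_eq_zero_of_notMem_tsupport hz, zero_mul]]
    simp only [smul_eq_mul]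
  -- Continuity upgrades vanishing almost everywhere to vanishing at every point of the open chart
  -- range.
  refine MeasureTheory.Measure.eqOn_open_of_ae_eq (μ := MeasureTheory.volume) (g := fun _ => (0 : ℝ))
    ?_ h.isOpen hcont continuousOn_const hx
  exact (MeasureTheory.ae_restrict_iff' h.isOpen.measurableSet).2 hae

end EulerLagrange

/-! ### The algebra that turns the Euler-Lagrange equations into the field equations. -/

section FieldEquations

variable {m : ℕ}

/-- Skew connections have skew curvature. -/
theorem curvM_skew {Y : Type*} [NormedAddCommGroup Y] [NormedSpace ℝ Y] {O : Set Y}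
    {d : Fin m → Y} {W : Fin m → Y → Matrix (Fin m) (Fin m) ℝ} (hO : IsOpen O)
    (hW : ∀ μ, SmoothMat (W μ) O)
    (h : ∀ y ∈ O, ∀ μ, etaM m * W μ y + (etaM m * W μ y).transpose = 0) {y : Y} (hy : y ∈ O)
    (μ ν : Fin m) :
    etaM m * curvM d W μ ν y + (etaM m * curvM d W μ ν y).transpose = 0 := by
  have h1 : ∀ μ w, etaM m * dMat w (W μ) y + (etaM m * dMat w (W μ) y).transpose = 0 := by
    intro μ w
    have hη := diffMat_const (etaM m) y
    have hWy := (hW μ).diffMat hO hy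
    have h2 : (fun y => etaM m * W μ y + (etaM m * W μ y).transpose) =ᶠ[𝓝 y] fun _ => 0 := by
      filter_upwards [hO.mem_nhds hy] with z hz using h z hz μ
    have h3 := dMat_congr h2 w
    rwa [dMat_const, dMat_add (hη.mul hWy) (hη.mul hWy).transpose, dMat_transpose,
      dMat_mul hη hWy, dMat_const, zero_mul, zero_add] at h3
  have h4 : ∀ μ, (W μ y).transpose = -(etaM m * W μ y * etaM m) := by
    intro μ
    rw [mul_assoc, skew_mul_eta (h y hy μ), mul_neg, neg_neg, ← mul_assoc, etaM_mul_self, one_mul]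
  have h5 : ∀ μ ν, (etaM m * (W μ y * W ν y)).transpose = etaM m * (W ν y * W μ y) := by
    intro μ ν
    rw [Matrix.transpose_mul, Matrix.transpose_mul, etaM_transpose, h4, h4]
    simp only [neg_mul, mul_neg, neg_neg, mul_assoc, etaM_mul_self, mul_one]
    rw [← mul_assoc (etaM m) (etaM m), etaM_mul_self, one_mul]
  simp only [curvM, mul_add, mul_sub, Matrix.transpose_add, Matrix.transpose_sub, h5]
  have h6 := h1 ν (d μ)
  have h7 := h1 μ (d ν)
  rw [← sub_eq_zero.2 (h6.trans h7.symm)]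
  abel

theorem IsMetricRep.sectionCurv_antisymm {s : E m → Coord m} {T : Set (E m)} (h : IsMetricRep s T)
    {x : E m} (hx : x ∈ T) (i j μ ν : Fin m) :
    sectionCurv s x i j μ ν = -sectionCurv s x j i μ ν := by
  rw [h.sectionCurv_eq hx]
  have h1 := skew_mul_eta (curvM_skew (d := fun a => EuclideanSpace.single a 1) h.isOpen (fun a =>
    smoothMat_pullConn h.isOpen h.smooth h.det (EuclideanSpace.single a 1)) h.skew hx μ ν)
  have h2 := congrFun (congrFun h1 i) j
  rw [Matrix.neg_apply, ← Matrix.transpose_apply (etaM m * _), Matrix.transpose_mul,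
    Matrix.transpose_transpose, etaM_transpose] at h2
  exact h2

theorem altSum_eq_altSumWith {V : Type*} [Fintype V] [DecidableEq V] {k r : ℕ} (e : Pos k r ≃ V)
    (c : V → V → ℝ) (R : V → V → V → V → ℝ) (b : Fin r) :
    altSum e c R = altSumWith e c R (.inr b) fun π σ => R (π (.inr (b, false)))
      (π (.inr (b, true))) (σ (.inr (b, false))) (σ (.inr (b, true))) := by
  refine Finset.sum_congr rfl fun π _ => Finset.sum_congr rfl fun σ _ => congrArg _ ?_
  exact (Finset.mul_prod_erase _ _ (Finset.mem_univ (Sum.inr b))).symm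

/-- If the algebraic variation vanishes, then so does its curvature counterpart, up to the trace. -/
theorem altSumWith_curv_of_algTerm {n k : ℕ} (ee : Pos k (n + 1) ≃ Fin m) {s : E m → Coord m}
    {x : E m} (hdet : (frameM (s x)).det ≠ 0)
    (hR : ∀ i j μ ν, sectionCurv s x i j μ ν = -sectionCurv s x j i μ ν)
    (h : ∀ A, algTerm ee s x A = 0) (l i : Fin m) :
    2 * ((n + 1 : ℕ) : ℝ) * (altSumWith ee (fun i j => (frameM (s x))⁻¹ i j) (sectionCurv s x)
        (.inr 0) fun π σ => if π (.inr (0, true)) = i then sectionCurv s x (π (.inr (0, false))) l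
          (σ (.inr (0, false))) (σ (.inr (0, true))) else 0) =
      (if l = i then 1 else 0) *
        altSum ee (fun i j => (frameM (s x))⁻¹ i j) (sectionCurv s x) := by
  set c := (frameM (s x))⁻¹ with hc
  set R := sectionCurv s x
  set A : Matrix (Fin m) (Fin m) ℝ := Matrix.single i l 1 with hA
  -- This argument is chosen so that its product with e⁻¹ is A e⁻¹: the variation then acts as A on
  -- the frame index of each coframe factor, as `altSum_slot` requires.
  have h1 := h (frameM (s x) * (A * c))
  rw [algTerm, ← hc, ← mul_assoc, (det_inv_cancel hdet).1, one_mul] at h1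
  have h2 := altSum_slot ee (fun i j => c i j) R fun i j => A i j
  have h1' : (∑ a, altSumWith ee (fun i j => c i j) R (.inl a) fun π σ =>
      ∑ l, A (π (.inl a)) l * c l (σ (.inl a))) = 0 := h1
  rw [h1', zero_add] at h2
  have h3 : ∀ b : Fin (n + 1), (altSumWith ee (fun i j => c i j) R (.inr b) fun π σ =>
      ∑ l, A (π (.inr (b, true))) l *
        R (π (.inr (b, false))) l (σ (.inr (b, false))) (σ (.inr (b, true)))) =
      altSumWith ee (fun i j => c i j) R (.inr 0) fun π σ => if π (.inr (0, true)) = i then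
        R (π (.inr (0, false))) l (σ (.inr (0, false))) (σ (.inr (0, true))) else 0 := by
    intro b
    rw [← altSumWith_swapBlocks ee _ R b 0 fun i₁ j₁ μ ν => if j₁ = i then R i₁ l μ ν else 0]
    congr 1
    funext π σ
    by_cases hi : π (.inr (b, true)) = i
    · rw [if_pos hi, Finset.sum_eq_single l]
      · simp [hA, hi]
      · intro j _ hj; simp [hA, Ne.symm hj]
      · simp
    · rw [if_neg hi]
      exact Finset.sum_eq_zero fun j _ => by simp [hA, Ne.symm hi]
  -- Two frame indices in each of the n + 1 curvature blocks give 2(n + 1) equal terms, while the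
  -- trace of A = E_il gives δ.
  rw [Finset.sum_congr rfl fun b _ => congrArg₂ (· + ·)
    ((altSum_slot_swap ee (fun i j => c i j) R hR (fun i j => A i j) b).trans (h3 b)) (h3 b)] at h2
  have h4 : ∑ j, A j j = if l = i then 1 else 0 := by
    rw [Finset.sum_eq_single i]
    · simp [hA, Matrix.single_apply]
    · intro j _ hj; simp [hA, Ne.symm hj]
    · simp
  rw [h4, Finset.sum_const, Finset.card_univ, Fintype.card_fin, nsmul_eq_mul] at h2
  rw [← h2]
  ring

/-- A form of top degree is determined by its value on the standard basis; any injective choice of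
basis vectors is a permutation of it. -/
theorem eq_zero_of_topCoeff {N : ℕ} (h : N = m) {α : E m [⋀^Fin N]→L[ℝ] ℝ}
    (hα : topCoeff h α = 0) : α = 0 := by
  subst h
  apply ContinuousAlternatingMap.toAlternatingMap_injective
  refine (EuclideanSpace.basisFun (Fin N) ℝ).toBasis.ext_alternating fun v hv => ?_
  have h1 : ∀ σ : Equiv.Perm (Fin N),
      α.toAlternatingMap (fun a => (EuclideanSpace.basisFun (Fin N) ℝ).toBasis (σ a)) = 0 := by
    intro σ
    have h2 := α.toAlternatingMap.map_perm
      (fun a => (EuclideanSpace.basisFun (Fin N) ℝ).toBasis a) σ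
    have h3 : α.toAlternatingMap (fun a => (EuclideanSpace.basisFun (Fin N) ℝ).toBasis a) = 0 := by
      simpa [topCoeff] using hα
    rw [h3, smul_zero] at h2
    exact h2
  exact h1 (Equiv.ofBijective v (Finite.injective_iff_bijective.1 hv))

theorem fieldForm_pullback_eq_zero {n : ℕ} {s : E m → Coord m} {T : Set (E m)}
    (hs : IsMetricRep s T) (h : m - (n + 1 + (n + 1)) + 2 * (n + 1) = m) {x : E m} (hx : x ∈ T)
    (hA : ∀ A, algTerm ((lowerEquiv (m - (n + 1 + (n + 1))) (n + 1)).trans (finCongr h)) s x A = 0)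
    (l i : Fin m) : pullback s (fieldForm m (n + 1) l i) x = 0 := by
  have hdim : m - (n + 1 - 1 + 1 + (n + 1 - 1 + 1)) + 2 + 2 * (n + 1 - 1) = m := by
    simp only [Nat.add_sub_cancel]; omega
  set ee := (lowerEquiv (m - (n + 1 + (n + 1))) (n + 1)).trans (finCongr h)
  have hsx : DifferentiableAt ℝ s x :=
    (hs.smooth.contDiffAt (hs.isOpen.mem_nhds hx)).differentiableAt (by simp)
  have hfst : ∀ v : E m, (fderiv ℝ s x v).1 = v :=
    fst_fderiv_of_section hs.isOpen hsx hs.fst hx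
  have h1 := fieldForm_apply hdim h (s x) (fun a => fderiv ℝ s x (EuclideanSpace.single a 1)) l i
  have hθ := thetaC_fderiv (F := s) (y := x) (d := fun a => EuclideanSpace.single a 1)
    fun a => hfst _
  have hκ := altSumWith_curv_of_algTerm ee (hs.det x hx) (hs.sectionCurv_antisymm hx) hA l i
  have h2 : fieldForm m (n + 1) l i (s x)
      (fun a => fderiv ℝ s x (EuclideanSpace.single (Fin.cast hdim a) 1)) = 0 := by
    rw [h1, hθ]
    refine mul_eq_zero_of_right _ ?_
    rw [show curvUpC (s x) (fun a => fderiv ℝ s x (EuclideanSpace.single a 1)) =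
      sectionCurv s x from rfl]
    simp only [sub_eq_add_neg, ← neg_mul]
    rw [altSumWith_add, altSumWith_const_mul ee _ _ (.inr 0) _ fun π σ => sectionCurv s x
      (π (.inr (0, false))) (π (.inr (0, true))) (σ (.inr (0, false))) (σ (.inr (0, true))),
      ← altSum_eq_altSumWith]
    have hn : ((n + 1 : ℕ) : ℝ) ≠ 0 := by positivity
    field_simp
    -- The trace term of the field form is 1/(2r) δ times the full alternating sum, which is what
    -- `hκ` assigns to the first term.
    linear_combination hκ
  exact eq_zero_of_topCoeff hdim h2

end FieldEquations

end Lovelock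

theorem mainTheorem1 (m r : ℕ) (hr : 1 ≤ r) (hrm : r < m / 2)
    (M : Type*) [TopologicalSpace M] [T2Space M] [ParacompactSpace M] [ConnectedSpace M]
    [ChartedSpace (EuclideanSpace ℝ (Fin m)) M] [IsManifold (𝓡 m) ∞ M]
    (S : Lovelock.T0Section m M)
    (hS : Lovelock.IsExtremal r (by omega) S)
    (φ : OpenPartialHomeomorph M (EuclideanSpace ℝ (Fin m)))
    (hφ : φ ∈ IsManifold.maximalAtlas (𝓡 m) ∞ M)
    (p : EuclideanSpace ℝ (Fin m)) (hp : p ∈ φ.target) (k i : Fin m) :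
    Lovelock.pullback (Lovelock.localRep φ hφ S.toFun) (Lovelock.fieldForm m r k i) p = 0 := by
  obtain ⟨n, rfl⟩ : ∃ n, r = n + 1 := ⟨r - 1, by omega⟩
  have h : m - (n + 1 + (n + 1)) + 2 * (n + 1) = m := by omega
  exact Lovelock.fieldForm_pullback_eq_zero (Lovelock.isMetricRep_localRep hS.1 φ hφ) h hp
    (fun A => Lovelock.algTerm_eq_zero hS h φ hφ hp A) k i
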